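/- Let $k$ be an algebraically closed field of characteristic zero, let $G$ be a (possibly disconnected) linear algebraic group over $k$, and let $X$ be a $G$-variety, i.e. an integral, separated scheme of finite type over $k$ with an algebraic left action of $G$. Let $y \in X(k)$, let $G_y \subset G$ be its (scheme-theoretic) stabilizer, and let $i : Z \hookrightarrow X$ be a closed $G_y$-stable subvariety. Let $q : G \times Z \to G \wedge_{G_y} Z$ be the contracted product, i.e. the quotient of $G \times Z$ by the right action $(g,z)\cdot h = (gh, h^{-1}z)$ of $G_y$, for which $q$ is a right $G_y$-torsor ($q$ is faithfully flat, quasi-compact and $G_y$-invariant, and $(p,h) \mapsto (p\cdot h, p)$ is an isomorphism from $(G\times Z)\times G_y$ onto the fibre product of $G \times Z$ with itself over $G\wedge_{G_y}Z$). Suppose that the multiplication map $m : G \wedge_{G_y} Z \to X$, induced by $(g,z) \mapsto g\cdot i(z)$, is an isomorphism. For a linear algebraic group $H$ and an $H$-variety $T$ with action map $a : H \times T \to T$, let $\mathsf{Vec}^H(T)$ be the category of $H$-equivariant vector bundles on $T$: its objects are pairs $(\mathcal V, \varphi)$ of a locally free sheaf $\mathcal V$ of finite rank on $T$ and an isomorphism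 $\varphi : a^*\mathcal V \to p_2^*\mathcal V$ on $H \times T$ satisfying the cocycle condition $(\mu \times 1)^*\varphi = p_{23}^*\varphi \circ (1 \times a)^*\varphi$ on $H \times H \times T$ ($\mu$ being the multiplication of $H$), and its morphisms are the $\mathcal O_T$-linear maps compatible with the isomorphisms $\varphi$. Then the restriction functor $i^* : \mathsf{Vec}^G(X) \to \mathsf{Vec}^{G_y}(Z)$ is an equivalence of categories. -/

import Mathlib

open CategoryTheory MonoidalCategory CartesianMonoidalCategory MonObj AlgebraicGeometry
universe u v

noncomputable section

namespace AlgebraicGeometry.Scheme.Modules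

/-- The pullback along `g : W' ⟶ W` of a morphism `φ : f₁^* M ⟶ f₂^* N` of modules on `W`, seen as a
morphism `(g ≫ f₁)^* M ⟶ (g ≫ f₂)^* N` through the canonical isomorphisms `g^* f^* ≅ (g ≫ f)^*`. -/
def pullHom {X₁ X₂ W W' : Scheme.{u}} {M : X₁.Modules} {N : X₂.Modules}
    {f₁ : W ⟶ X₁} {f₂ : W ⟶ X₂} (φ : (pullback f₁).obj M ⟶ (pullback f₂).obj N)
    (g : W' ⟶ W) {g₁ : W' ⟶ X₁} {g₂ : W' ⟶ X₂} (h₁ : g ≫ f₁ = g₁) (h₂ : g ≫ f₂ = g₂) :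
    (pullback g₁).obj M ⟶ (pullback g₂).obj N :=
  (pullbackCongr h₁.symm).hom.app M ≫ (pullbackComp g f₁).inv.app M ≫ (pullback g).map φ ≫
    (pullbackComp g f₂).hom.app N ≫ (pullbackCongr h₂).hom.app N

/-- A morphism `ψ : g₁^* M ⟶ g₂^* N`, where `b₁ ≫ f₁ = g₁` and `b₂ ≫ f₂ = g₂`, seen as a morphism
`b₁^* f₁^* M ⟶ b₂^* f₂^* N` through the canonical isomorphisms `b^* f^* ≅ (b ≫ f)^*`. -/
def restrHom {X₁ X₂ Z W : Scheme.{u}} {M : X₁.Modules} {N : X₂.Modules} {b₁ b₂ : W ⟶ Z}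
    {f₁ : Z ⟶ X₁} {f₂ : Z ⟶ X₂} {g₁ : W ⟶ X₁} {g₂ : W ⟶ X₂} (h₁ : b₁ ≫ f₁ = g₁)
    (h₂ : b₂ ≫ f₂ = g₂) (ψ : (pullback g₁).obj M ⟶ (pullback g₂).obj N) :
    (pullback b₁).obj ((pullback f₁).obj M) ⟶ (pullback b₂).obj ((pullback f₂).obj N) :=
  (pullbackComp b₁ f₁).hom.app M ≫ (pullbackCongr h₁).hom.app M ≫ ψ ≫
    (pullbackCongr h₂.symm).hom.app N ≫ (pullbackComp b₂ f₂).inv.app N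

@[simp] lemma pullbackCongr_rfl {X Y : Scheme.{u}} {f : X ⟶ Y} (h : f = f) (M : Y.Modules) :
    (pullbackCongr h).hom.app M = 𝟙 _ := rfl

lemma pullbackComp_assoc_app {X Y Z T : Scheme.{u}} (f : X ⟶ Y) (g : Y ⟶ Z) (h : Z ⟶ T)
    (M : T.Modules) :
    (pullback f).map ((pullbackComp g h).hom.app M) ≫ (pullbackComp f (g ≫ h)).hom.app M =
      (pullbackComp f g).hom.app ((pullback h).obj M) ≫ (pullbackComp (f ≫ g) h).hom.app M ≫
        (pullbackCongr (Category.assoc f g h)).hom.app M := by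
  have H := NatTrans.congr_app (pseudofunctor_associativity f g h) M
  simp only [NatTrans.comp_app, Functor.whiskerRight_app, Functor.associator_hom_app,
    Functor.whiskerLeft_app, eqToHom_app] at H
  have H2 : (pullbackCongr (Category.assoc f g h)).hom.app M = eqToHom (by simp) := by
    simp [pullbackCongr]
  rw [H2]
  have e1 : (pullbackComp f (g ≫ h)).hom.app M ≫ (pullbackComp f (g ≫ h)).inv.app M = 𝟙 _ :=
    Iso.hom_inv_id_app _ _
  have e2 : (pullback f).map ((pullbackComp g h).hom.app M) ≫
      (pullback f).map ((pullbackComp g h).inv.app M) = 𝟙 _ := by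
    rw [← Functor.map_comp, Iso.hom_inv_id_app]; exact CategoryTheory.Functor.map_id _ _
  have H3 := congrArg (fun t => (pullback f).map ((pullbackComp g h).hom.app M) ≫
    (pullbackComp f (g ≫ h)).hom.app M ≫ t ≫ eqToHom
      (show (pullback ((f ≫ g) ≫ h)).obj M = (pullback (f ≫ g ≫ h)).obj M by simp)) H
  simp only [Category.assoc, eqToHom_trans, eqToHom_refl, Category.comp_id] at H3
  rw [reassoc_of% e1, reassoc_of% e2] at H3
  erw [Category.id_comp] at H3
  exact H3.symm

lemma map_pullbackComp_hom_app {X Y Z T : Scheme.{u}} (f : X ⟶ Y) (g : Y ⟶ Z) (h : Z ⟶ T)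
    (M : T.Modules) :
    (pullback f).map ((pullbackComp g h).hom.app M) =
      (pullbackComp f g).hom.app ((pullback h).obj M) ≫ (pullbackComp (f ≫ g) h).hom.app M ≫
        (pullbackCongr (Category.assoc f g h)).hom.app M ≫
          (pullbackComp f (g ≫ h)).inv.app M := by
  have e1 : (pullbackComp f (g ≫ h)).hom.app M ≫ (pullbackComp f (g ≫ h)).inv.app M = 𝟙 _ :=
    Iso.hom_inv_id_app _ _
  have H := congrArg (· ≫ (pullbackComp f (g ≫ h)).inv.app M) (pullbackComp_assoc_app f g h M)
  simp only [Category.assoc, e1] at H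
  rw [← H]
  exact (Category.comp_id _).symm

lemma pullbackCongr_hom_app_trans {X Y : Scheme.{u}} {f g h : X ⟶ Y} (e : f = g) (e' : g = h)
    (M : Y.Modules) :
    (pullbackCongr e).hom.app M ≫ (pullbackCongr e').hom.app M =
      (pullbackCongr (e.trans e')).hom.app M := by
  subst e e'; exact Category.comp_id _

lemma map_pullbackComp_inv_app {X Y Z T : Scheme.{u}} (f : X ⟶ Y) (g : Y ⟶ Z) (h : Z ⟶ T)
    (M : T.Modules) :
    (pullback f).map ((pullbackComp g h).inv.app M) =
      (pullbackComp f (g ≫ h)).hom.app M ≫ (pullbackCongr (Category.assoc f g h).symm).hom.app M ≫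
        (pullbackComp (f ≫ g) h).inv.app M ≫
          (pullbackComp f g).inv.app ((pullback h).obj M) := by
  have e0 : (pullback f).map ((pullbackComp g h).hom.app M) ≫
      (pullback f).map ((pullbackComp g h).inv.app M) = 𝟙 _ := by
    rw [← Functor.map_comp, Iso.hom_inv_id_app]; exact CategoryTheory.Functor.map_id _ _
  have : IsIso ((pullback f).map ((pullbackComp g h).hom.app M)) := inferInstance
  rw [← cancel_epi ((pullback f).map ((pullbackComp g h).hom.app M)), e0,
    map_pullbackComp_hom_app]
  have e1 : (pullbackComp f (g ≫ h)).inv.app M ≫ (pullbackComp f (g ≫ h)).hom.app M = 𝟙 _ :=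
    Iso.inv_hom_id_app _ _
  have e2 : (pullbackComp (f ≫ g) h).hom.app M ≫ (pullbackComp (f ≫ g) h).inv.app M = 𝟙 _ :=
    Iso.hom_inv_id_app _ _
  have e3 : (pullbackComp f g).hom.app ((pullback h).obj M) ≫
      (pullbackComp f g).inv.app ((pullback h).obj M) = 𝟙 _ := Iso.hom_inv_id_app _ _
  have e4 : (pullbackCongr (Category.assoc f g h)).hom.app M ≫
      (pullbackCongr (Category.assoc f g h).symm).hom.app M = 𝟙 _ :=
    pullbackCongr_hom_app_trans _ _ _
  simp only [Category.assoc]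
  rw [reassoc_of% e1, reassoc_of% e4, reassoc_of% e2, e3]
  rfl

lemma pullHom_restrHom {X₁ X₂ Z W W' : Scheme.{u}} {M : X₁.Modules} {N : X₂.Modules}
    {b₁ b₂ : W ⟶ Z} {f₁ : Z ⟶ X₁} {f₂ : Z ⟶ X₂} {g₁ : W ⟶ X₁} {g₂ : W ⟶ X₂}
    (h₁ : b₁ ≫ f₁ = g₁) (h₂ : b₂ ≫ f₂ = g₂) (ψ : (pullback g₁).obj M ⟶ (pullback g₂).obj N)
    (g : W' ⟶ W) {c₁ c₂ : W' ⟶ Z} (k₁ : g ≫ b₁ = c₁) (k₂ : g ≫ b₂ = c₂) {d₁ : W' ⟶ X₁}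
    {d₂ : W' ⟶ X₂} (l₁ : c₁ ≫ f₁ = d₁) (l₂ : c₂ ≫ f₂ = d₂) :
    pullHom (restrHom h₁ h₂ ψ) g k₁ k₂ = restrHom l₁ l₂
      (pullHom ψ g (by rw [← h₁, ← l₁, ← k₁, Category.assoc])
        (by rw [← h₂, ← l₂, ← k₂, Category.assoc])) := by
  subst h₁ h₂ k₁ k₂ l₁ l₂
  have e3 : (pullbackComp g b₁).inv.app ((pullback f₁).obj M) ≫
      (pullbackComp g b₁).hom.app ((pullback f₁).obj M) = 𝟙 _ := Iso.inv_hom_id_app _ _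
  have e4 : (pullbackComp g b₂).inv.app ((pullback f₂).obj N) ≫
      (pullbackComp g b₂).hom.app ((pullback f₂).obj N) = 𝟙 _ := Iso.inv_hom_id_app _ _
  simp only [pullHom, restrHom, pullbackCongr_rfl, Functor.map_comp, Category.assoc,
    map_pullbackComp_hom_app, map_pullbackComp_inv_app]
  rw [reassoc_of% e3, reassoc_of% e4]
  have e5 : (pullbackComp (g ≫ b₂) f₂).inv.app N ≫
      𝟙 ((pullback (g ≫ b₂)).obj ((pullback f₂).obj N)) = (pullbackComp (g ≫ b₂) f₂).inv.app N :=
    Category.comp_id _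
  simp only [CategoryTheory.Functor.map_id, Category.id_comp, e5]

lemma pullHom_pullHom {X₁ X₂ W W' W'' : Scheme.{u}} {M : X₁.Modules} {N : X₂.Modules}
    {f₁ : W ⟶ X₁} {f₂ : W ⟶ X₂} (φ : (pullback f₁).obj M ⟶ (pullback f₂).obj N)
    (g : W' ⟶ W) {g₁ : W' ⟶ X₁} {g₂ : W' ⟶ X₂} (h₁ : g ≫ f₁ = g₁) (h₂ : g ≫ f₂ = g₂)
    (g' : W'' ⟶ W') {k₁ : W'' ⟶ X₁} {k₂ : W'' ⟶ X₂} (l₁ : g' ≫ g₁ = k₁) (l₂ : g' ≫ g₂ = k₂)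
    {t : W'' ⟶ W} (ht : g' ≫ g = t) :
    pullHom (pullHom φ g h₁ h₂) g' l₁ l₂ = pullHom φ t
      (by rw [← ht, Category.assoc, h₁, l₁]) (by rw [← ht, Category.assoc, h₂, l₂]) := by
  subst h₁ h₂ l₁ l₂ ht
  simp only [pullHom, pullbackCongr_rfl, Functor.map_comp, Category.assoc,
    map_pullbackComp_hom_app, map_pullbackComp_inv_app]
  have e1 : (pullback g').map ((pullback g).map φ) ≫
      (pullbackComp g' g).hom.app ((pullback f₂).obj N) =
      (pullbackComp g' g).hom.app ((pullback f₁).obj M) ≫ (pullback (g' ≫ g)).map φ :=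
    (pullbackComp g' g).hom.naturality φ
  have e2 : (pullbackComp g' g).inv.app ((pullback f₁).obj M) ≫
      (pullbackComp g' g).hom.app ((pullback f₁).obj M) = 𝟙 _ := Iso.inv_hom_id_app _ _
  have e3 : (pullbackComp g' (g ≫ f₁)).inv.app M ≫ (pullbackComp g' (g ≫ f₁)).hom.app M = 𝟙 _ :=
    Iso.inv_hom_id_app _ _
  have e4 : (pullbackComp g' (g ≫ f₂)).inv.app N ≫ (pullbackComp g' (g ≫ f₂)).hom.app N = 𝟙 _ :=
    Iso.inv_hom_id_app _ _
  simp only [CategoryTheory.Functor.map_id, Category.id_comp, Category.comp_id]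
  rw [reassoc_of% e1, reassoc_of% e2]
  erw [Category.id_comp]
  rw [reassoc_of% e3, e4]
  erw [Category.comp_id]

lemma restrHom_comp {X₁ X₂ X₃ Z W : Scheme.{u}} {M : X₁.Modules} {N : X₂.Modules} {P : X₃.Modules}
    {b₁ b₂ b₃ : W ⟶ Z} {f₁ : Z ⟶ X₁} {f₂ : Z ⟶ X₂} {f₃ : Z ⟶ X₃} {g₁ : W ⟶ X₁} {g₂ : W ⟶ X₂}
    {g₃ : W ⟶ X₃} (h₁ : b₁ ≫ f₁ = g₁) (h₂ : b₂ ≫ f₂ = g₂) (h₃ : b₃ ≫ f₃ = g₃)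
    (ψ : (pullback g₁).obj M ⟶ (pullback g₂).obj N)
    (χ : (pullback g₂).obj N ⟶ (pullback g₃).obj P) :
    restrHom h₁ h₃ (ψ ≫ χ) = restrHom h₁ h₂ ψ ≫ restrHom h₂ h₃ χ := by
  subst h₁ h₂ h₃
  simp [restrHom]

lemma pullHom_comp {X₁ X₂ X₃ W W' : Scheme.{u}} {M : X₁.Modules} {N : X₂.Modules} {P : X₃.Modules}
    {g₁ : W ⟶ X₁} {g₂ : W ⟶ X₂} {g₃ : W ⟶ X₃}
    (ψ : (pullback g₁).obj M ⟶ (pullback g₂).obj N)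
    (χ : (pullback g₂).obj N ⟶ (pullback g₃).obj P) (g : W' ⟶ W)
    {c₁ : W' ⟶ X₁} {c₂ : W' ⟶ X₂} {c₃ : W' ⟶ X₃} (k₁ : g ≫ g₁ = c₁) (k₂ : g ≫ g₂ = c₂)
    (k₃ : g ≫ g₃ = c₃) :
    pullHom (ψ ≫ χ) g k₁ k₃ = pullHom ψ g k₁ k₂ ≫ pullHom χ g k₂ k₃ := by
  subst k₁ k₂ k₃
  simp [pullHom]

lemma pullHom_id {X W W' : Scheme.{u}} {M : X.Modules} {f : W ⟶ X} (g : W' ⟶ W) {g₁ : W' ⟶ X}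
    (h : g ≫ f = g₁) : pullHom (𝟙 ((pullback f).obj M)) g h h = 𝟙 _ := by
  subst h
  have e : (pullbackComp g f).inv.app M ≫ (pullbackComp g f).hom.app M = 𝟙 _ :=
    Iso.inv_hom_id_app _ _
  simp only [pullHom, pullbackCongr_rfl, CategoryTheory.Functor.map_id, Category.id_comp]
  erw [Category.id_comp]
  rw [reassoc_of% e]

lemma restrHom_id {X Z W : Scheme.{u}} {M : X.Modules} {b : W ⟶ Z} {f : Z ⟶ X} {g : W ⟶ X}
    (h : b ≫ f = g) :
    restrHom h h (𝟙 ((pullback g).obj M)) = 𝟙 _ := by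
  subst h
  have e : (pullbackComp b f).hom.app M ≫ (pullbackComp b f).inv.app M = 𝟙 _ :=
    Iso.hom_inv_id_app _ _
  simp only [restrHom, pullbackCongr_rfl, Category.id_comp]
  exact e

lemma restrHom_map {X₁ X₂ Z W : Scheme.{u}} {M M' : X₁.Modules} {N N' : X₂.Modules}
    {b₁ b₂ : W ⟶ Z} {f₁ : Z ⟶ X₁} {f₂ : Z ⟶ X₂} {g₁ : W ⟶ X₁} {g₂ : W ⟶ X₂}
    (h₁ : b₁ ≫ f₁ = g₁) (h₂ : b₂ ≫ f₂ = g₂)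
    {ψ : (pullback g₁).obj M ⟶ (pullback g₂).obj N}
    {ψ' : (pullback g₁).obj M' ⟶ (pullback g₂).obj N'} {α : M ⟶ M'} {β : N ⟶ N'}
    (h : ψ ≫ (pullback g₂).map β = (pullback g₁).map α ≫ ψ') :
    restrHom h₁ h₂ ψ ≫ (pullback b₂).map ((pullback f₂).map β) =
      (pullback b₁).map ((pullback f₁).map α) ≫ restrHom h₁ h₂ ψ' := by
  subst h₁ h₂
  have e1 : (pullback b₁).map ((pullback f₁).map α) ≫ (pullbackComp b₁ f₁).hom.app M' =
      (pullbackComp b₁ f₁).hom.app M ≫ (pullback (b₁ ≫ f₁)).map α :=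
    (pullbackComp b₁ f₁).hom.naturality α
  have e2 : (pullbackComp b₂ f₂).inv.app N ≫ (pullback b₂).map ((pullback f₂).map β) =
      (pullback (b₂ ≫ f₂)).map β ≫ (pullbackComp b₂ f₂).inv.app N' :=
    ((pullbackComp b₂ f₂).inv.naturality β).symm
  simp only [restrHom, pullbackCongr_rfl, Category.id_comp, Category.assoc]
  rw [e2, reassoc_of% e1, reassoc_of% h]

lemma pullHom_map {X₁ X₂ W W' : Scheme.{u}} {M M' : X₁.Modules} {N N' : X₂.Modules}
    {f₁ : W ⟶ X₁} {f₂ : W ⟶ X₂} {ψ : (pullback f₁).obj M ⟶ (pullback f₂).obj N}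
    {ψ' : (pullback f₁).obj M' ⟶ (pullback f₂).obj N'} {α : M ⟶ M'} {β : N ⟶ N'}
    (h : ψ ≫ (pullback f₂).map β = (pullback f₁).map α ≫ ψ')
    (g : W' ⟶ W) {g₁ : W' ⟶ X₁} {g₂ : W' ⟶ X₂} (h₁ : g ≫ f₁ = g₁) (h₂ : g ≫ f₂ = g₂) :
    pullHom ψ g h₁ h₂ ≫ (pullback g₂).map β = (pullback g₁).map α ≫ pullHom ψ' g h₁ h₂ := by
  subst h₁ h₂
  have e1 : (pullback (g ≫ f₁)).map α ≫ (pullbackComp g f₁).inv.app M' =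
      (pullbackComp g f₁).inv.app M ≫ (pullback g).map ((pullback f₁).map α) :=
    (pullbackComp g f₁).inv.naturality α
  have e2 : (pullbackComp g f₂).hom.app N ≫ (pullback (g ≫ f₂)).map β =
      (pullback g).map ((pullback f₂).map β) ≫ (pullbackComp g f₂).hom.app N' :=
    ((pullbackComp g f₂).hom.naturality β).symm
  have e3 := congrArg (pullback g).map h
  simp only [Functor.map_comp] at e3
  simp only [pullHom, pullbackCongr_rfl, Category.id_comp, Category.comp_id, Category.assoc]
  rw [e2, reassoc_of% e1, reassoc_of% e3]

/-- A sheaf of modules is a vector bundle if it is locally free of finite rank: every point has an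
open neighbourhood on which the sheaf is isomorphic to `𝒪ⁿ` for some natural number `n`. -/
def IsVectorBundle {X : Scheme.{u}} (M : X.Modules) : Prop :=
  ∀ x : X, ∃ (U : X.Opens) (_ : x ∈ U) (n : ℕ),
    Nonempty (M.restrict U.ι ≅ (SheafOfModules.free (ULift.{u} (Fin n)) : U.toScheme.Modules))

lemma final_opensMap {X Y : TopCat.{u}} (f : X ⟶ Y) : (TopologicalSpace.Opens.map f).Final where
  out U := by
    let t : StructuredArrow U (TopologicalSpace.Opens.map f) :=
      StructuredArrow.mk (Y := (⊤ : TopologicalSpace.Opens Y)) (homOfLE le_top)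
    have : Nonempty (StructuredArrow U (TopologicalSpace.Opens.map f)) := ⟨t⟩
    have key (a : StructuredArrow U (TopologicalSpace.Opens.map f)) : Zigzag a t :=
      Zigzag.of_hom (StructuredArrow.homMk (homOfLE le_top) rfl)
    exact zigzag_isConnected fun a b => (key a).trans (key b).symm

lemma nonempty_pullback_free {X Y : Scheme.{u}} (f : X ⟶ Y) (I : Type u) :
    Nonempty ((pullback f).obj (SheafOfModules.free I : Y.Modules) ≅
      (SheafOfModules.free I : X.Modules)) := by
  have : (TopologicalSpace.Opens.map f.base).Final := final_opensMap f.base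
  have : (SheafOfModules.pushforward.{u} f.toRingCatSheafHom).IsRightAdjoint :=
    inferInstanceAs (pushforward f).IsRightAdjoint
  exact ⟨SheafOfModules.pullbackObjFreeIso f.toRingCatSheafHom I⟩

lemma IsVectorBundle.pullback {X Y : Scheme.{u}} (f : X ⟶ Y) {M : Y.Modules}
    (hM : IsVectorBundle M) : IsVectorBundle ((pullback f).obj M) := by
  intro x
  obtain ⟨U, hx, n, ⟨e⟩⟩ := hM (f x)
  obtain ⟨e'⟩ := nonempty_pullback_free (f ∣_ U) (ULift.{u} (Fin n))
  refine ⟨f ⁻¹ᵁ U, hx, n, ⟨?_⟩⟩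
  exact (restrictFunctorIsoPullback (f ⁻¹ᵁ U).ι).app _ ≪≫
    (pullbackComp (f ⁻¹ᵁ U).ι f).app M ≪≫
    (pullbackCongr (morphismRestrict_ι f U).symm).app M ≪≫
    (pullbackComp (f ∣_ U) U.ι).symm.app M ≪≫
    (Modules.pullback (f ∣_ U)).mapIso ((restrictFunctorIsoPullback U.ι).symm.app M ≪≫ e) ≪≫ e'

end AlgebraicGeometry.Scheme.Modules

namespace EquivBundle

open Scheme.Modules

section Stabilizer

variable {C : Type u} [Category.{v} C] [CartesianMonoidalCategory C]

lemma toUnit_comp_smul_comp (G : C) [GrpObj G] {X : C} [ModObj G X] {T T' : C} (f : T' ⟶ T)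
    (g : T ⟶ G) (x : T ⟶ X) : (f ≫ g) • (f ≫ x) = f ≫ (g • x) := by
  simp [Hom.smul_def, ← comp_lift_assoc]

/-- The functor of points `T ↦ {g ∈ G(T) | g • y_T = y_T}` of the stabilizer of a point `y` of `X`. -/
def stabilizerFunctor (G : C) [GrpObj G] {X : C} [ModObj G X] (y : 𝟙_ C ⟶ X) : Cᵒᵖ ⥤ GrpCat.{v} where
  obj T := GrpCat.of (MulAction.stabilizer (T.unop ⟶ G) (toUnit T.unop ≫ y))
  map {T T'} f := GrpCat.ofHom
    { toFun g := ⟨f.unop ≫ g.1, by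
        have h : g.1 • (toUnit T.unop ≫ y) = toUnit T.unop ≫ y := g.2
        change (f.unop ≫ g.1) • (toUnit T'.unop ≫ y) = toUnit T'.unop ≫ y
        rw [← comp_toUnit f.unop, Category.assoc, toUnit_comp_smul_comp, h]⟩
      map_one' := by
        apply Subtype.ext; change f.unop ≫ 1 = 1; simp
      map_mul' a b := by
        apply Subtype.ext; exact MonObj.comp_mul _ _ _ }
  map_id T := by
    ext g; exact Category.id_comp _
  map_comp f g := by
    ext a; exact Category.assoc _ _ _

/-- The orbit map `g ↦ g • y`. -/
def orbitMap (G : C) [GrpObj G] {X : C} [ModObj G X] (y : 𝟙_ C ⟶ X) : G ⟶ X :=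
  𝟙 G • (toUnit G ≫ y)

lemma comp_orbitMap (G : C) [GrpObj G] {X : C} [ModObj G X] (y : 𝟙_ C ⟶ X) {T : C} (g : T ⟶ G) :
    g ≫ orbitMap G y = g • (toUnit T ≫ y) := by
  simp [orbitMap, ← toUnit_comp_smul_comp]

variable [Limits.HasPullbacks C]

/-- The stabilizer `G_y` of a point `y` of `X`: the fibre over `y` of the orbit map `G ⟶ X`. -/
def stabilizer (G : C) [GrpObj G] {X : C} [ModObj G X] (y : 𝟙_ C ⟶ X) : C :=
  Limits.pullback (orbitMap G y) y

/-- The inclusion `G_y ⟶ G`. -/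
def stabilizerι (G : C) [GrpObj G] {X : C} [ModObj G X] (y : 𝟙_ C ⟶ X) : stabilizer G y ⟶ G :=
  Limits.pullback.fst (orbitMap G y) y

lemma stabilizerι_comp_orbitMap (G : C) [GrpObj G] {X : C} [ModObj G X] (y : 𝟙_ C ⟶ X) :
    stabilizerι G y ≫ orbitMap G y = toUnit _ ≫ y := by
  rw [toUnit_unique (toUnit (stabilizer G y)) (Limits.pullback.snd (orbitMap G y) y)]
  exact Limits.pullback.condition

/-- The stabilizer represents the functor of stabilizer subgroups. -/
def stabilizerRepresentableBy (G : C) [GrpObj G] {X : C} [ModObj G X] (y : 𝟙_ C ⟶ X) :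
    (stabilizerFunctor G y ⋙ forget GrpCat).RepresentableBy (stabilizer G y) where
  homEquiv {T} :=
    { toFun g := ⟨g ≫ stabilizerι G y, by
        change (g ≫ stabilizerι G y) • (toUnit T ≫ y) = toUnit T ≫ y
        rw [← comp_orbitMap, Category.assoc, stabilizerι_comp_orbitMap, ← Category.assoc,
          toUnit_unique (g ≫ toUnit _) (toUnit T)]⟩
      invFun g := Limits.pullback.lift g.1 (toUnit T) (by
        rw [comp_orbitMap]; exact g.2)
      left_inv g := by
        apply Limits.pullback.hom_ext
        · exact Limits.pullback.lift_fst _ _ _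
        · exact toUnit_unique _ _
      right_inv g := by
        apply Subtype.ext
        exact Limits.pullback.lift_fst _ _ _ }
  homEquiv_comp f g := by
    apply Subtype.ext
    exact Category.assoc _ _ _

/-- The group structure on `G_y` inherited from `G`. -/
instance stabilizerGrpObj (G : C) [GrpObj G] {X : C} [ModObj G X] (y : 𝟙_ C ⟶ X) :
    GrpObj (stabilizer G y) :=
  GrpObj.ofRepresentableBy _ (stabilizerFunctor G y) (stabilizerRepresentableBy G y)

instance stabilizerι_isMonHom (G : C) [GrpObj G] {X : C} [ModObj G X] (y : 𝟙_ C ⟶ X) :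
    IsMonHom (stabilizerι G y) where
  one_hom := by
    have h : ((stabilizerRepresentableBy G y).homEquiv η[stabilizer G y]) =
        (1 : MulAction.stabilizer (𝟙_ C ⟶ G) (toUnit (𝟙_ C) ≫ y)) :=
      Equiv.apply_symm_apply _ _
    have h' : η[stabilizer G y] ≫ stabilizerι G y = (1 : 𝟙_ C ⟶ G) := congrArg Subtype.val h
    rw [h', MonObj.one_eq_one]
  mul_hom := by
    have h : ((stabilizerRepresentableBy G y).homEquiv μ[stabilizer G y]) =
        ((stabilizerRepresentableBy G y).homEquiv (fst _ _) *
          (stabilizerRepresentableBy G y).homEquiv (snd _ _) :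
          MulAction.stabilizer (stabilizer G y ⊗ stabilizer G y ⟶ G) (toUnit _ ≫ y)) :=
      Equiv.apply_symm_apply _ _
    have h' : μ[stabilizer G y] ≫ stabilizerι G y =
        (fst _ _ ≫ stabilizerι G y) * (snd _ _ ≫ stabilizerι G y) := congrArg Subtype.val h
    rw [h', MonObj.mul_eq_mul, MonObj.comp_mul]
    simp

end Stabilizer

section Auxiliary

variable {C : Type u} [Category.{v} C] [CartesianMonoidalCategory C]

lemma mulLeft_tensorHom {G H X Z : C} [GrpObj G] [GrpObj H] (j : H ⟶ G) [IsMonHom j] (f : Z ⟶ X) :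
    ((α_ H H Z).inv ≫ μ[H] ▷ Z) ≫ (j ⊗ₘ f) =
      (j ⊗ₘ (j ⊗ₘ f)) ≫ ((α_ G G X).inv ≫ μ[G] ▷ X) := by
  apply CartesianMonoidalCategory.hom_ext
  · simp only [Category.assoc, tensorHom_fst, whiskerRight_fst_assoc, whiskerRight_fst]
    have h : (α_ H H Z).inv ≫ fst (H ⊗ H) Z ≫ (j ⊗ₘ j) =
        (j ⊗ₘ (j ⊗ₘ f)) ≫ (α_ G G X).inv ≫ fst (G ⊗ G) X := by
      apply CartesianMonoidalCategory.hom_ext <;> simp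
    rw [IsMonHom.mul_hom, reassoc_of% h]
  · simp

lemma whiskerLeft_smul_tensorHom {G H X Z : C} [GrpObj G] [GrpObj H] [ModObj G X] [ModObj H Z]
    (j : H ⟶ G) (f : Z ⟶ X) (h : γ[H, Z] ≫ f = (j ⊗ₘ f) ≫ γ[G, X]) :
    (H ◁ γ[H, Z]) ≫ (j ⊗ₘ f) = (j ⊗ₘ (j ⊗ₘ f)) ≫ (G ◁ γ[G, X]) := by
  apply CartesianMonoidalCategory.hom_ext <;> simp [h]

lemma snd_tensorHom {G H X Z : C} (j : H ⟶ G) (f : Z ⟶ X) :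
    snd H (H ⊗ Z) ≫ (j ⊗ₘ f) = (j ⊗ₘ (j ⊗ₘ f)) ≫ snd G (G ⊗ X) := by
  simp

end Auxiliary

variable {S : Scheme.{u}}

/-- The right action `(g, z) · h = (g * j h, h⁻¹ • z)` of `H` on `G × Z`, for a homomorphism
`j : H ⟶ G` and a left `H`-scheme `Z`. -/
def contractedAction {G H : Over S} [GrpObj G] [GrpObj H] (j : H ⟶ G) (Z : Over S)
    [ModObj H Z] : (G ⊗ Z) ⊗ H ⟶ G ⊗ Z :=
  lift ((fst (G ⊗ Z) H ≫ fst G Z) * (snd (G ⊗ Z) H ≫ j))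
    ((snd (G ⊗ Z) H)⁻¹ • (fst (G ⊗ Z) H ≫ snd G Z))

/-- For a right action `r : P × H ⟶ P`, the morphism `q : P ⟶ W` is a right `H`-torsor (for the
flat topology): `q` is faithfully flat and quasi-compact, it is `H`-invariant, and
`P × H ⟶ P ×_W P`, `(p, h) ↦ (p · h, p)`, is an isomorphism. -/
structure IsTorsor {P H W : Over S} (r : P ⊗ H ⟶ P) (q : P ⟶ W) : Prop where
  flat : Flat q.left
  surjective : Surjective q.left
  quasiCompact : QuasiCompact q.left
  isPullback : IsPullback r (fst P H) q q

/-- `q : G × Z ⟶ W` exhibits `W` as the contracted product `G ∧_H Z`, the quotient of `G × Z` by the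
right action `(g, z) · h = (g * j h, h⁻¹ • z)` of `H`, over which `G × Z` is a right `H`-torsor. -/
def IsContractedProduct {G H W : Over S} [GrpObj G] [GrpObj H] (j : H ⟶ G) (Z : Over S)
    [ModObj H Z] (q : G ⊗ Z ⟶ W) : Prop :=
  IsTorsor (contractedAction j Z) q

lemma left_comp_left {A B D : Over S} {a : A ⟶ B} {b : B ⟶ D} {c : A ⟶ D} (h : a ≫ b = c) :
    a.left ≫ b.left = c.left := by
  rw [← Over.comp_left, h]

lemma mulLeft_smul (G X : Over S) [GrpObj G] [ModObj G X] :
    ((α_ G G X).inv ≫ μ[G] ▷ X) ≫ γ[G, X] = (G ◁ γ[G, X]) ≫ γ[G, X] := by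
  simp

lemma mulLeft_snd (G X : Over S) [GrpObj G] :
    ((α_ G G X).inv ≫ μ[G] ▷ X) ≫ snd G X = snd G (G ⊗ X) ≫ snd G X := by
  simp

lemma whiskerLeft_smul_snd (G X : Over S) [GrpObj G] [ModObj G X] :
    (G ◁ γ[G, X]) ≫ snd G X = snd G (G ⊗ X) ≫ γ[G, X] := by
  simp

/-- A `G`-equivariant vector bundle on a `G`-scheme `X`, with action `a : G × X ⟶ X`: a finite rank
locally free sheaf `E` on `X` with an isomorphism `φ : a^* E ≅ p₂^* E` on `G × X` satisfying the
cocycle condition `(μ × 1)^* φ = p₂₃^* φ ∘ (1 × a)^* φ` on `G × G × X`. -/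
structure VecG (G X : Over S) [GrpObj G] [ModObj G X] where
  sheaf : X.left.Modules
  isVectorBundle : IsVectorBundle sheaf
  iso : (pullback γ[G, X].left).obj sheaf ≅ (pullback (snd G X).left).obj sheaf
  cocycle :
    pullHom iso.hom ((α_ G G X).inv ≫ μ[G] ▷ X).left
        (left_comp_left (mulLeft_smul G X)) (left_comp_left (mulLeft_snd G X)) =
      pullHom iso.hom (G ◁ γ[G, X]).left
          (left_comp_left rfl) (left_comp_left (whiskerLeft_smul_snd G X)) ≫
        pullHom iso.hom (snd G (G ⊗ X)).left (left_comp_left rfl) (left_comp_left rfl)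

namespace VecG

variable {G X : Over S} [GrpObj G] [ModObj G X]

/-- A morphism of equivariant vector bundles: an `𝒪_X`-linear map commuting with the equivariant
structures. -/
@[ext]
structure Hom (E F : VecG G X) where
  hom : E.sheaf ⟶ F.sheaf
  comm : E.iso.hom ≫ (pullback (snd G X).left).map hom =
    (pullback γ[G, X].left).map hom ≫ F.iso.hom

instance category : Category (VecG G X) where
  Hom := Hom
  id E := ⟨𝟙 _, by simp⟩
  comp f g := ⟨f.hom ≫ g.hom, by
    rw [Functor.map_comp, Functor.map_comp, ← Category.assoc, f.comm, Category.assoc, g.comm,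
      Category.assoc]⟩

@[ext]
lemma hom_ext {E F : VecG G X} {f g : E ⟶ F} (h : f.hom = g.hom) : f = g := Hom.ext h

@[simp] lemma id_hom (E : VecG G X) : (𝟙 E : E ⟶ E).hom = 𝟙 E.sheaf := rfl
@[simp] lemma comp_hom {E F K : VecG G X} (f : E ⟶ F) (g : F ⟶ K) :
    (f ≫ g).hom = f.hom ≫ g.hom := rfl

end VecG

section Restriction

variable {G H X Z : Over S} [GrpObj G] [GrpObj H] [ModObj G X] [ModObj H Z]

/-- A morphism `f : Z ⟶ X` from an `H`-scheme to a `G`-scheme is equivariant along a homomorphism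
`j : H ⟶ G` if `f (h • z) = j h • f z`. -/
def IsEquivariant (j : H ⟶ G) (f : Z ⟶ X) : Prop :=
  γ[H, Z] ≫ f = (j ⊗ₘ f) ≫ γ[G, X]

namespace IsEquivariant

variable {j : H ⟶ G} {f : Z ⟶ X}

lemma left_smul (hf : IsEquivariant j f) :
    γ[H, Z].left ≫ f.left = (j ⊗ₘ f).left ≫ γ[G, X].left := by
  rw [← Over.comp_left, ← Over.comp_left, hf]

lemma left_snd {G H X Z : Over S} (j : H ⟶ G) (f : Z ⟶ X) :
    (snd H Z).left ≫ f.left = (j ⊗ₘ f).left ≫ (snd G X).left := by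
  rw [← Over.comp_left, ← Over.comp_left]; simp

/-- The equivariant structure on `f^* E`: the pullback along `j × f : H × Z ⟶ G × X` of that of `E`. -/
def restrictIso (hf : IsEquivariant j f) (E : VecG G X) :
    (pullback γ[H, Z].left).obj ((pullback f.left).obj E.sheaf) ≅
      (pullback (snd H Z).left).obj ((pullback f.left).obj E.sheaf) where
  hom := restrHom hf.left_smul (left_snd j f) (pullHom E.iso.hom (j ⊗ₘ f).left rfl rfl)
  inv := restrHom (left_snd j f) hf.left_smul (pullHom E.iso.inv (j ⊗ₘ f).left rfl rfl)
  hom_inv_id := by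
    rw [← restrHom_comp, ← pullHom_comp, Iso.hom_inv_id, pullHom_id, restrHom_id]
  inv_hom_id := by
    rw [← restrHom_comp, ← pullHom_comp, Iso.inv_hom_id, pullHom_id, restrHom_id]

/-- The pullback `f^* E` as an `H`-equivariant vector bundle on `Z`. -/
def restrictObj [IsMonHom j] (hf : IsEquivariant j f) (E : VecG G X) : VecG H Z where
  sheaf := (pullback f.left).obj E.sheaf
  isVectorBundle := E.isVectorBundle.pullback f.left
  iso := hf.restrictIso E
  cocycle := by
    have a1 := mulLeft_tensorHom j f
    have a2 := whiskerLeft_smul_tensorHom j f hf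
    have a3 := snd_tensorHom j f
    have key := congrArg (fun t => pullHom t (j ⊗ₘ (j ⊗ₘ f)).left rfl rfl) E.cocycle
    beta_reduce at key
    rw [pullHom_comp _ _ _ rfl rfl rfl, pullHom_pullHom (ht := rfl), pullHom_pullHom (ht := rfl),
      pullHom_pullHom (ht := rfl)] at key
    have p₁ : ((H ◁ γ[H, Z]) ≫ γ[H, Z]).left ≫ f.left =
        (j ⊗ₘ (j ⊗ₘ f)).left ≫ ((G ◁ γ[G, X]) ≫ γ[G, X]).left := by
      rw [← Over.comp_left, ← Over.comp_left, Category.assoc, hf, reassoc_of% a2]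
    have p₂ : (snd H (H ⊗ Z) ≫ γ[H, Z]).left ≫ f.left =
        (j ⊗ₘ (j ⊗ₘ f)).left ≫ (snd G (G ⊗ X) ≫ γ[G, X]).left := by
      rw [← Over.comp_left, ← Over.comp_left, Category.assoc, hf, reassoc_of% a3]
    have p₃ : (snd H (H ⊗ Z) ≫ snd H Z).left ≫ f.left =
        (j ⊗ₘ (j ⊗ₘ f)).left ≫ (snd G (G ⊗ X) ≫ snd G X).left := by
      rw [← Over.comp_left, ← Over.comp_left]
      congr 1
      simp
    have b₁ := (left_comp_left a1).trans (left_comp_left rfl).symm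
    have b₂ := (left_comp_left a2).trans (left_comp_left rfl).symm
    have b₃ := (left_comp_left a3).trans (left_comp_left rfl).symm
    dsimp only [restrictIso]
    rw [pullHom_restrHom (l₁ := p₁) (l₂ := p₃), pullHom_restrHom (l₁ := p₁) (l₂ := p₂),
      pullHom_restrHom (l₁ := p₂) (l₂ := p₃), pullHom_pullHom (ht := b₁),
      pullHom_pullHom (ht := b₂), pullHom_pullHom (ht := b₃), ← restrHom_comp]
    rw [key]

/-- The pullback functor `f^* : Vec^G(X) ⥤ Vec^H(Z)` along a morphism `f` that is equivariant along
`j : H ⟶ G`. -/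
def restrict [IsMonHom j] (hf : IsEquivariant j f) : VecG G X ⥤ VecG H Z where
  obj E := hf.restrictObj E
  map φ := ⟨(pullback f.left).map φ.hom,
    restrHom_map hf.left_smul (left_snd j f) (pullHom_map φ.comm _ rfl rfl)⟩
  map_id E := by
    apply VecG.hom_ext; exact CategoryTheory.Functor.map_id _ _
  map_comp φ ψ := by
    apply VecG.hom_ext; exact Functor.map_comp _ _ _

end IsEquivariant
end Restriction

end EquivBundle

end

noncomputable section

/-- The component of an isomorphism `F ⋙ G ≅ K` of functors, with source written as
`G.obj (F.obj M)`. -/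
def CategoryTheory.Functor.compIsoApp {C D E : Type*} [Category* C] [Category* D] [Category* E]
    {F : C ⥤ D} {G : D ⥤ E} {K : C ⥤ E} (e : F ⋙ G ≅ K) (M : C) :
    G.obj (F.obj M) ≅ K.obj M :=
  e.app M

namespace AlgebraicGeometry.Scheme.Modules

/-- The restriction of a section of a module to a smaller open. -/
def res {X : Scheme.{u}} {M : X.Modules} {U V : X.Opens} (h : V ≤ U) (s : Γ(M, U)) : Γ(M, V) :=
  M.presheaf.map (homOfLE h).op s

/-- The image of a section under a morphism of modules. -/
def ev {X : Scheme.{u}} {M N : X.Modules} (φ : M ⟶ N) {U : X.Opens} (s : Γ(M, U)) : Γ(N, U) :=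
  φ.app U s

section res
variable {X : Scheme.{u}} {M N K : X.Modules} {U V W : X.Opens}

@[simp] lemma res_self (h : U ≤ U) (s : Γ(M, U)) : res h s = s := by
  have : (homOfLE h).op = 𝟙 _ := rfl
  rw [res, this, M.presheaf.map_id]; rfl

@[simp] lemma res_res (h : V ≤ U) (h' : W ≤ V) (s : Γ(M, U)) :
    res h' (res h s) = res (h'.trans h) s := by
  simp only [res]
  rw [← ConcreteCategory.comp_apply, ← M.presheaf.map_comp]
  rfl

@[simp] lemma res_add (h : V ≤ U) (s t : Γ(M, U)) : res h (s + t) = res h s + res h t :=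
  map_add _ _ _

@[simp] lemma res_zero (h : V ≤ U) : res h (0 : Γ(M, U)) = 0 := map_zero _

@[simp] lemma res_sum {J : Type*} (h : V ≤ U) (A : Finset J) (s : J → Γ(M, U)) :
    res h (∑ i ∈ A, s i) = ∑ i ∈ A, res h (s i) :=
  map_sum (M.presheaf.map (homOfLE h).op).hom _ _

lemma res_smul (h : V ≤ U) (r : Γ(X, U)) (s : Γ(M, U)) :
    res h (r • s) = X.presheaf.map (homOfLE h).op r • res h s :=
  map_smul M _ _ _

@[simp] lemma ev_add (φ : M ⟶ N) (s t : Γ(M, U)) : ev φ (s + t) = ev φ s + ev φ t :=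
  map_add _ _ _

@[simp] lemma ev_zero (φ : M ⟶ N) : ev φ (0 : Γ(M, U)) = 0 := map_zero _

@[simp] lemma ev_sum {J : Type*} (φ : M ⟶ N) (A : Finset J) (s : J → Γ(M, U)) :
    ev φ (∑ i ∈ A, s i) = ∑ i ∈ A, ev φ (s i) :=
  map_sum (φ.app U).hom _ _

lemma ev_smul (φ : M ⟶ N) (r : Γ(X, U)) (s : Γ(M, U)) : ev φ (r • s) = r • ev φ s :=
  Hom.app_smul φ r s

@[simp] lemma ev_id (s : Γ(M, U)) : ev (𝟙 M) s = s := rfl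

@[simp] lemma ev_comp (φ : M ⟶ N) (ψ : N ⟶ K) (s : Γ(M, U)) : ev (φ ≫ ψ) s = ev ψ (ev φ s) := rfl

@[simp] lemma ev_hom_inv (φ : M ≅ N) (s : Γ(M, U)) : ev φ.inv (ev φ.hom s) = s := by
  rw [← ev_comp, Iso.hom_inv_id, ev_id]

@[simp] lemma ev_inv_hom (φ : M ≅ N) (s : Γ(N, U)) : ev φ.hom (ev φ.inv s) = s := by
  rw [← ev_comp, Iso.inv_hom_id, ev_id]

lemma ev_res (φ : M ⟶ N) (h : V ≤ U) (s : Γ(M, U)) : ev φ (res h s) = res h (ev φ s) :=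
  ConcreteCategory.congr_hom (φ.mapPresheaf.naturality (homOfLE h).op) s

lemma hom_ext_ev {φ ψ : M ⟶ N} (h : ∀ (U : X.Opens) (s : Γ(M, U)), ev φ s = ev ψ s) : φ = ψ := by
  ext U s
  exact h U s

lemma isIso_of_bijective_ev {φ : M ⟶ N}
    (h : ∀ U : X.Opens, Function.Bijective (fun s : Γ(M, U) => ev φ s)) : IsIso φ := by
  rw [Hom.isIso_iff_isIso_app]
  intro U
  rw [ConcreteCategory.isIso_iff_bijective]
  exact h U

lemma eq_of_res_eq {J : Type*} {W : X.Opens} (U : J → X.Opens) (hU : ∀ i, U i ≤ W)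
    (hW : W ≤ ⨆ i, U i) {s t : Γ(M, W)} (h : ∀ i, res (hU i) s = res (hU i) t) : s = t :=
  TopCat.Sheaf.eq_of_locally_eq' ⟨M.presheaf, M.isSheaf⟩ U W (fun i => homOfLE (hU i)) hW s t h

lemma exists_res_eq {J : Type*} {W : X.Opens} (U : J → X.Opens) (hU : ∀ i, U i ≤ W)
    (hW : W ≤ ⨆ i, U i) (s : ∀ i, Γ(M, U i))
    (h : ∀ i j, res (inf_le_left : U i ⊓ U j ≤ U i) (s i) =
      res (inf_le_right : U i ⊓ U j ≤ U j) (s j)) : ∃ t : Γ(M, W), ∀ i, res (hU i) t = s i := by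
  obtain ⟨t, ht, -⟩ := TopCat.Sheaf.existsUnique_gluing' ⟨M.presheaf, M.isSheaf⟩ U W
    (fun i => homOfLE (hU i)) hW s h
  exact ⟨t, ht⟩

/-- A family of additive maps on sections which is compatible with restriction and scalars defines
a morphism of modules. -/
lemma exists_hom_ev (f : ∀ U : X.Opens, Γ(M, U) → Γ(N, U))
    (hadd : ∀ U s t, f U (s + t) = f U s + f U t)
    (hsmul : ∀ U (r : Γ(X, U)) s, f U (r • s) = r • f U s)
    (hres : ∀ (U V : X.Opens) (h : V ≤ U) s, f V (res h s) = res h (f U s)) :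
    ∃ φ : M ⟶ N, ∀ (U : X.Opens) (s : Γ(M, U)), ev φ s = f U s := by
  let α : M.val ⟶ N.val :=
    { app := fun U => ModuleCat.ofHom (X := M.val.obj U) (Y := N.val.obj U)
        { toFun := f U.unop
          map_add' := hadd _
          map_smul' := hsmul _ }
      naturality := fun {U V} i => by
        ext s
        exact hres _ _ i.unop.le s }
  exact ⟨⟨α⟩, fun U s => rfl⟩

end res

/-- The pullback along `g` of a section of `M` over `U`, as a section of `g^* M` over `g ⁻¹ᵁ U`. -/
def sharp {X Y : Scheme.{u}} (g : Y ⟶ X) {M : X.Modules} {U : X.Opens} (s : Γ(M, U)) :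
    Γ((pullback g).obj M, g ⁻¹ᵁ U) :=
  ev ((pullbackPushforwardAdjunction g).unit.app M) s

section sharp
variable {X Y Z : Scheme.{u}} (g : Y ⟶ X) {M N : X.Modules} {U U' : X.Opens} {V V' : Y.Opens}

lemma sharp_add (s t : Γ(M, U)) : sharp g (s + t) = sharp g s + sharp g t :=
  ev_add ((pullbackPushforwardAdjunction g).unit.app M) s t

lemma sharp_zero : sharp g (0 : Γ(M, U)) = 0 :=
  ev_zero ((pullbackPushforwardAdjunction g).unit.app M)

lemma sharp_res (h : U ≤ U') (s : Γ(M, U')) :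
    sharp g (res h s) = res (g.preimage_mono h) (sharp g s) :=
  ev_res ((pullbackPushforwardAdjunction g).unit.app M) h s

lemma sharp_smul (r : Γ(X, U)) (s : Γ(M, U)) : sharp g (r • s) = g.app U r • sharp g s :=
  ev_smul ((pullbackPushforwardAdjunction g).unit.app M) r s

lemma ev_map_sharp (φ : M ⟶ N) (s : Γ(M, U)) :
    ev ((pullback g).map φ) (sharp g s) = sharp g (ev φ s) :=
  (congrArg (fun α => ev α s) ((pullbackPushforwardAdjunction g).unit.naturality φ)).symm

lemma ev_homEquiv {K : Y.Modules} (α : (pullback g).obj M ⟶ K) (s : Γ(M, U)) :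
    ev (((pullbackPushforwardAdjunction g).homEquiv _ _) α) s =
      ev (U := g ⁻¹ᵁ U) α (sharp g s) := by
  rw [Adjunction.homEquiv_unit]
  rfl

lemma pullbackComp_unit {M : Z.Modules} (f : X ⟶ Z) :
    (((pullbackPushforwardAdjunction f).comp (pullbackPushforwardAdjunction g)).unit.app M)
        ≫ (pushforward g ⋙ pushforward f).map ((pullbackComp g f).hom.app M) =
      (pullbackPushforwardAdjunction (g ≫ f)).unit.app M ≫ (pushforwardComp g f).inv.app _ := by
  have h := unit_conjugateEquiv ((pullbackPushforwardAdjunction f).comp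
    (pullbackPushforwardAdjunction g)) (pullbackPushforwardAdjunction (g ≫ f))
    (pullbackComp g f).inv M
  rw [conjugateEquiv_pullbackComp_inv] at h
  have e1 : (pullbackComp g f).inv.app M ≫ (pullbackComp g f).hom.app M = 𝟙 _ :=
    Iso.inv_hom_id_app _ _
  have n := (pushforwardComp g f).hom.naturality ((pullbackComp g f).hom.app M)
  rw [← cancel_mono ((pushforwardComp g f).hom.app _)]
  simp only [Category.assoc, Iso.inv_hom_id_app]
  rw [n, ← Category.assoc]
  refine (congrArg (· ≫ (pushforward (g ≫ f)).map ((pullbackComp g f).hom.app M)) h).trans ?_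
  rw [Category.assoc, ← Functor.map_comp, e1, CategoryTheory.Functor.map_id]

/-- The canonical isomorphism `g^* f^* M ≅ k^* M`, where `g ≫ f = k`. -/
def compIso {f : X ⟶ Z} {k : Y ⟶ Z} (e : g ≫ f = k) (M : Z.Modules) :
    (pullback g).obj ((pullback f).obj M) ≅ (pullback k).obj M :=
  Functor.compIsoApp (pullbackComp g f) M ≪≫ (pullbackCongr e).app M

lemma pullHom_eq {X₁ X₂ W W' : Scheme.{u}} {M : X₁.Modules} {N : X₂.Modules}
    {f₁ : W ⟶ X₁} {f₂ : W ⟶ X₂} (φ : (pullback f₁).obj M ⟶ (pullback f₂).obj N)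
    (g : W' ⟶ W) {g₁ : W' ⟶ X₁} {g₂ : W' ⟶ X₂} (h₁ : g ≫ f₁ = g₁) (h₂ : g ≫ f₂ = g₂) :
    pullHom φ g h₁ h₂ = (compIso g h₁ M).inv ≫ (pullback g).map φ ≫ (compIso g h₂ N).hom := by
  subst h₁ h₂
  rw [pullHom, compIso, Iso.trans_inv, Category.assoc]
  rfl

lemma restrHom_eq {X₁ X₂ Z W : Scheme.{u}} {M : X₁.Modules} {N : X₂.Modules} {b₁ b₂ : W ⟶ Z}
    {f₁ : Z ⟶ X₁} {f₂ : Z ⟶ X₂} {g₁ : W ⟶ X₁} {g₂ : W ⟶ X₂} (h₁ : b₁ ≫ f₁ = g₁)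
    (h₂ : b₂ ≫ f₂ = g₂) (ψ : (pullback g₁).obj M ⟶ (pullback g₂).obj N) :
    restrHom h₁ h₂ ψ = (compIso b₁ h₁ M).hom ≫ ψ ≫ (compIso b₂ h₂ N).inv := by
  subst h₁ h₂
  rw [restrHom, compIso, Iso.trans_hom, Category.assoc]
  rfl

lemma ev_compIso_sharp {M : Z.Modules} (f : X ⟶ Z) {U : Z.Opens} (s : Γ(M, U)) :
    ev (compIso g (f := f) rfl M).hom (sharp g (sharp f s)) = sharp (g ≫ f) s :=
  congrArg (fun α => ev α s) (pullbackComp_unit g f)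

end sharp

/-- The pullback along `g` of a section of `M` over `U`, as a section of `g^* M` over an open
contained in the preimage of `U`. -/
def pb {X Y : Scheme.{u}} (g : Y ⟶ X) {M : X.Modules} {U : X.Opens} {V : Y.Opens}
    (h : V ≤ g ⁻¹ᵁ U) (s : Γ(M, U)) : Γ((pullback g).obj M, V) :=
  res h (sharp g s)

section pb
variable {X Y Z : Scheme.{u}} (g : Y ⟶ X) {M N : X.Modules} {U U' : X.Opens} {V V' : Y.Opens}

lemma sharp_eq_pb (s : Γ(M, U)) : sharp g s = pb g le_rfl s := by rw [pb, res_self]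

@[simp] lemma res_pb (h : V ≤ g ⁻¹ᵁ U) (h' : V' ≤ V) (s : Γ(M, U)) :
    res h' (pb g h s) = pb g (h'.trans h) s := by
  rw [pb, res_res, pb]

@[simp] lemma pb_res (h : V ≤ g ⁻¹ᵁ U) (h' : U ≤ U') (s : Γ(M, U')) :
    pb g h (res h' s) = pb g (h.trans (g.preimage_mono h')) s := by
  rw [pb, sharp_res, res_res, pb]

@[simp] lemma pb_add (h : V ≤ g ⁻¹ᵁ U) (s t : Γ(M, U)) : pb g h (s + t) = pb g h s + pb g h t := by
  rw [pb, sharp_add, res_add, pb, pb]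

@[simp] lemma pb_zero (h : V ≤ g ⁻¹ᵁ U) : pb g h (0 : Γ(M, U)) = 0 := by
  rw [pb, sharp_zero, res_zero]

@[simp] lemma pb_sum {J : Type*} (h : V ≤ g ⁻¹ᵁ U) (A : Finset J) (s : J → Γ(M, U)) :
    pb g h (∑ i ∈ A, s i) = ∑ i ∈ A, pb g h (s i) :=
  map_sum (⟨⟨pb g h, pb_zero g h⟩, pb_add g h⟩ : Γ(M, U) →+ Γ((pullback g).obj M, V)) _ _

lemma pb_smul (h : V ≤ g ⁻¹ᵁ U) (r : Γ(X, U)) (s : Γ(M, U)) :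
    pb g h (r • s) = g.appLE U V h r • pb g h s := by
  rw [pb, sharp_smul, res_smul, pb]
  rfl

lemma ev_map_pb (φ : M ⟶ N) (h : V ≤ g ⁻¹ᵁ U) (s : Γ(M, U)) :
    ev ((pullback g).map φ) (pb g h s) = pb g h (ev φ s) := by
  rw [pb, ev_res, ev_map_sharp, pb]

variable {g} in
lemma hom_ext_pb {K : Y.Modules} {α β : (pullback g).obj M ⟶ K}
    (h : ∀ (U : X.Opens) (s : Γ(M, U)), ev α (pb g le_rfl s) = ev β (pb g le_rfl s)) :
    α = β := by
  apply ((pullbackPushforwardAdjunction g).homEquiv _ _).injective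
  apply hom_ext_ev
  intro U s
  rw [ev_homEquiv, ev_homEquiv, sharp_eq_pb, h]

/-- The morphism `g^* M ⟶ K` adjoint to a morphism `M ⟶ g_* K`. -/
lemma exists_ev_pb {K : Y.Modules} (β : M ⟶ (pushforward g).obj K) :
    ∃ α : (pullback g).obj M ⟶ K, ∀ (U : X.Opens) (V : Y.Opens) (h : V ≤ g ⁻¹ᵁ U) (s : Γ(M, U)),
      ev α (pb g h s) = res (M := K) h (ev β s) := by
  obtain ⟨α, rfl⟩ := ((pullbackPushforwardAdjunction g).homEquiv _ _).surjective β
  refine ⟨α, fun U V h s => ?_⟩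
  rw [ev_homEquiv, pb, ev_res]

section compIso
variable {M : Z.Modules} {f : X ⟶ Z} {k : Y ⟶ Z} (e : g ≫ f = k)

lemma le_preimage_of_comp_eq {f : X ⟶ Z} {k : Y ⟶ Z} (e : g ≫ f = k)
    {U : Z.Opens} {V : X.Opens} {W : Y.Opens}
    (h : V ≤ f ⁻¹ᵁ U) (h' : W ≤ g ⁻¹ᵁ V) : W ≤ k ⁻¹ᵁ U := by
  subst e
  exact h'.trans (g.preimage_mono h)

lemma ev_compIso_hom_pb {U : Z.Opens} {V : X.Opens} {W : Y.Opens}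
    (h : V ≤ f ⁻¹ᵁ U) (h' : W ≤ g ⁻¹ᵁ V) (s : Γ(M, U)) :
    ev (compIso g e M).hom (pb g h' (pb f h s)) =
      pb k (le_preimage_of_comp_eq g e h h') s := by
  subst e
  rw [pb, pb, sharp_res, ev_res, ev_res, ev_compIso_sharp, pb]
  exact res_res (M := (pullback (g ≫ f)).obj M) (g.preimage_mono h) h' _

lemma ev_compIso_inv_pb {U : Z.Opens} {V : X.Opens} {W : Y.Opens}
    (h : V ≤ f ⁻¹ᵁ U) (h' : W ≤ g ⁻¹ᵁ V) (k' : W ≤ k ⁻¹ᵁ U) (s : Γ(M, U)) :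
    ev (compIso g e M).inv (pb k k' s) = pb g h' (pb f h s) := by
  rw [← ev_compIso_hom_pb g e h h', ev_hom_inv]

end compIso

/-- The pullback along `g` of a section of `f^* M`, as a section of `k^* M`, where `g ≫ f = k`. -/
def pbComp {M : Z.Modules} {f : X ⟶ Z} {k : Y ⟶ Z} (e : g ≫ f = k)
    (h : V ≤ g ⁻¹ᵁ U) (s : Γ((pullback f).obj M, U)) : Γ((pullback k).obj M, V) :=
  ev (compIso g e M).hom (pb g h s)

section pbComp
variable {M : Z.Modules} {f : X ⟶ Z} {k : Y ⟶ Z} (e : g ≫ f = k) (h : V ≤ g ⁻¹ᵁ U)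

@[simp] lemma pbComp_add (s t : Γ((pullback f).obj M, U)) :
    pbComp g e h (s + t) = pbComp g e h s + pbComp g e h t := by
  rw [pbComp, pb_add, ev_add, pbComp, pbComp]

@[simp] lemma pbComp_sum {J : Type*} (A : Finset J) (s : J → Γ((pullback f).obj M, U)) :
    pbComp g e h (∑ i ∈ A, s i) = ∑ i ∈ A, pbComp g e h (s i) := by
  rw [pbComp, pb_sum, ev_sum]
  rfl

lemma pbComp_smul (r : Γ(X, U)) (s : Γ((pullback f).obj M, U)) :
    pbComp g e h (r • s) = g.appLE U V h r • pbComp g e h s := by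
  rw [pbComp, pb_smul, ev_smul, pbComp]

lemma res_pbComp (h' : V' ≤ V) (s : Γ((pullback f).obj M, U)) :
    res h' (pbComp g e h s) = pbComp g e (h'.trans h) s := by
  rw [pbComp, ← ev_res, res_pb, pbComp]

lemma pbComp_res (h' : U ≤ U') (s : Γ((pullback f).obj M, U')) :
    pbComp g e h (res h' s) = pbComp g e (h.trans (g.preimage_mono h')) s := by
  rw [pbComp, pb_res, pbComp]

lemma pbComp_pb {A : Z.Opens} (h' : U ≤ f ⁻¹ᵁ A) (s : Γ(M, A)) :
    pbComp g e h (pb f h' s) = pb k (le_preimage_of_comp_eq g e h' h) s :=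
  ev_compIso_hom_pb g e h' h s

end pbComp

lemma ev_pullHom_pb {X₁ X₂ W W' : Scheme.{u}} {M : X₁.Modules} {N : X₂.Modules}
    {f₁ : W ⟶ X₁} {f₂ : W ⟶ X₂} (φ : (pullback f₁).obj M ⟶ (pullback f₂).obj N)
    (g : W' ⟶ W) {g₁ : W' ⟶ X₁} {g₂ : W' ⟶ X₂} (h₁ : g ≫ f₁ = g₁) (h₂ : g ≫ f₂ = g₂)
    {U : X₁.Opens} {V : W.Opens} {V' : W'.Opens} (h : V ≤ f₁ ⁻¹ᵁ U) (h' : V' ≤ g ⁻¹ᵁ V)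
    (k : V' ≤ g₁ ⁻¹ᵁ U) (s : Γ(M, U)) :
    ev (pullHom φ g h₁ h₂) (pb g₁ k s) = pbComp g h₂ h' (ev φ (pb f₁ h s)) := by
  rw [pbComp, ← ev_map_pb, ← ev_compIso_inv_pb g h₁ h h' k, pullHom_eq, ev_comp, ev_comp]

end pb

end AlgebraicGeometry.Scheme.Modules
end

noncomputable section

namespace AlgebraicGeometry.Scheme.Modules

/-- The structure sheaf as a module over itself. -/
abbrev unit (X : Scheme.{u}) : X.Modules := SheafOfModules.unit X.ringCatSheaf

/-- The section of the structure sheaf given by a function. -/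
def ofFn {X : Scheme.{u}} {U : X.Opens} (r : Γ(X, U)) : Γ(unit X, U) := r

/-- The function underlying a section of the structure sheaf. -/
def toFn {X : Scheme.{u}} {U : X.Opens} (r : Γ(unit X, U)) : Γ(X, U) := r

section unit
variable {X : Scheme.{u}} {U V : X.Opens}

@[simp] lemma ofFn_toFn (r : Γ(unit X, U)) : ofFn (toFn r) = r := rfl
@[simp] lemma toFn_ofFn (r : Γ(X, U)) : toFn (ofFn r) = r := rfl
@[simp] lemma toFn_add (r s : Γ(unit X, U)) : toFn (r + s) = toFn r + toFn s := rfl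
@[simp] lemma toFn_smul (r : Γ(X, U)) (s : Γ(unit X, U)) : toFn (r • s) = r * toFn s := rfl
lemma toFn_res (h : V ≤ U) (s : Γ(unit X, U)) :
    toFn (res h s) = X.presheaf.map (homOfLE h).op (toFn s) := rfl

lemma smul_ofFn_one (r : Γ(X, U)) : r • ofFn (1 : Γ(X, U)) = ofFn r := mul_one r

lemma eq_toFn_smul (s : Γ(unit X, U)) : s = toFn s • ofFn 1 := (mul_one (toFn s)).symm

lemma res_ofFn_one (h : V ≤ U) : res h (ofFn (1 : Γ(X, U))) = ofFn 1 :=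
  map_one (X.presheaf.map (homOfLE h).op).hom

end unit

/-- Sections `e` of `M` over `U` form a basis if every section of `M` over an open subset of `U`
is uniquely a linear combination of them. -/
def IsBasisOn {X : Scheme.{u}} {M : X.Modules} {U : X.Opens} {n : ℕ} (e : Fin n → Γ(M, U)) :
    Prop :=
  ∀ (V : X.Opens) (h : V ≤ U),
    Function.Bijective (fun f : Fin n → Γ(X, V) => ∑ i, f i • res h (e i))

section
variable {X Y : Scheme.{u}} {M N : X.Modules} {U V : X.Opens} {n : ℕ}

lemma IsBasisOn.of_le {e : Fin n → Γ(M, U)} (he : IsBasisOn e) (h : V ≤ U) :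
    IsBasisOn (fun i => res h (e i)) := by
  intro W hW
  simpa using he W (hW.trans h)

lemma bijective_ev (φ : M ≅ N) : Function.Bijective (fun s : Γ(M, U) => ev φ.hom s) :=
  ⟨fun s t h => by simpa using congrArg (ev φ.inv) h, fun t => ⟨ev φ.inv t, by simp⟩⟩

lemma IsBasisOn.map_iso {e : Fin n → Γ(M, U)} (he : IsBasisOn e) (φ : M ≅ N) :
    IsBasisOn (fun i => ev φ.hom (e i)) := by
  intro W hW
  convert (bijective_ev φ).comp (he W hW) using 1
  funext f
  simp [ev_smul, ev_res]

/-- A decomposition of a module as a direct sum of copies of the structure sheaf. -/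
structure FreeDecomp (M : X.Modules) (n : ℕ) where
  incl : Fin n → (unit X ⟶ M)
  proj : Fin n → (M ⟶ unit X)
  incl_proj_self (i : Fin n) : incl i ≫ proj i = 𝟙 _
  incl_proj_ne (i j : Fin n) (h : i ≠ j) : incl i ≫ proj j = 0
  sum : ∑ i, proj i ≫ incl i = 𝟙 M

namespace FreeDecomp

/-- The sections given by a decomposition. -/
def sec (D : FreeDecomp M n) (i : Fin n) : Γ(M, ⊤) := ev (D.incl i) (ofFn 1)

@[simp] lemma ev_zero_hom (s : Γ(M, U)) : ev (0 : M ⟶ N) s = 0 := rfl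

lemma ev_sum_hom {J : Type*} (A : Finset J) (φ : J → (M ⟶ N)) (s : Γ(M, U)) :
    ev (∑ i ∈ A, φ i) s = ∑ i ∈ A, ev (φ i) s :=
  map_sum (⟨⟨fun φ => ev φ s, rfl⟩, fun _ _ => rfl⟩ : (M ⟶ N) →+ Γ(N, U)) _ _

lemma isBasisOn (D : FreeDecomp M n) : IsBasisOn D.sec := by
  intro V hV
  have key (f : Fin n → Γ(X, V)) (j : Fin n) :
      ev (D.proj j) (∑ i, f i • res hV (D.sec i)) = ofFn (f j) := by
    simp only [ev_sum, ev_smul, ev_res, sec]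
    rw [Finset.sum_eq_single j]
    · rw [← ev_comp, D.incl_proj_self, ev_id, res_ofFn_one, smul_ofFn_one]
    · intro i _ hij
      rw [← ev_comp, D.incl_proj_ne i j hij, ev_zero_hom, res_zero, smul_zero]
    · simp
  constructor
  · intro f f' h
    funext j
    have := congrArg (ev (D.proj j)) h
    dsimp only at this
    rw [key, key] at this
    exact this
  · intro s
    refine ⟨fun i => toFn (ev (D.proj i) s), ?_⟩
    dsimp only
    have h1 : ∑ i, ev (D.proj i ≫ D.incl i) s = s := by
      rw [← ev_sum_hom, D.sum, ev_id]
    conv_rhs => rw [← h1]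
    refine Finset.sum_congr rfl fun i _ => ?_
    rw [ev_comp, eq_toFn_smul (ev (D.proj i) s), ev_smul, sec, ← ev_res, res_ofFn_one,
      ← eq_toFn_smul]

end FreeDecomp

/-- The decomposition given by a basis of global sections. -/
lemma IsBasisOn.exists_freeDecomp {e : Fin n → Γ(M, ⊤)} (he : IsBasisOn e) :
    ∃ D : FreeDecomp M n, D.sec = e := by
  let c (U : X.Opens) (s : Γ(M, U)) : Fin n → Γ(X, U) := ((he U le_top).2 s).choose
  have hc (U : X.Opens) (s : Γ(M, U)) : ∑ i, c U s i • res le_top (e i) = s :=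
    ((he U le_top).2 s).choose_spec
  have hc' (U : X.Opens) (f : Fin n → Γ(X, U)) : c U (∑ i, f i • res le_top (e i)) = f :=
    (he U le_top).1 (hc U _)
  have cext (U : X.Opens) (s : Γ(M, U)) (f : Fin n → Γ(X, U))
      (h : ∑ i, f i • res le_top (e i) = s) : c U s = f := by rw [← h, hc']
  have h1 (i : Fin n) : ∃ φ : unit X ⟶ M, ∀ (U : X.Opens) (s : Γ(unit X, U)),
      ev φ s = toFn s • res le_top (e i) := by
    apply exists_hom_ev
    · intro U s t; rw [toFn_add, add_smul]
    · intro U r s; rw [toFn_smul, mul_smul]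
    · intro U V h s; rw [res_smul, res_res, toFn_res]
  have h2 (i : Fin n) : ∃ φ : M ⟶ unit X, ∀ (U : X.Opens) (s : Γ(M, U)),
      ev φ s = ofFn (c U s i) := by
    apply exists_hom_ev
    · intro U s t
      rw [cext U (s + t) (c U s + c U t)]
      · rfl
      · simp only [Pi.add_apply, add_smul, Finset.sum_add_distrib, hc]
    · intro U r s
      rw [cext U (r • s) (fun i => r * c U s i)]
      · rfl
      · simp only [mul_smul, ← Finset.smul_sum, hc]
    · intro U V h s
      rw [cext V (res h s) (fun i => X.presheaf.map (homOfLE h).op (c U s i))]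
      · rfl
      · conv_rhs => rw [← hc U s]
        simp only [res_sum, res_smul, res_res]
  choose a ha using h1
  choose b hb using h2
  refine ⟨⟨a, b, ?_, ?_, ?_⟩, ?_⟩
  · intro i
    apply hom_ext_ev
    intro U s
    rw [ev_comp, ha, hb, ev_id, cext U _ (Pi.single i (toFn s))]
    · rw [Pi.single_eq_same, ofFn_toFn]
    · rw [Finset.sum_eq_single i (fun j _ h => by rw [Pi.single_eq_of_ne h, zero_smul]) (by simp),
        Pi.single_eq_same]
  · intro i j hij
    apply hom_ext_ev
    intro U s
    rw [ev_comp, ha, hb, FreeDecomp.ev_zero_hom, cext U _ (Pi.single i (toFn s))]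
    · rw [Pi.single_eq_of_ne hij.symm]; rfl
    · rw [Finset.sum_eq_single i (fun j _ h => by rw [Pi.single_eq_of_ne h, zero_smul]) (by simp),
        Pi.single_eq_same]
  · apply hom_ext_ev
    intro U s
    rw [FreeDecomp.ev_sum_hom, ev_id]
    conv_rhs => rw [← hc U s]
    refine Finset.sum_congr rfl fun i _ => ?_
    rw [ev_comp, hb, ha, toFn_ofFn]
  · funext i
    rw [FreeDecomp.sec, ha, toFn_ofFn, one_smul, res_self]

lemma _root_.CategoryTheory.Limits.IsColimit.exists_proj_of_cofan {C : Type*} [Category* C]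
    [Preadditive C] {J : Type*} [Fintype J] [DecidableEq J] {A B : C} {a : J → (A ⟶ B)}
    (hc : Limits.IsColimit (Limits.Cofan.mk B a)) :
    ∃ p : J → (B ⟶ A), (∀ i, a i ≫ p i = 𝟙 A) ∧ (∀ i j, i ≠ j → a i ≫ p j = 0) ∧
      ∑ i, p i ≫ a i = 𝟙 B := by
  let p (j : J) : B ⟶ A := Limits.Cofan.IsColimit.desc hc (fun i => if i = j then 𝟙 A else 0)
  have h (i j : J) : a i ≫ p j = if i = j then 𝟙 A else 0 := Limits.Cofan.IsColimit.fac hc _ i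
  refine ⟨p, fun i => by simp [h], fun i j hij => by simp [h, hij], ?_⟩
  refine Limits.Cofan.IsColimit.hom_ext hc _ _ fun i => ?_
  change a i ≫ _ = a i ≫ _
  rw [Preadditive.comp_sum, Finset.sum_eq_single i]
  · rw [← Category.assoc, h, if_pos rfl, Category.id_comp, Category.comp_id]
  · intro j _ hj
    rw [← Category.assoc, h, if_neg hj.symm, Limits.zero_comp]
  · simp

lemma FreeDecomp.nonempty_of_isColimit {a : ULift.{u} (Fin n) → (unit X ⟶ M)}
    (hc : Limits.IsColimit (Limits.Cofan.mk M a)) : Nonempty (FreeDecomp M n) := by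
  obtain ⟨p, h1, h2, h3⟩ := hc.exists_proj_of_cofan
  refine ⟨⟨fun i => a ⟨i⟩, fun i => p ⟨i⟩, fun i => h1 _,
    fun i j hij => h2 _ _ fun h => hij (congrArg ULift.down h), ?_⟩⟩
  rw [← h3]
  exact Fintype.sum_equiv Equiv.ulift.symm _ _ fun i => rfl

/-- The decomposition of a free module. -/
lemma nonempty_freeDecomp_free (X : Scheme.{u}) (n : ℕ) :
    Nonempty (FreeDecomp (SheafOfModules.free (ULift.{u} (Fin n)) : X.Modules) n) :=
  FreeDecomp.nonempty_of_isColimit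
    (SheafOfModules.isColimitFreeCofan (R := X.ringCatSheaf) (ULift.{u} (Fin n)))

/-- Two modules with decompositions of the same length are isomorphic. -/
lemma FreeDecomp.nonempty_iso (D : FreeDecomp M n) (D' : FreeDecomp N n) : Nonempty (M ≅ N) := by
  have key {M N : X.Modules} (D : FreeDecomp M n) (D' : FreeDecomp N n) :
      (∑ i, D.proj i ≫ D'.incl i) ≫ (∑ i, D'.proj i ≫ D.incl i) = 𝟙 M := by
    rw [Preadditive.sum_comp, ← D.sum]
    refine Finset.sum_congr rfl fun i _ => ?_
    rw [Preadditive.comp_sum, Finset.sum_eq_single i]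
    · rw [Category.assoc, ← Category.assoc (D'.incl i), D'.incl_proj_self, Category.id_comp]
    · intro j _ hj
      rw [Category.assoc, ← Category.assoc (D'.incl i), D'.incl_proj_ne i j hj.symm,
        Limits.zero_comp, Limits.comp_zero]
    · simp
  exact ⟨⟨_, _, key D D', key D' D⟩⟩

lemma isIso_unit_pullback (g : Y ⟶ X) : ∃ α : (pullback g).obj (unit X) ≅ unit Y,
    ∀ (U : X.Opens) (V : Y.Opens) (h : V ≤ g ⁻¹ᵁ U), ev α.hom (pb g h (ofFn 1)) = ofFn 1 := by
  have : (TopologicalSpace.Opens.map g.base).Final := final_opensMap g.base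
  have : (SheafOfModules.pushforward.{u} g.toRingCatSheafHom).IsRightAdjoint :=
    inferInstanceAs (pushforward g).IsRightAdjoint
  let α : (pullback g).obj (unit X) ⟶ unit Y :=
    SheafOfModules.pullbackObjUnitToUnit g.toRingCatSheafHom
  have : IsIso α :=
    SheafOfModules.instIsIsoPullbackObjUnitToUnitOfFinal g.toRingCatSheafHom
  have hα : ((pullbackPushforwardAdjunction g).homEquiv _ _) α =
      SheafOfModules.unitToPushforwardObjUnit g.toRingCatSheafHom :=
    Equiv.apply_symm_apply _ _
  refine ⟨asIso α, fun U V h => ?_⟩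
  rw [pb, ev_res, asIso_hom, ← ev_homEquiv, hα]
  exact map_one (g.appLE U V h).hom

lemma top_le_preimage (g : Y ⟶ X) : (⊤ : Y.Opens) ≤ g ⁻¹ᵁ ⊤ := le_rfl

lemma FreeDecomp.exists_pullback (g : Y ⟶ X) (D : FreeDecomp M n) :
    ∃ D' : FreeDecomp ((pullback g).obj M) n,
      ∀ i, D'.sec i = pb g (top_le_preimage g) (D.sec i) := by
  obtain ⟨α, hα⟩ := isIso_unit_pullback g
  refine ⟨⟨fun i => α.inv ≫ (pullback g).map (D.incl i),
    fun i => (pullback g).map (D.proj i) ≫ α.hom, ?_, ?_, ?_⟩, ?_⟩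
  · intro i
    rw [Category.assoc, ← Functor.map_comp_assoc, D.incl_proj_self]
    simp
  · intro i j hij
    rw [Category.assoc, ← Functor.map_comp_assoc, D.incl_proj_ne i j hij]
    simp
  · simp only [Category.assoc, Iso.hom_inv_id_assoc, ← Functor.map_comp]
    rw [← Functor.map_sum, D.sum, CategoryTheory.Functor.map_id]
  · intro i
    dsimp only [sec]
    rw [ev_comp, ← ev_map_pb]
    refine congrArg (ev ((pullback g).map (D.incl i))) ?_
    rw [← ev_hom_inv α (pb g (top_le_preimage g) (ofFn 1)), hα]

end

section OpenImmersion

variable {X Y : Scheme.{u}} {M : X.Modules} {U V : X.Opens} {n : ℕ}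

lemma bijective_res_of_eq (h : V = U) (h' : V ≤ U) :
    Function.Bijective (fun s : Γ(M, U) => res h' s) := by
  subst h
  convert Function.bijective_id
  simp

lemma bijective_pb_of_isOpenImmersion (j : Y ⟶ X) [IsOpenImmersion j] (hU : U ≤ j.opensRange)
    {V : Y.Opens} (hV : V = j ⁻¹ᵁ U) :
    Function.Bijective (fun s : Γ(M, U) => pb j hV.le s) := by
  subst hV
  have h1 := Adjunction.unit_leftAdjointUniq_hom_app (restrictAdjunction j)
    (pullbackPushforwardAdjunction j) M
  have h2 (s : Γ(M, U)) : pb j le_rfl s = ev ((restrictFunctorIsoPullback j).hom.app M)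
      (U := j ⁻¹ᵁ U) (res (M := M) (j.image_preimage_le U) s) := by
    rw [← sharp_eq_pb, sharp, ← h1]
    rfl
  have h3 : Function.Bijective (fun s : Γ(M.restrict j, j ⁻¹ᵁ U) =>
      ev ((restrictFunctorIsoPullback j).hom.app M) s) :=
    bijective_ev ((restrictFunctorIsoPullback j).app M)
  have h4 : j ''ᵁ j ⁻¹ᵁ U = U := by
    rw [j.image_preimage_eq_opensRange_inf, inf_eq_right.mpr hU]
  have h5 := h3.comp (bijective_res_of_eq (M := M) h4 (j.image_preimage_le U))
  convert h5 using 1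
  funext s
  exact h2 s

/-- A family of sections is a basis if and only if its pullback to the open is one. -/
lemma isBasisOn_pb_ι_iff {e : Fin n → Γ(M, U)} (h : (⊤ : (U : Scheme.{u}).Opens) ≤ U.ι ⁻¹ᵁ U) :
    IsBasisOn (fun i => pb U.ι h (e i)) ↔ IsBasisOn e := by
  have key (V : X.Opens) (hV : V ≤ U) (V' : (U : Scheme.{u}).Opens) (hV' : V' = U.ι ⁻¹ᵁ V) :
      Function.Bijective (fun f : Fin n → Γ(X, V) => ∑ i, f i • res hV (e i)) ↔
      Function.Bijective (fun f : Fin n → Γ(U, V') =>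
        ∑ i, f i • res (le_top : V' ≤ ⊤) (pb U.ι h (e i))) := by
    have hVr : V ≤ U.ι.opensRange := by simpa using hV
    have hb := bijective_pb_of_isOpenImmersion (M := M) U.ι hVr hV'
    have hr : Function.Bijective (fun r : Γ(X, V) => U.ι.appLE V V' hV'.le r) := by
      subst hV'
      have : IsIso (U.ι.app V) := Scheme.Hom.isIso_app _ _ hVr
      have e : U.ι.appLE V (U.ι ⁻¹ᵁ V) le_rfl = U.ι.app V := by rw [Scheme.Hom.app_eq_appLE]
      rw [e]
      exact ConcreteCategory.bijective_of_isIso _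
    have hr' : Function.Bijective (fun (f : Fin n → Γ(X, V)) i => U.ι.appLE V V' hV'.le (f i)) :=
      ⟨fun f f' h => funext fun i => hr.1 (congrFun h i),
        fun f => ⟨fun i => (hr.2 (f i)).choose, funext fun i => (hr.2 (f i)).choose_spec⟩⟩
    rw [← Function.Bijective.of_comp_iff' hb, ← Function.Bijective.of_comp_iff _ hr']
    have : (fun s : Γ(M, V) => pb U.ι hV'.le s) ∘
        (fun f : Fin n → Γ(X, V) => ∑ i, f i • res hV (e i)) =
      (fun f : Fin n → Γ(U, V') => ∑ i, f i • res (le_top : V' ≤ ⊤) (pb U.ι h (e i))) ∘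
        (fun (f : Fin n → Γ(X, V)) i => U.ι.appLE V V' hV'.le (f i)) := by
      funext f
      simp [pb_smul]
    rw [this]
  constructor
  · intro he V hV
    rw [key V hV _ rfl]
    exact he _ _
  · intro he V' hV'
    have h1 : V' = U.ι ⁻¹ᵁ (U.ι ''ᵁ V') := (U.ι.preimage_image_eq V').symm
    have h2 : U.ι ''ᵁ V' ≤ U := by simpa using U.ι.image_le_opensRange V'
    exact (key _ h2 V' h1).1 (he _ h2)

lemma IsBasisOn.of_pb_top {g : Y ⟶ X} {e : Fin n → Γ(M, ⊤)} (he : IsBasisOn e) :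
    IsBasisOn (fun i => pb g (top_le_preimage g) (e i)) := by
  obtain ⟨D, rfl⟩ := he.exists_freeDecomp
  obtain ⟨D', hD'⟩ := D.exists_pullback g
  simpa only [← hD'] using D'.isBasisOn

lemma IsBasisOn.pb {g : Y ⟶ X} {e : Fin n → Γ(M, U)} (he : IsBasisOn e) {V : Y.Opens}
    (hV : V ≤ g ⁻¹ᵁ U) : IsBasisOn (fun i => pb g hV (e i)) := by
  have h1 : (⊤ : (U : Scheme.{u}).Opens) ≤ U.ι ⁻¹ᵁ U := by simp
  have h2 : (⊤ : (V : Scheme.{u}).Opens) ≤ V.ι ⁻¹ᵁ V := by simp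
  let g' : (V : Scheme.{u}) ⟶ U := IsOpenImmersion.lift U.ι (V.ι ≫ g) (by
    rintro _ ⟨x, rfl⟩
    rw [Scheme.Opens.range_ι]
    exact hV x.2)
  have hg' : g' ≫ U.ι = V.ι ≫ g := IsOpenImmersion.lift_fac _ _ _
  have key (i : Fin n) : ev (compIso g' hg' M ≪≫ (compIso V.ι (f := g) rfl M).symm).hom
      (Modules.pb g' (top_le_preimage g') (Modules.pb U.ι h1 (e i))) =
        Modules.pb V.ι h2 (Modules.pb g hV (e i)) := by
    rw [Iso.trans_hom, ev_comp, Iso.symm_hom, ev_compIso_hom_pb, ev_compIso_inv_pb]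
  have h3 := (((isBasisOn_pb_ι_iff h1).2 he).of_pb_top (g := g')).map_iso
    (compIso g' hg' M ≪≫ (compIso V.ι (f := g) rfl M).symm)
  rw [← isBasisOn_pb_ι_iff h2, ← funext key]
  exact h3

/-- A vector bundle has a basis locally. -/
lemma IsVectorBundle.exists_isBasisOn (hM : IsVectorBundle M) (x : X) :
    ∃ (U : X.Opens) (_ : x ∈ U) (n : ℕ) (e : Fin n → Γ(M, U)), IsBasisOn e := by
  obtain ⟨U, hx, n, ⟨α⟩⟩ := hM x
  obtain ⟨D⟩ := nonempty_freeDecomp_free (U : Scheme.{u}) n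
  have h := D.isBasisOn.map_iso (α.symm ≪≫ (restrictFunctorIsoPullback U.ι).app M)
  have h1 : (⊤ : (U : Scheme.{u}).Opens) = U.ι ⁻¹ᵁ U := by simp
  choose e he using fun i => (bijective_pb_of_isOpenImmersion (M := M) U.ι (U := U) (by simp) h1).2
    (ev (α.symm ≪≫ (restrictFunctorIsoPullback U.ι).app M).hom (D.sec i))
  refine ⟨U, hx, n, e, ?_⟩
  rw [← isBasisOn_pb_ι_iff h1.le]
  simpa only [he] using h

/-- A module which has a basis locally is a vector bundle. -/
lemma isVectorBundle_of_isBasisOn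
    (h : ∀ x : X, ∃ (U : X.Opens) (_ : x ∈ U) (n : ℕ) (e : Fin n → Γ(M, U)), IsBasisOn e) :
    IsVectorBundle M := by
  intro x
  obtain ⟨U, hx, n, e, he⟩ := h x
  have h1 : (⊤ : (U : Scheme.{u}).Opens) ≤ U.ι ⁻¹ᵁ U := by simp
  obtain ⟨D, -⟩ := ((isBasisOn_pb_ι_iff h1).2 he).exists_freeDecomp
  obtain ⟨D'⟩ := nonempty_freeDecomp_free (U : Scheme.{u}) n
  obtain ⟨α⟩ := D.nonempty_iso D'
  exact ⟨U, hx, n, ⟨(restrictFunctorIsoPullback U.ι).app M ≪≫ α⟩⟩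

end OpenImmersion

end AlgebraicGeometry.Scheme.Modules
end

noncomputable section

namespace AlgebraicGeometry.Scheme

lemma appTop_eq_appLE {X Y : Scheme.{u}} (f : X ⟶ Y) :
    f.appTop = f.appLE (⊤ : Y.Opens) (⊤ : X.Opens) (f.preimage_top).ge :=
  Scheme.Hom.app_eq_appLE f

/-- The morphism to the affine line given by a function. -/
lemma exists_hom_appTop_X (R : CommRingCat.{u})
    (hR : R = CommRingCat.of (Polynomial (ULift.{u} ℤ))) : ∃ x : Γ(Spec R, ⊤),
    (∀ (T : Scheme.{u}) (f : Γ(T, ⊤)), ∃ a : T ⟶ Spec R, a.appTop x = f) ∧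
    ∀ (T : Scheme.{u}) (a b : T ⟶ Spec R), a.appTop x = b.appTop x → a = b := by
  subst hR
  refine ⟨(ΓSpecIso _).inv Polynomial.X, fun T f => ?_, fun T a b h => ?_⟩
  · let φ : CommRingCat.of (Polynomial (ULift.{u} ℤ)) ⟶ Γ(T, ⊤) := CommRingCat.ofHom
      (Polynomial.eval₂RingHom ((Int.castRingHom Γ(T, ⊤)).comp ULift.ringEquiv.toRingHom) f)
    refine ⟨T.toSpecΓ ≫ Spec.map φ, ?_⟩
    have h : (ΓSpecIso _).inv ≫ (T.toSpecΓ ≫ Spec.map φ).appTop = φ := by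
      rw [Scheme.Hom.comp_appTop, ← ΓSpecIso_inv_naturality_assoc, toSpecΓ_appTop,
        Iso.inv_hom_id, Category.comp_id]
    have h' : φ.hom Polynomial.X = f := by simp [φ]
    exact (congrArg (fun ψ => ψ.hom Polynomial.X) h).trans h'
  · apply ext_to_Spec
    ext1
    apply Polynomial.ringHom_ext'
    · exact RingHom.ext fun n => RingHom.congr_fun (Subsingleton.elim
        ((_ : Polynomial (ULift.{u} ℤ) →+* Γ(T, ⊤)).comp (Polynomial.C.comp
          ULift.ringEquiv.symm.toRingHom) : ℤ →+* _)
        ((_ : Polynomial (ULift.{u} ℤ) →+* Γ(T, ⊤)).comp (Polynomial.C.comp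
          ULift.ringEquiv.symm.toRingHom))) n.down
    · exact h

section
variable {T T' : Scheme.{u}} (q : T' ⟶ T) [Flat q] [Surjective q] [QuasiCompact q]

lemma appTop_injective_of_fpqc : Function.Injective q.appTop := by
  obtain ⟨x, hx, hx'⟩ := exists_hom_appTop_X.{u} _ rfl
  intro s t h
  obtain ⟨a, rfl⟩ := hx T s
  obtain ⟨b, rfl⟩ := hx T t
  have : q ≫ a = q ≫ b := hx' _ _ _ (by
    rw [Scheme.Hom.comp_appTop, Scheme.Hom.comp_appTop]; exact h)
  rw [(cancel_epi q).1 this]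

lemma exists_appTop_eq_of_fpqc (f : Γ(T', ⊤)) (hf : ∀ (Z : Scheme.{u}) (g₁ g₂ : Z ⟶ T'),
    g₁ ≫ q = g₂ ≫ q → g₁.appTop f = g₂.appTop f) : ∃ t : Γ(T, ⊤), q.appTop t = f := by
  obtain ⟨x, hx, hx'⟩ := exists_hom_appTop_X.{u} _ rfl
  obtain ⟨a, rfl⟩ := hx T' f
  have h : ∀ {Z : Scheme.{u}} (g₁ g₂ : Z ⟶ T'), g₁ ≫ q = g₂ ≫ q → g₁ ≫ a = g₂ ≫ a :=
    fun g₁ g₂ h => hx' _ _ _ (by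
      rw [Scheme.Hom.comp_appTop, Scheme.Hom.comp_appTop]; exact hf _ g₁ g₂ h)
  exact ⟨(EffectiveEpi.desc q a h).appTop x, by
    conv_rhs => rw [← EffectiveEpi.fac q a h, Scheme.Hom.comp_appTop]
    rfl⟩

lemma bijective_ι_appLE {X : Scheme.{u}} (U : X.Opens) (h : ⊤ ≤ U.ι ⁻¹ᵁ U) :
    Function.Bijective (U.ι.appLE U ⊤ h) := by
  exact ConcreteCategory.bijective_of_isIso _

lemma morphismRestrict_appTop_ι {T T' : Scheme.{u}} (q : T' ⟶ T) (U : T.Opens)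
    (h1 : ⊤ ≤ U.ι ⁻¹ᵁ U) (h2 : ⊤ ≤ (q ⁻¹ᵁ U).ι ⁻¹ᵁ (q ⁻¹ᵁ U)) (t : Γ(T, U)) :
    (q ∣_ U).appTop (U.ι.appLE U ⊤ h1 t) =
      (q ⁻¹ᵁ U).ι.appLE (q ⁻¹ᵁ U) ⊤ h2 (q.app U t) := by
  have : U.ι.appLE U ⊤ h1 ≫ (q ∣_ U).appTop = q.app U ≫ (q ⁻¹ᵁ U).ι.appLE (q ⁻¹ᵁ U) ⊤ h2 := by
    rw [appTop_eq_appLE, Scheme.Hom.app_eq_appLE,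
      Scheme.Hom.appLE_comp_appLE, Scheme.Hom.appLE_comp_appLE]
    simp only [morphismRestrict_ι]
  exact congrArg (fun φ => φ.hom t) this

lemma app_injective_of_fpqc (U : T.Opens) : Function.Injective (q.app U) := by
  have h1 : (⊤ : (U : Scheme.{u}).Opens) ≤ U.ι ⁻¹ᵁ U := by simp
  have h2 : (⊤ : (q ⁻¹ᵁ U : Scheme.{u}).Opens) ≤ (q ⁻¹ᵁ U).ι ⁻¹ᵁ (q ⁻¹ᵁ U) := by simp
  have key (t : Γ(T, U)) : (q ∣_ U).appTop (U.ι.appLE U ⊤ h1 t) =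
      (q ⁻¹ᵁ U).ι.appLE (q ⁻¹ᵁ U) ⊤ h2 (q.app U t) := morphismRestrict_appTop_ι q U h1 h2 t
  have : Surjective (q ∣_ U) := IsZariskiLocalAtTarget.restrict ‹_› U
  intro s t h
  apply (bijective_ι_appLE U h1).1
  apply appTop_injective_of_fpqc (q ∣_ U)
  rw [key, key, h]

lemma exists_app_eq_of_fpqc {T'' : Scheme.{u}} {p₁ p₂ : T'' ⟶ T'} (hp : IsPullback p₁ p₂ q q)
    (U : T.Opens) (f : Γ(T', q ⁻¹ᵁ U)) {V : T''.Opens} (h₁ : V = p₁ ⁻¹ᵁ q ⁻¹ᵁ U)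
    (h₂ : V ≤ p₂ ⁻¹ᵁ q ⁻¹ᵁ U) (hf : p₁.appLE _ V h₁.le f = p₂.appLE _ V h₂ f) :
    ∃ t : Γ(T, U), q.app U t = f := by
  have h1 : (⊤ : (U : Scheme.{u}).Opens) ≤ U.ι ⁻¹ᵁ U := by simp
  have h2 : (⊤ : (q ⁻¹ᵁ U : Scheme.{u}).Opens) ≤ (q ⁻¹ᵁ U).ι ⁻¹ᵁ (q ⁻¹ᵁ U) := by simp
  have : Surjective (q ∣_ U) := IsZariskiLocalAtTarget.restrict ‹_› U
  obtain ⟨t, ht⟩ := exists_appTop_eq_of_fpqc (q ∣_ U)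
    ((q ⁻¹ᵁ U).ι.appLE (q ⁻¹ᵁ U) ⊤ h2 f) (by
    intro Z g₁ g₂ h
    have h' : (g₁ ≫ (q ⁻¹ᵁ U).ι) ≫ q = (g₂ ≫ (q ⁻¹ᵁ U).ι) ≫ q := by
      simp only [Category.assoc, ← morphismRestrict_ι]
      rw [reassoc_of% h]
    have e1 := hp.lift_fst _ _ h'
    have e2 := hp.lift_snd _ _ h'
    generalize hp.lift _ _ h' = l at e1 e2
    have hV : (⊤ : Z.Opens) ≤ l ⁻¹ᵁ V := by
      rw [h₁, ← Scheme.Hom.comp_preimage, e1, Scheme.Hom.comp_preimage]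
      exact g₁.preimage_mono h2
    have key {p : T'' ⟶ T'} {g : Z ⟶ (q ⁻¹ᵁ U : Scheme.{u})} (hVp : V ≤ p ⁻¹ᵁ q ⁻¹ᵁ U)
        (e : l ≫ p = g ≫ (q ⁻¹ᵁ U).ι) : g.appTop ((q ⁻¹ᵁ U).ι.appLE (q ⁻¹ᵁ U) ⊤ h2 f) =
          l.appLE V ⊤ hV (p.appLE _ V hVp f) := by
      have : (q ⁻¹ᵁ U).ι.appLE (q ⁻¹ᵁ U) ⊤ h2 ≫ g.appTop = p.appLE _ V hVp ≫ l.appLE V ⊤ hV := by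
        rw [appTop_eq_appLE,
          Scheme.Hom.appLE_comp_appLE, Scheme.Hom.appLE_comp_appLE]
        simp only [e]
      exact congrArg (fun φ => φ.hom f) this
    rw [key h₁.le e1, key h₂ e2, hf])
  obtain ⟨t', rfl⟩ := (bijective_ι_appLE U h1).2 t
  refine ⟨t', (bijective_ι_appLE (q ⁻¹ᵁ U) h2).1 ?_⟩
  rw [← ht, morphismRestrict_appTop_ι q U h1 h2]
end

end AlgebraicGeometry.Scheme

namespace AlgebraicGeometry.Scheme.Modules

section
variable {T T' T'' : Scheme.{u}} {q : T' ⟶ T} [Flat q] [Surjective q] [QuasiCompact q]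
  {p₁ p₂ : T'' ⟶ T'} {r : T'' ⟶ T} {E F : T.Modules}

lemma pb_injective_of_fpqc (hF : IsVectorBundle F) (U : T.Opens) :
    Function.Injective (fun s : Γ(F, U) => pb q (V := q ⁻¹ᵁ U) le_rfl s) := by
  intro s t h
  choose W hW n e he using fun x : U => hF.exists_isBasisOn x.1
  refine eq_of_res_eq (fun x : U => U ⊓ W x) (fun _ => inf_le_left) (fun x hx => ?_) fun x => ?_
  · exact TopologicalSpace.Opens.mem_iSup.2 ⟨⟨x, hx⟩, hx, hW _⟩
  have hb := (he x).of_le (inf_le_right : U ⊓ W x ≤ W x)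
  have hb' := hb.pb (g := q) (V := q ⁻¹ᵁ (U ⊓ W x)) le_rfl
  have h' := congrArg (res (q.preimage_mono (inf_le_left : U ⊓ W x ≤ U))) h
  simp only [res_pb] at h'
  obtain ⟨a, ha⟩ := (hb _ le_rfl).2 (res inf_le_left s)
  obtain ⟨b, hb2⟩ := (hb _ le_rfl).2 (res inf_le_left t)
  dsimp only at ha hb2
  rw [← ha, ← hb2]
  have ha' := congrArg (pb q (V := q ⁻¹ᵁ (U ⊓ W x)) le_rfl) ha
  have hb2' := congrArg (pb q (V := q ⁻¹ᵁ (U ⊓ W x)) le_rfl) hb2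
  simp only [pb_sum, pb_smul, pb_res] at ha' hb2'
  have h3 : (fun i => q.appLE _ (q ⁻¹ᵁ (U ⊓ W x)) le_rfl (a i)) =
      fun i => q.appLE _ (q ⁻¹ᵁ (U ⊓ W x)) le_rfl (b i) := by
    apply (hb' _ le_rfl).1
    simp only [res_pb, pb_res]
    rw [ha', hb2', h']
  have h4 : a = b := by
    funext i
    have := congrFun h3 i
    simp only [← Scheme.Hom.app_eq_appLE] at this
    exact app_injective_of_fpqc q _ this
  rw [h4]

lemma exists_pb_eq_of_fpqc (hF : IsVectorBundle F) (hp : IsPullback p₁ p₂ q q)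
    (e₁ : p₁ ≫ q = r) (e₂ : p₂ ≫ q = r) (U : T.Opens) (s : Γ((pullback q).obj F, q ⁻¹ᵁ U))
    {V : T''.Opens} (h₁ : V = p₁ ⁻¹ᵁ q ⁻¹ᵁ U)
    (h₂ : V ≤ p₂ ⁻¹ᵁ q ⁻¹ᵁ U) (hs : pbComp p₁ e₁ h₁.le s = pbComp p₂ e₂ h₂ s) :
    ∃ t : Γ(F, U), pb q le_rfl t = s := by
  choose W hW n e he using fun x : U => hF.exists_isBasisOn x.1
  have key (x : U) : ∃ t : Γ(F, U ⊓ W x), pb q (V := q ⁻¹ᵁ (U ⊓ W x)) le_rfl t =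
      res (q.preimage_mono inf_le_left) s := by
    set W' := U ⊓ W x
    have hWU : W' ≤ U := inf_le_left
    have hb := (he x).of_le (inf_le_right : W' ≤ W x)
    have hb' := hb.pb (g := q) (V := q ⁻¹ᵁ W') le_rfl
    let V' : T''.Opens := p₁ ⁻¹ᵁ q ⁻¹ᵁ W'
    have hr : V' = r ⁻¹ᵁ W' := by subst e₁; rfl
    have h₂' : V' ≤ p₂ ⁻¹ᵁ q ⁻¹ᵁ W' := by rw [hr]; subst e₂; exact le_rfl
    have hV : V' ≤ V := by
      rw [h₁]; exact p₁.preimage_mono (q.preimage_mono hWU)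
    have hb'' := hb.pb (g := r) (V := V') hr.le
    obtain ⟨f, hf⟩ := (hb' _ le_rfl).2 (res (q.preimage_mono hWU) s)
    simp only [res_pb, pb_res] at hf
    have hs' := congrArg (res hV) hs
    rw [res_pbComp, res_pbComp, ← pbComp_res p₁ e₁ (U := q ⁻¹ᵁ W') le_rfl (q.preimage_mono hWU),
      ← pbComp_res p₂ e₂ (U := q ⁻¹ᵁ W') h₂' (q.preimage_mono hWU), ← hf] at hs'
    simp only [pbComp_sum, pbComp_smul, pbComp_pb] at hs'
    have hff (i) : p₁.appLE _ V' le_rfl (f i) = p₂.appLE _ V' h₂' (f i) := by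
      refine congrFun (f := fun i => p₁.appLE _ V' le_rfl (f i))
        (g := fun i => p₂.appLE _ V' h₂' (f i)) ((hb'' _ le_rfl).1 ?_) i
      simpa only [res_pb, pb_res] using hs'
    choose a ha using fun i => exists_app_eq_of_fpqc q hp W' (f i) rfl h₂' (hff i)
    refine ⟨∑ i, a i • res inf_le_right (e x i), ?_⟩
    rw [← hf]
    simp only [pb_sum, pb_smul, pb_res, ← Scheme.Hom.app_eq_appLE]
    exact Finset.sum_congr rfl fun i _ => by rw [← ha i]
  choose t ht using key
  have hcov : U ≤ ⨆ x, U ⊓ W x := fun x hx =>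
    TopologicalSpace.Opens.mem_iSup.2 ⟨⟨x, hx⟩, hx, hW _⟩
  obtain ⟨t', ht'⟩ := exists_res_eq (fun x : U => U ⊓ W x) (fun _ => inf_le_left) hcov t (by
    intro x y
    apply pb_injective_of_fpqc (q := q) hF
    have h1 := congrArg (res (q.preimage_mono (inf_le_left : (U ⊓ W x) ⊓ (U ⊓ W y) ≤ _))) (ht x)
    have h2 := congrArg (res (q.preimage_mono (inf_le_right : (U ⊓ W x) ⊓ (U ⊓ W y) ≤ _))) (ht y)
    rw [res_pb, res_res] at h1 h2
    dsimp only
    rw [pb_res, pb_res, h1, h2])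
  refine ⟨t', ?_⟩
  refine eq_of_res_eq (fun x : U => q ⁻¹ᵁ (U ⊓ W x)) (fun _ => q.preimage_mono inf_le_left)
    (fun x hx => ?_) fun x => ?_
  · exact TopologicalSpace.Opens.mem_iSup.2 ⟨⟨q x, hx⟩, hx, hW _⟩
  · rw [← ht, ← ht', res_pb, pb_res]

/-- Morphisms of vector bundles satisfy descent along faithfully flat quasi-compact morphisms. -/
theorem exists_map_eq_of_fpqc (hF : IsVectorBundle F) (hp : IsPullback p₁ p₂ q q)
    (e₁ : p₁ ≫ q = r) (e₂ : p₂ ≫ q = r) (ψ : (pullback q).obj E ⟶ (pullback q).obj F)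
    (hψ : pullHom ψ p₁ e₁ e₁ = pullHom ψ p₂ e₂ e₂) : ∃ φ : E ⟶ F, (pullback q).map φ = ψ := by
  have key (U : T.Opens) (s : Γ(E, U)) : ∃ t : Γ(F, U), pb q (V := q ⁻¹ᵁ U) le_rfl t =
      ev ψ (pb q le_rfl s) := by
    have h₂ : p₁ ⁻¹ᵁ q ⁻¹ᵁ U ≤ p₂ ⁻¹ᵁ q ⁻¹ᵁ U := by
      have : p₁ ≫ q = p₂ ≫ q := e₁.trans e₂.symm
      change (p₁ ≫ q) ⁻¹ᵁ U ≤ (p₂ ≫ q) ⁻¹ᵁ U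
      rw [this]
    have hr : p₁ ⁻¹ᵁ q ⁻¹ᵁ U ≤ r ⁻¹ᵁ U := by subst e₁; exact le_rfl
    apply exists_pb_eq_of_fpqc hF hp e₁ e₂ U _ rfl h₂
    rw [← ev_pullHom_pb ψ p₁ e₁ e₁ le_rfl le_rfl hr, ← ev_pullHom_pb ψ p₂ e₂ e₂ le_rfl h₂ hr, hψ]
  choose f hf using key
  have inj (U : T.Opens) := pb_injective_of_fpqc (q := q) hF U
  obtain ⟨φ, hφ⟩ := exists_hom_ev f
    (fun U s t => inj U (by dsimp only; rw [hf, pb_add, pb_add, ev_add, hf, hf]))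
    (fun U r s => inj U (by dsimp only; rw [hf, pb_smul, pb_smul, ev_smul, hf]))
    (fun U V h s => inj V (by
      dsimp only
      rw [hf, pb_res, pb_res, ← res_pb q le_rfl (q.preimage_mono h), ev_res, ← hf, res_pb]))
  refine ⟨φ, hom_ext_pb fun U s => ?_⟩
  rw [ev_map_pb, hφ, hf]

theorem map_injective_of_fpqc (hF : IsVectorBundle F) {φ ψ : E ⟶ F}
    (h : (pullback q).map φ = (pullback q).map ψ) : φ = ψ := by
  apply hom_ext_ev
  intro U s
  apply pb_injective_of_fpqc (q := q) hF
  dsimp only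
  rw [← ev_map_pb, h, ev_map_pb]

end

end AlgebraicGeometry.Scheme.Modules
end

noncomputable section

namespace AlgebraicGeometry.Scheme.Modules

section
variable {X Y Z T : Scheme.{u}} {M : Z.Modules}

lemma hom_ext_pb_pb {f : X ⟶ Z} {g : Y ⟶ X} {K : Y.Modules}
    {α β : (pullback g).obj ((pullback f).obj M) ⟶ K}
    (h : ∀ (U : Z.Opens) (s : Γ(M, U)),
      ev α (pb g (V := g ⁻¹ᵁ f ⁻¹ᵁ U) le_rfl (pb f (V := f ⁻¹ᵁ U) le_rfl s)) =
        ev β (pb g le_rfl (pb f le_rfl s))) : α = β := by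
  rw [← cancel_epi (compIso g (f := f) rfl M).inv]
  refine hom_ext_pb fun U s => ?_
  have := ev_compIso_inv_pb g (rfl : g ≫ f = g ≫ f) (le_refl (f ⁻¹ᵁ U)) (le_refl ((g ≫ f) ⁻¹ᵁ U))
    le_rfl s
  rw [ev_comp, ev_comp, this]
  exact h U s

lemma compIso_assoc {f : X ⟶ Z} {g : Y ⟶ X} {h : T ⟶ Y} {k : Y ⟶ Z} {l : T ⟶ Z} {m : T ⟶ X}
    (e₁ : g ≫ f = k) (e₂ : h ≫ k = l) (e₃ : h ≫ g = m) (e₄ : m ≫ f = l) :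
    (pullback h).map (compIso g e₁ M).hom ≫ (compIso h e₂ M).hom =
      (compIso h e₃ ((pullback f).obj M)).hom ≫ (compIso m e₄ M).hom := by
  rw [← cancel_epi (compIso h e₃ ((pullback f).obj M)).inv]
  refine hom_ext_pb_pb fun U s => ?_
  have hV : m ⁻¹ᵁ f ⁻¹ᵁ U ≤ h ⁻¹ᵁ g ⁻¹ᵁ f ⁻¹ᵁ U := by subst e₃; exact le_rfl
  rw [ev_comp, ev_comp, ev_comp, ev_comp,
    ev_compIso_inv_pb (V := g ⁻¹ᵁ f ⁻¹ᵁ U) h e₃ le_rfl hV, ev_map_pb, ev_compIso_hom_pb,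
    ev_compIso_hom_pb, ev_compIso_hom_pb, ev_compIso_hom_pb]

variable {f : X ⟶ Z} {g : Y ⟶ X} {k : Y ⟶ Z} {U : X.Opens} {V : Y.Opens} {W : T.Opens}

lemma pbComp_pbComp {h : T ⟶ Y} {l : T ⟶ Z} {m : T ⟶ X}
    (e₁ : g ≫ f = k) (e₂ : h ≫ k = l) (e₃ : h ≫ g = m) (e₄ : m ≫ f = l) (hV : V ≤ g ⁻¹ᵁ U)
    (hW : W ≤ h ⁻¹ᵁ V) (hm : W ≤ m ⁻¹ᵁ U) (s : Γ((pullback f).obj M, U)) :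
    pbComp h e₂ hW (pbComp g e₁ hV s) = pbComp m e₄ hm s := by
  rw [pbComp, pbComp, ← ev_map_pb, ← ev_comp, compIso_assoc e₁ e₂ e₃ e₄, ev_comp,
    ev_compIso_hom_pb, pbComp]

lemma ev_compIso_inv_pbComp (e : g ≫ f = k) (h : V ≤ g ⁻¹ᵁ U) (s : Γ((pullback f).obj M, U)) :
    ev (compIso g e M).inv (pbComp g e h s) = pb g h s := by
  rw [pbComp, ev_hom_inv]

lemma ev_pullHom_pbComp {X₁ X₂ W W' : Scheme.{u}} {M : X₁.Modules} {N : X₂.Modules}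
    {f₁ : W ⟶ X₁} {f₂ : W ⟶ X₂} (φ : (pullback f₁).obj M ⟶ (pullback f₂).obj N)
    (g : W' ⟶ W) {g₁ : W' ⟶ X₁} {g₂ : W' ⟶ X₂} (h₁ : g ≫ f₁ = g₁) (h₂ : g ≫ f₂ = g₂)
    {V : W.Opens} {V' : W'.Opens} (h' : V' ≤ g ⁻¹ᵁ V) (s : Γ((pullback f₁).obj M, V)) :
    ev (pullHom φ g h₁ h₂) (pbComp g h₁ h' s) = pbComp g h₂ h' (ev φ s) := by
  rw [pullHom_eq, ev_comp, ev_compIso_inv_pbComp, ev_comp, ev_map_pb, pbComp]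

lemma IsBasisOn.pbComp {n : ℕ} {e : Fin n → Γ((pullback f).obj M, U)} (he : IsBasisOn e)
    (h : g ≫ f = k) (hV : V ≤ g ⁻¹ᵁ U) : IsBasisOn (fun i => pbComp g h hV (e i)) :=
  (he.pb hV).map_iso (compIso g h M)

lemma pullHom_map_eq {f : X ⟶ Z} {g : Y ⟶ X} {k : Y ⟶ Z} {N : Z.Modules} (e : g ≫ f = k)
    (φ : M ⟶ N) : pullHom ((pullback f).map φ) g e e = (pullback k).map φ := by
  refine hom_ext_pb fun U s => ?_
  rw [ev_pullHom_pb (V := f ⁻¹ᵁ U) _ _ _ _ le_rfl (by subst e; exact le_rfl), ev_map_pb, pbComp_pb,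
    ev_map_pb]

lemma pullHom_self {X₁ X₂ W : Scheme.{u}} {M : X₁.Modules} {N : X₂.Modules}
    {f₁ : W ⟶ X₁} {f₂ : W ⟶ X₂} (φ : (pullback f₁).obj M ⟶ (pullback f₂).obj N)
    (h₁ : 𝟙 W ≫ f₁ = f₁) (h₂ : 𝟙 W ≫ f₂ = f₂) : pullHom φ (𝟙 W) h₁ h₂ = φ := by
  have key {X : Scheme.{u}} {M : X.Modules} {f : W ⟶ X} {U : W.Opens} (h : 𝟙 W ≫ f = f)
      (s : Γ((pullback f).obj M, U)) : Modules.pbComp (𝟙 W) h (le_refl U) s = s := by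
    have h1 : Modules.pbComp (𝟙 W) h (le_refl U) (Modules.pbComp (𝟙 W) h (le_refl U) s) =
        Modules.pbComp (𝟙 W) h (le_refl U) s :=
      pbComp_pbComp h h (Category.id_comp _) h _ _ _ s
    have h2 : Function.Bijective (fun s : Γ((pullback f).obj M, U) =>
        Modules.pbComp (𝟙 W) h (le_refl U) s) :=
      (bijective_ev (compIso (𝟙 W) h M)).comp
        (bijective_pb_of_isOpenImmersion (𝟙 W) (fun x _ => ⟨x, rfl⟩) rfl)
    exact h2.1 h1
  apply hom_ext_ev
  intro U s
  have := ev_pullHom_pbComp φ (𝟙 W) h₁ h₂ (le_refl U) s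
  rwa [key, key] at this

end

section
variable {X₁ X₂ X₃ W W' : Scheme.{u}} {M : X₁.Modules} {N : X₂.Modules}
    {f₁ : W ⟶ X₁} {f₂ : W ⟶ X₂}

/-- The pullback of an isomorphism `f₁^* M ≅ f₂^* N`. -/
@[simps] def pullIso (φ : (pullback f₁).obj M ≅ (pullback f₂).obj N)
    (g : W' ⟶ W) {g₁ : W' ⟶ X₁} {g₂ : W' ⟶ X₂} (h₁ : g ≫ f₁ = g₁) (h₂ : g ≫ f₂ = g₂) :
    (pullback g₁).obj M ≅ (pullback g₂).obj N where
  hom := pullHom φ.hom g h₁ h₂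
  inv := pullHom φ.inv g h₂ h₁
  hom_inv_id := by rw [← pullHom_comp, Iso.hom_inv_id, pullHom_id]
  inv_hom_id := by rw [← pullHom_comp, Iso.inv_hom_id, pullHom_id]

end

section fpqc
variable {T T' T'' : Scheme.{u}} {q : T' ⟶ T} [Flat q] [Surjective q] [QuasiCompact q]
  {p₁ p₂ : T'' ⟶ T'}

section
variable {X₁ X₂ : Scheme.{u}} {E : X₁.Modules} {F : X₂.Modules} {a : T ⟶ X₁} {b : T ⟶ X₂}
  {a' : T' ⟶ X₁} {b' : T' ⟶ X₂}

lemma pullHom_injective_of_fpqc (hF : IsVectorBundle F) (h₁ : q ≫ a = a') (h₂ : q ≫ b = b')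
    {φ ψ : (pullback a).obj E ⟶ (pullback b).obj F}
    (h : pullHom φ q h₁ h₂ = pullHom ψ q h₁ h₂) : φ = ψ := by
  apply map_injective_of_fpqc (q := q) (hF.pullback b)
  rwa [pullHom_eq, pullHom_eq, cancel_epi, cancel_mono] at h

lemma exists_pullHom_eq_of_fpqc (hF : IsVectorBundle F) (hp : IsPullback p₁ p₂ q q)
    (h₁ : q ≫ a = a') (h₂ : q ≫ b = b') (ψ : (pullback a').obj E ⟶ (pullback b').obj F)
    {a'' : T'' ⟶ X₁} {b'' : T'' ⟶ X₂} (k₁ : p₁ ≫ a' = a'') (k₂ : p₁ ≫ b' = b'')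
    (l₁ : p₂ ≫ a' = a'') (l₂ : p₂ ≫ b' = b'')
    (hψ : pullHom ψ p₁ k₁ k₂ = pullHom ψ p₂ l₁ l₂) :
    ∃ φ : (pullback a).obj E ⟶ (pullback b).obj F, pullHom φ q h₁ h₂ = ψ := by
  have d₁ : (p₁ ≫ q) ≫ a = a'' := by rw [Category.assoc, h₁, k₁]
  have d₂ : (p₁ ≫ q) ≫ b = b'' := by rw [Category.assoc, h₂, k₂]
  obtain ⟨φ, hφ⟩ := exists_map_eq_of_fpqc (hF.pullback b) hp rfl hp.w.symm (restrHom h₁ h₂ ψ)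
    (by rw [pullHom_restrHom (l₁ := d₁) (l₂ := d₂), pullHom_restrHom (l₁ := d₁) (l₂ := d₂), hψ])
  refine ⟨φ, ?_⟩
  rw [pullHom_eq, hφ, restrHom_eq]
  simp

lemma exists_pullIso_eq_of_fpqc (hE : IsVectorBundle E) (hF : IsVectorBundle F)
    (hp : IsPullback p₁ p₂ q q)
    (h₁ : q ≫ a = a') (h₂ : q ≫ b = b') (ψ : (pullback a').obj E ≅ (pullback b').obj F)
    {a'' : T'' ⟶ X₁} {b'' : T'' ⟶ X₂} (k₁ : p₁ ≫ a' = a'') (k₂ : p₁ ≫ b' = b'')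
    (l₁ : p₂ ≫ a' = a'') (l₂ : p₂ ≫ b' = b'')
    (hψ : pullHom ψ.hom p₁ k₁ k₂ = pullHom ψ.hom p₂ l₁ l₂) :
    ∃ φ : (pullback a).obj E ≅ (pullback b).obj F, pullIso φ q h₁ h₂ = ψ := by
  obtain ⟨φ, hφ⟩ := exists_pullHom_eq_of_fpqc hF hp h₁ h₂ ψ.hom k₁ k₂ l₁ l₂ hψ
  obtain ⟨χ, hχ⟩ := exists_pullHom_eq_of_fpqc hE hp h₂ h₁ ψ.inv k₂ k₁ l₂ l₁
    (congrArg Iso.inv (Iso.ext hψ : pullIso ψ p₁ k₁ k₂ = pullIso ψ p₂ l₁ l₂))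
  refine ⟨⟨φ, χ, ?_, ?_⟩, Iso.ext hφ⟩
  · apply pullHom_injective_of_fpqc hE h₁ h₁
    rw [pullHom_comp (k₂ := h₂), hφ, hχ, pullHom_id, Iso.hom_inv_id]
  · apply pullHom_injective_of_fpqc hF h₂ h₂
    rw [pullHom_comp (k₂ := h₁), hφ, hχ, pullHom_id, Iso.inv_hom_id]

end

section
variable {Z : Scheme.{u}} {F : Z.Modules} {f : T ⟶ Z} {f' : T' ⟶ Z} {f'' : T'' ⟶ Z}

lemma pbComp_injective_of_fpqc (hF : IsVectorBundle F) (e : q ≫ f = f') {U : T.Opens}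
    {V : T'.Opens} (hV : V = q ⁻¹ᵁ U) :
    Function.Injective (fun s : Γ((pullback f).obj F, U) => pbComp q e hV.le s) := by
  subst hV
  exact (bijective_ev (compIso q e F)).1.comp (pb_injective_of_fpqc (hF.pullback f) U)

lemma exists_pbComp_eq_of_fpqc (hF : IsVectorBundle F) (hp : IsPullback p₁ p₂ q q)
    (e : q ≫ f = f') (e₁ : p₁ ≫ f' = f'') (e₂ : p₂ ≫ f' = f'') (U : T.Opens)
    (s : Γ((pullback f').obj F, q ⁻¹ᵁ U)) {V : T''.Opens} (h₁ : V = p₁ ⁻¹ᵁ q ⁻¹ᵁ U)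
    (h₂ : V ≤ p₂ ⁻¹ᵁ q ⁻¹ᵁ U) (hs : pbComp p₁ e₁ h₁.le s = pbComp p₂ e₂ h₂ s) :
    ∃ t : Γ((pullback f).obj F, U), pbComp q e le_rfl t = s := by
  have e₃ : (p₁ ≫ q) ≫ f = f'' := by rw [Category.assoc, e, e₁]
  have hV : V ≤ (p₁ ≫ q) ⁻¹ᵁ U := h₁.le
  have key {p : T'' ⟶ T'} (h : p ≫ f' = f'') (h' : p ≫ q = p₁ ≫ q) (hp : V ≤ p ⁻¹ᵁ q ⁻¹ᵁ U) :
      pbComp p h hp s =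
        ev (compIso (p₁ ≫ q) e₃ F).hom (pbComp p h' hp (ev (compIso q e F).inv s)) := by
    conv_rhs => rw [pbComp]
    rw [← ev_comp, ← compIso_assoc e h h' e₃, ev_comp, ev_map_pb, ev_inv_hom, pbComp]
  obtain ⟨t, ht⟩ := exists_pb_eq_of_fpqc (hF.pullback f) hp rfl hp.w.symm U
    (ev (compIso q e F).inv s) h₁ h₂ (by
    apply (bijective_ev (compIso (p₁ ≫ q) e₃ F)).1
    dsimp only
    rw [← key e₁, ← key e₂, hs])
  exact ⟨t, by rw [pbComp, ht, ev_inv_hom]⟩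

end

/-- Whether sections form a basis can be checked after a faithfully flat base change. -/
lemma IsBasisOn.of_pb_of_fpqc {F : T.Modules} (hF : IsVectorBundle F) {U : T.Opens} {n : ℕ}
    {e : Fin n → Γ(F, U)} (he : IsBasisOn (fun i => Modules.pb q (V := q ⁻¹ᵁ U) le_rfl (e i))) :
    IsBasisOn e := by
  intro V hV
  have hq : q ⁻¹ᵁ V ≤ q ⁻¹ᵁ U := q.preimage_mono hV
  have key (f : Fin n → Γ(T, V)) : Modules.pb q (V := q ⁻¹ᵁ V) le_rfl (∑ i, f i • res hV (e i)) =
      ∑ i, q.app V (f i) • res hq (Modules.pb q (V := q ⁻¹ᵁ U) le_rfl (e i)) := by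
    simp only [pb_sum, pb_smul, pb_res, res_pb, Scheme.Hom.app_eq_appLE]
  constructor
  · intro f f' h
    have h' := congrArg (Modules.pb q (V := q ⁻¹ᵁ V) le_rfl) h
    dsimp only at h'
    rw [key, key] at h'
    have h2 := (he _ hq).1 h'
    exact funext fun i => app_injective_of_fpqc q V (congrFun h2 i)
  · intro s
    obtain ⟨f, hf⟩ := (he _ hq).2 (Modules.pb q le_rfl s)
    dsimp only at hf
    let p₁ := Limits.pullback.fst q q
    let p₂ := Limits.pullback.snd q q
    have hp : IsPullback p₁ p₂ q q := IsPullback.of_hasPullback q q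
    have h₂ : p₁ ⁻¹ᵁ q ⁻¹ᵁ V ≤ p₂ ⁻¹ᵁ q ⁻¹ᵁ V := by
      change (p₁ ≫ q) ⁻¹ᵁ V ≤ (p₂ ≫ q) ⁻¹ᵁ V
      rw [hp.w]
    have h1 := congrArg (Modules.pbComp p₁ (k := p₁ ≫ q) rfl (le_refl (p₁ ⁻¹ᵁ q ⁻¹ᵁ V))) hf
    have h2 := congrArg (Modules.pbComp p₂ hp.w.symm h₂) hf
    rw [pbComp_pb] at h1 h2
    rw [← h2] at h1
    simp only [pbComp_sum, pbComp_smul, res_pb, pbComp_pb] at h1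
    have hb := he.pbComp (g := p₁) (k := p₁ ≫ q) rfl (V := p₁ ⁻¹ᵁ q ⁻¹ᵁ U) le_rfl
    have h3 (i) : p₁.appLE _ (p₁ ⁻¹ᵁ q ⁻¹ᵁ V) le_rfl (f i) = p₂.appLE _ _ h₂ (f i) := by
      refine congrFun (f := fun i => p₁.appLE _ (p₁ ⁻¹ᵁ q ⁻¹ᵁ V) le_rfl (f i))
        (g := fun i => p₂.appLE _ _ h₂ (f i)) ((hb _ (p₁.preimage_mono hq)).1 ?_) i
      have h4 (i) : res (p₁.preimage_mono hq) (Modules.pbComp p₁ (k := p₁ ≫ q) rfl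
          (le_refl (p₁ ⁻¹ᵁ q ⁻¹ᵁ U)) (Modules.pb q (V := q ⁻¹ᵁ U) le_rfl (e i))) =
            Modules.pb (p₁ ≫ q) (p₁.preimage_mono hq) (e i) := by
        rw [res_pbComp, pbComp_pb]
      dsimp only
      simp only [h4]
      exact h1
    choose a ha using fun i => exists_app_eq_of_fpqc q hp V (f i) rfl h₂ (h3 i)
    refine ⟨a, pb_injective_of_fpqc (q := q) hF V ?_⟩
    dsimp only
    rw [key, ← hf]
    simp only [ha]

end fpqc

end AlgebraicGeometry.Scheme.Modules
end

noncomputable section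

namespace AlgebraicGeometry.Scheme.Modules

section
variable {X Y : Scheme.{u}} {M N : X.Modules}

/-- The equalizer of two morphisms of modules, in terms of sections. -/
lemma exists_equalizer_ev (a b : M ⟶ N) : ∃ (E : X.Modules) (j : E ⟶ M),
    (∀ (U : X.Opens) (s : Γ(E, U)), ev a (ev j s) = ev b (ev j s)) ∧
    (∀ U : X.Opens, Function.Injective (fun s : Γ(E, U) => ev j s)) ∧
    ∀ (U : X.Opens) (s : Γ(M, U)), ev a s = ev b s → ∃ t, ev j t = s := by
  refine ⟨Limits.equalizer a b, Limits.equalizer.ι a b, fun U s => ?_, ?_⟩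
  · rw [← ev_comp, Limits.equalizer.condition, ev_comp]
  have key (U : X.Opens) (s : Γ(M, U)) (hs : ev a s = ev b s) :
      ∃! t, ev (Limits.equalizer.ι a b) t = s := by
    let F : X.Modules ⥤ Type u :=
      toPresheaf X ⋙ (CategoryTheory.evaluation _ _).obj (.op U) ⋙ CategoryTheory.forget Ab
    have : Limits.PreservesLimits (toPresheaf X) := inferInstance
    have : Limits.PreservesLimits (CategoryTheory.forget Ab.{u}) := inferInstance
    have : Limits.PreservesLimitsOfShape Limits.WalkingParallelPair
      ((CategoryTheory.evaluation X.Opensᵒᵖ Ab.{u}).obj (.op U)) := inferInstance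
    have : Limits.PreservesLimitsOfShape Limits.WalkingParallelPair F :=
      Limits.comp_preservesLimitsOfShape _ _
    have h := Limits.isLimitForkMapOfIsLimit F _ (Limits.equalizerIsEqualizer a b)
    exact (Limits.Types.type_equalizer_iff_unique _ _).1 ⟨h⟩ s hs
  refine ⟨fun U s t h => ?_, fun U s hs => (key U s hs).exists⟩
  refine (key U (ev (Limits.equalizer.ι a b) s) ?_).unique rfl h.symm
  rw [← ev_comp, Limits.equalizer.condition, ev_comp]

/-- A morphism of modules which is bijective on sections over all sufficiently small opens is an
isomorphism. -/
lemma isIso_of_locally_bijective {φ : M ⟶ N}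
    (h : ∀ x : X, ∃ U : X.Opens, x ∈ U ∧ ∀ V : X.Opens, V ≤ U →
      Function.Bijective (fun s : Γ(M, V) => ev φ s)) : IsIso φ := by
  choose U hU hb using h
  have cov (W : X.Opens) : W ≤ ⨆ x : X, W ⊓ U x := fun x hx =>
    TopologicalSpace.Opens.mem_iSup.2 ⟨x, hx, hU x⟩
  have inj (W : X.Opens) : Function.Injective (fun s : Γ(M, W) => ev φ s) := by
    intro s t h
    refine eq_of_res_eq (fun x => W ⊓ U x) (fun _ => inf_le_left) (cov W) fun x => ?_
    apply (hb x _ inf_le_right).1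
    dsimp only at h ⊢
    rw [ev_res, ev_res, h]
  refine isIso_of_bijective_ev fun W => ⟨inj W, fun s => ?_⟩
  choose t ht using fun x => (hb x _ inf_le_right).2 (res (inf_le_left : W ⊓ U x ≤ W) s)
  dsimp only at ht
  obtain ⟨t', ht'⟩ := exists_res_eq (fun x => W ⊓ U x) (fun _ => inf_le_left) (cov W) t (by
    intro x y
    apply inj
    dsimp only
    rw [ev_res, ev_res, ht, ht, res_res, res_res])
  refine ⟨t', eq_of_res_eq (fun x => W ⊓ U x) (fun _ => inf_le_left) (cov W) fun x => ?_⟩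
  dsimp only
  rw [← ev_res, ht', ht]

/-- A morphism of modules which locally maps a basis to a basis is an isomorphism. -/
lemma isIso_of_isBasisOn {φ : M ⟶ N}
    (h : ∀ x : X, ∃ (U : X.Opens) (_ : x ∈ U) (n : ℕ) (e : Fin n → Γ(M, U)), IsBasisOn e ∧
      IsBasisOn (fun i => ev φ (e i))) : IsIso φ := by
  refine isIso_of_locally_bijective fun x => ?_
  obtain ⟨U, hx, n, e, he, he'⟩ := h x
  refine ⟨U, hx, fun V hV => ?_⟩
  rw [← Function.Bijective.of_comp_iff _ (he V hV)]
  convert he' V hV using 1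
  funext f
  simp [ev_smul, ev_res]

/-- A section of a direct image as a section over the preimage. -/
def ofPush (g : Y ⟶ X) {K : Y.Modules} {U : X.Opens} (s : Γ((pushforward g).obj K, U)) :
    Γ(K, g ⁻¹ᵁ U) := s

/-- A section over the preimage as a section of the direct image. -/
def toPush (g : Y ⟶ X) {K : Y.Modules} {U : X.Opens} (s : Γ(K, g ⁻¹ᵁ U)) :
    Γ((pushforward g).obj K, U) := s

section
variable (g : Y ⟶ X) {K : Y.Modules} {U V : X.Opens}

@[simp] lemma ofPush_toPush (s : Γ(K, g ⁻¹ᵁ U)) : ofPush g (toPush g s) = s := rfl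

lemma ofPush_injective : Function.Injective (ofPush g (K := K) (U := U)) := fun _ _ h => h

@[simp] lemma ofPush_add (s t : Γ((pushforward g).obj K, U)) :
    ofPush g (s + t) = ofPush g s + ofPush g t := rfl

@[simp] lemma ofPush_smul (r : Γ(X, U)) (s : Γ((pushforward g).obj K, U)) :
    ofPush g (r • s) = g.app U r • ofPush g s := rfl

@[simp] lemma ofPush_sum {J : Type*} (A : Finset J) (s : J → Γ((pushforward g).obj K, U)) :
    ofPush g (∑ i ∈ A, s i) = ∑ i ∈ A, ofPush g (s i) :=
  map_sum (⟨⟨ofPush g, rfl⟩, fun _ _ => rfl⟩ : Γ((pushforward g).obj K, U) →+ Γ(K, g ⁻¹ᵁ U)) _ _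

lemma ofPush_res (h : V ≤ U) (s : Γ((pushforward g).obj K, U)) :
    ofPush g (res h s) = res (g.preimage_mono h) (ofPush g s) := rfl

/-- A family of additive maps from sections to sections over preimages which is compatible with
restriction and scalars defines a morphism to the direct image. -/
lemma exists_hom_ofPush {M : X.Modules} (f : ∀ U : X.Opens, Γ(M, U) → Γ(K, g ⁻¹ᵁ U))
    (hadd : ∀ U s t, f U (s + t) = f U s + f U t)
    (hsmul : ∀ U (r : Γ(X, U)) s, f U (r • s) = g.app U r • f U s)
    (hres : ∀ (U V : X.Opens) (h : V ≤ U) s, f V (res h s) = res (g.preimage_mono h) (f U s)) :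
    ∃ φ : M ⟶ (pushforward g).obj K, ∀ (U : X.Opens) (s : Γ(M, U)), ofPush g (ev φ s) = f U s :=
  exists_hom_ev (N := (pushforward g).obj K) f hadd hsmul hres

lemma exists_ev_pb_ofPush {M : X.Modules} (β : M ⟶ (pushforward g).obj K) :
    ∃ α : (pullback g).obj M ⟶ K, ∀ (U : X.Opens) (V : Y.Opens) (h : V ≤ g ⁻¹ᵁ U) (s : Γ(M, U)),
      ev α (pb g h s) = res h (ofPush g (ev β s)) :=
  exists_ev_pb g β

end

end

/-- A descent datum for the pullback along `p : P ⟶ Z` of a module on `Z`, relative to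
`q : P ⟶ W`: a transitive family of isomorphisms between the pullbacks to `T` along any two points
`T ⟶ P` with the same image in `W`, compatible with base change in `T`. -/
structure DescentDatum {P W Z : Scheme.{u}} (q : P ⟶ W) (p : P ⟶ Z) (V : Z.Modules) where
  map {T : Scheme.{u}} (x₁ x₂ : T ⟶ P) (h : x₁ ≫ q = x₂ ≫ q) :
    (pullback (x₁ ≫ p)).obj V ⟶ (pullback (x₂ ≫ p)).obj V
  pullHom_map {T T' : Scheme.{u}} (g : T' ⟶ T) (x₁ x₂ : T ⟶ P) (h : x₁ ≫ q = x₂ ≫ q)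
    (h' : (g ≫ x₁) ≫ q = (g ≫ x₂) ≫ q) :
    pullHom (map x₁ x₂ h) g (Category.assoc _ _ _).symm (Category.assoc _ _ _).symm =
      map (g ≫ x₁) (g ≫ x₂) h'
  map_self {T : Scheme.{u}} (x : T ⟶ P) : map x x rfl = 𝟙 _
  map_comp {T : Scheme.{u}} (x₁ x₂ x₃ : T ⟶ P) (h : x₁ ≫ q = x₂ ≫ q) (h' : x₂ ≫ q = x₃ ≫ q) :
    map x₁ x₂ h ≫ map x₂ x₃ h' = map x₁ x₃ (h.trans h')

namespace DescentDatum
variable {P W Z : Scheme.{u}} {q : P ⟶ W} {p : P ⟶ Z} {V : Z.Modules} (D : DescentDatum q p V)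

/-- A section is invariant if its pullbacks along any two points with the same image in the base
are matched by the descent datum. -/
def IsInvariant {O : P.Opens} (s : Γ((pullback p).obj V, O)) : Prop :=
  ∀ ⦃T : Scheme.{u}⦄ (x₁ x₂ : T ⟶ P) (h : x₁ ≫ q = x₂ ≫ q) (A : T.Opens)
    (k₁ : A ≤ x₁ ⁻¹ᵁ O) (k₂ : A ≤ x₂ ⁻¹ᵁ O),
    ev (D.map x₁ x₂ h) (pbComp x₁ rfl k₁ s) = pbComp x₂ rfl k₂ s

variable {D}

lemma ev_map_comp_pbComp {O O' : P.Opens} {s : Γ((pullback p).obj V, O)}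
    {s' : Γ((pullback p).obj V, O')} {T T' : Scheme.{u}}
    (g : T' ⟶ T) {x₁ x₂ : T ⟶ P} (h : x₁ ≫ q = x₂ ≫ q) {A : T.Opens} {k₁ : A ≤ x₁ ⁻¹ᵁ O}
    {k₂ : A ≤ x₂ ⁻¹ᵁ O'} (e : ev (D.map x₁ x₂ h) (pbComp x₁ rfl k₁ s) = pbComp x₂ rfl k₂ s')
    {y₁ y₂ : T' ⟶ P} (e₁ : g ≫ x₁ = y₁) (e₂ : g ≫ x₂ = y₂) (h' : y₁ ≫ q = y₂ ≫ q)
    {B : T'.Opens} (l : B ≤ g ⁻¹ᵁ A) (l₁ : B ≤ y₁ ⁻¹ᵁ O) (l₂ : B ≤ y₂ ⁻¹ᵁ O') :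
    ev (D.map y₁ y₂ h') (pbComp y₁ rfl l₁ s) = pbComp y₂ rfl l₂ s' := by
  subst e₁ e₂
  rw [← D.pullHom_map g x₁ x₂ h h',
    ← pbComp_pbComp rfl (Category.assoc g x₁ p).symm rfl rfl k₁ l l₁, ev_pullHom_pbComp, e,
    pbComp_pbComp rfl (Category.assoc g x₂ p).symm rfl rfl k₂ l l₂]

lemma IsInvariant.of_isPullback {R : Scheme.{u}} {p₁ p₂ : R ⟶ P} (hp : IsPullback p₁ p₂ q q)
    {U : W.Opens} {s : Γ((pullback p).obj V, q ⁻¹ᵁ U)} {A : R.Opens}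
    (hA : A = p₁ ⁻¹ᵁ q ⁻¹ᵁ U) (k₂ : A ≤ p₂ ⁻¹ᵁ q ⁻¹ᵁ U)
    (h : ev (D.map p₁ p₂ hp.w) (pbComp p₁ rfl hA.le s) = pbComp p₂ rfl k₂ s) :
    D.IsInvariant s := by
  intro T x₁ x₂ hx B l₁ l₂
  refine ev_map_comp_pbComp (hp.lift _ _ hx) hp.w h (hp.lift_fst _ _ _) (hp.lift_snd _ _ _) hx
    ?_ l₁ l₂
  rw [hA, ← Scheme.Hom.comp_preimage, hp.lift_fst]
  exact l₁

lemma pbComp_ι_injective {T : Scheme.{u}} {f : T ⟶ Z} {A : T.Opens} {k : (A : Scheme.{u}) ⟶ Z}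
    (e : A.ι ≫ f = k) (h : (⊤ : (A : Scheme.{u}).Opens) ≤ A.ι ⁻¹ᵁ A) :
    Function.Injective (fun s : Γ((pullback f).obj V, A) => pbComp A.ι e h s) := by
  have h1 : (⊤ : (A : Scheme.{u}).Opens) = A.ι ⁻¹ᵁ A := by simp
  exact (bijective_ev (compIso A.ι e V)).1.comp
    (bijective_pb_of_isOpenImmersion A.ι (U := A) (by simp) h1).1

lemma IsInvariant.of_top {O : P.Opens} {s : Γ((pullback p).obj V, O)}
    (H : ∀ {T : Scheme.{u}} (x₁ x₂ : T ⟶ P) (h : x₁ ≫ q = x₂ ≫ q)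
      (k₁ : ⊤ ≤ x₁ ⁻¹ᵁ O) (k₂ : ⊤ ≤ x₂ ⁻¹ᵁ O),
      ev (D.map x₁ x₂ h) (pbComp x₁ rfl k₁ s) = pbComp x₂ rfl k₂ s) : D.IsInvariant s := by
  intro T x₁ x₂ h A k₁ k₂
  have h1 : (⊤ : (A : Scheme.{u}).Opens) ≤ A.ι ⁻¹ᵁ A := by simp
  have l₁ : ⊤ ≤ (A.ι ≫ x₁) ⁻¹ᵁ O := h1.trans (A.ι.preimage_mono k₁)
  have l₂ : ⊤ ≤ (A.ι ≫ x₂) ⁻¹ᵁ O := h1.trans (A.ι.preimage_mono k₂)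
  have h' : (A.ι ≫ x₁) ≫ q = (A.ι ≫ x₂) ≫ q := by rw [Category.assoc, h, Category.assoc]
  have := H (A.ι ≫ x₁) (A.ι ≫ x₂) h' l₁ l₂
  rw [← D.pullHom_map A.ι x₁ x₂ h h',
    ← pbComp_pbComp rfl (Category.assoc A.ι x₁ p).symm rfl rfl k₁ h1 l₁, ev_pullHom_pbComp,
    ← pbComp_pbComp rfl (Category.assoc A.ι x₂ p).symm rfl rfl k₂ h1 l₂] at this
  exact pbComp_ι_injective (Category.assoc A.ι x₂ p).symm h1 this

/-- The coefficients of an invariant section in a basis of invariant sections come from the base. -/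
lemma IsInvariant.exists_app_eq [Flat q] [Surjective q] [QuasiCompact q] {U U' : W.Opens}
    (hU : U' ≤ U) {n : ℕ} {e : Fin n → Γ((pullback p).obj V, q ⁻¹ᵁ U)} (he : IsBasisOn e)
    (hi : ∀ i, D.IsInvariant (e i)) {f : Fin n → Γ(P, q ⁻¹ᵁ U')}
    (hs : D.IsInvariant (∑ i, f i • res (q.preimage_mono hU) (e i))) :
    ∃ a : Fin n → Γ(W, U'), ∀ i, q.app U' (a i) = f i := by
  let p₁ := Limits.pullback.fst q q
  let p₂ := Limits.pullback.snd q q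
  have hp : IsPullback p₁ p₂ q q := IsPullback.of_hasPullback q q
  have hA (U : W.Opens) : p₁ ⁻¹ᵁ q ⁻¹ᵁ U ≤ p₂ ⁻¹ᵁ q ⁻¹ᵁ U := by
    change (p₁ ≫ q) ⁻¹ᵁ U ≤ (p₂ ≫ q) ⁻¹ᵁ U
    rw [hp.w]
  have h1 := hs p₁ p₂ hp.w (p₁ ⁻¹ᵁ q ⁻¹ᵁ U') le_rfl (hA U')
  have h2 (i) := hi i p₁ p₂ hp.w (p₁ ⁻¹ᵁ q ⁻¹ᵁ U') (p₁.preimage_mono (q.preimage_mono hU))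
    ((hA U').trans (p₂.preimage_mono (q.preimage_mono hU)))
  simp only [pbComp_sum, pbComp_smul, pbComp_res, ev_sum, ev_smul, h2] at h1
  have hb := he.pbComp (g := p₂) (k := p₂ ≫ p) rfl (hA U)
  have h3 (i) : p₁.appLE _ (p₁ ⁻¹ᵁ q ⁻¹ᵁ U') le_rfl (f i) = p₂.appLE _ _ (hA U') (f i) := by
    refine congrFun (f := fun i => p₁.appLE _ (p₁ ⁻¹ᵁ q ⁻¹ᵁ U') le_rfl (f i))
      (g := fun i => p₂.appLE _ _ (hA U') (f i))
      ((hb _ (p₁.preimage_mono (q.preimage_mono hU))).1 ?_) i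
    dsimp only
    simp only [res_pbComp]
    exact h1
  choose a ha using fun i => exists_app_eq_of_fpqc q hp U' (f i) rfl (hA U') (h3 i)
  exact ⟨a, ha⟩

variable (D) in
/-- The module of invariant sections. -/
lemma exists_invariants : ∃ (E : W.Modules) (j : E ⟶ (pushforward q).obj ((pullback p).obj V)),
    (∀ (U : W.Opens) (s : Γ(E, U)), D.IsInvariant (ofPush q (ev j s))) ∧
    (∀ U : W.Opens, Function.Injective (fun s : Γ(E, U) => ofPush q (ev j s))) ∧
    ∀ (U : W.Opens) (s : Γ((pullback p).obj V, q ⁻¹ᵁ U)), D.IsInvariant s →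
      ∃ t : Γ(E, U), ofPush q (ev j t) = s := by
  let p₁ := Limits.pullback.fst q q
  let p₂ := Limits.pullback.snd q q
  have hp : IsPullback p₁ p₂ q q := IsPullback.of_hasPullback q q
  generalize hr : p₁ ≫ q = r
  have hA (U : W.Opens) : r ⁻¹ᵁ U ≤ p₁ ⁻¹ᵁ q ⁻¹ᵁ U := by subst hr; exact le_rfl
  have hA' (U : W.Opens) : r ⁻¹ᵁ U ≤ p₂ ⁻¹ᵁ q ⁻¹ᵁ U := by subst hr; rw [hp.w]; exact le_rfl
  have happ {g : Limits.pullback q q ⟶ P} (hg : g ≫ q = r) (U : W.Opens)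
      (h : r ⁻¹ᵁ U ≤ g ⁻¹ᵁ q ⁻¹ᵁ U) (t : Γ(W, U)) :
      g.appLE (q ⁻¹ᵁ U) (r ⁻¹ᵁ U) h (q.app U t) = r.app U t := by
    subst hg
    have : q.app U ≫ g.appLE (q ⁻¹ᵁ U) ((g ≫ q) ⁻¹ᵁ U) h = (g ≫ q).app U := by
      rw [Scheme.Hom.app_eq_appLE, Scheme.Hom.appLE_comp_appLE, Scheme.Hom.app_eq_appLE]
    exact congrArg (fun φ => φ.hom t) this
  obtain ⟨a, ha⟩ := exists_hom_ofPush r (M := (pushforward q).obj ((pullback p).obj V))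
    (K := (pullback (p₂ ≫ p)).obj V)
    (fun U s => ev (D.map p₁ p₂ hp.w) (pbComp p₁ rfl (hA U) (ofPush q s)))
    (fun U s t => by rw [ofPush_add, pbComp_add, ev_add])
    (fun U t s => by rw [ofPush_smul, pbComp_smul, ev_smul, happ hr])
    (fun U U' h s => by
      rw [ofPush_res, pbComp_res, ← ev_res, res_pbComp])
  obtain ⟨b, hb⟩ := exists_hom_ofPush r (M := (pushforward q).obj ((pullback p).obj V))
    (K := (pullback (p₂ ≫ p)).obj V)
    (fun U s => pbComp p₂ rfl (hA' U) (ofPush q s))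
    (fun U s t => by rw [ofPush_add, pbComp_add])
    (fun U t s => by rw [ofPush_smul, pbComp_smul, happ (hp.w.symm.trans hr)])
    (fun U U' h s => by
      rw [ofPush_res, pbComp_res, res_pbComp])
  obtain ⟨E, j, h1, h2, h3⟩ := exists_equalizer_ev a b
  refine ⟨E, j, fun U s => ?_, fun U => (ofPush_injective q).comp (h2 U), fun U s hs => ?_⟩
  · have := congrArg (ofPush r) (h1 U s)
    rw [ha, hb] at this
    exact IsInvariant.of_isPullback hp (by subst hr; rfl) (hA' U) this
  · obtain ⟨t, ht⟩ := h3 U (toPush q s) (by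
      apply ofPush_injective r
      rw [ha, hb, ofPush_toPush]
      exact hs p₁ p₂ hp.w _ (hA U) (hA' U))
    exact ⟨t, by rw [ht, ofPush_toPush]⟩

/-- A descent datum with local bases of invariant sections is effective. -/
theorem exists_isVectorBundle [Flat q] [Surjective q] [QuasiCompact q] (D : DescentDatum q p V)
    (hloc : ∀ w : W, ∃ (U : W.Opens) (_ : w ∈ U) (n : ℕ)
      (e : Fin n → Γ((pullback p).obj V, q ⁻¹ᵁ U)), IsBasisOn e ∧ ∀ i, D.IsInvariant (e i)) :
    ∃ (E : W.Modules) (_ : IsVectorBundle E) (ε : (pullback q).obj E ≅ (pullback p).obj V),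
      ∀ {T : Scheme.{u}} (x₁ x₂ : T ⟶ P) (h : x₁ ≫ q = x₂ ≫ q) {w : T ⟶ W} (e₁ : x₁ ≫ q = w)
        (e₂ : x₂ ≫ q = w),
        pullHom ε.hom x₁ e₁ rfl ≫ D.map x₁ x₂ h = pullHom ε.hom x₂ e₂ rfl := by
  obtain ⟨E, j, h1, h2, h3⟩ := D.exists_invariants
  obtain ⟨ε, hε⟩ := exists_ev_pb_ofPush q j
  have hbasis {U : W.Opens} {n : ℕ} {e : Fin n → Γ((pullback p).obj V, q ⁻¹ᵁ U)}
      (he : IsBasisOn e) {e' : Fin n → Γ(E, U)} (he' : ∀ i, ofPush q (ev j (e' i)) = e i) :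
      IsBasisOn e' := by
    intro U' hU
    have hq : q ⁻¹ᵁ U' ≤ q ⁻¹ᵁ U := q.preimage_mono hU
    have key (f : Fin n → Γ(W, U')) : ofPush q (ev j (∑ i, f i • res hU (e' i))) =
        ∑ i, q.app U' (f i) • res hq (e i) := by
      simp only [ev_sum, ofPush_sum, ev_smul, ofPush_smul, ev_res, ofPush_res, he']
    constructor
    · intro f f' h
      have h' := congrArg (fun s => ofPush q (ev j s)) h
      dsimp only at h'
      rw [key, key] at h'
      have h2 := (he _ hq).1 h'
      exact funext fun i => app_injective_of_fpqc q U' (congrFun h2 i)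
    · intro s
      obtain ⟨f, hf⟩ := (he _ hq).2 (ofPush q (ev j s))
      dsimp only at hf
      have hs := h1 U' s
      rw [← hf] at hs
      obtain ⟨a, ha⟩ := hs.exists_app_eq hU he fun i => he' i ▸ h1 U (e' i)
      refine ⟨a, h2 U' ?_⟩
      dsimp only
      rw [key, ← hf]
      simp only [ha]
  have hbas (w : W) : ∃ (U : W.Opens) (_ : w ∈ U) (n : ℕ) (e : Fin n → Γ(E, U)), IsBasisOn e ∧
      IsBasisOn (fun i => ofPush q (ev j (e i))) := by
    obtain ⟨U, hw, n, e, he, hi⟩ := hloc w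
    choose e' he' using fun i => h3 U (e i) (hi i)
    refine ⟨U, hw, n, e', hbasis he he', ?_⟩
    rw [funext he']
    exact he
  have hE : IsVectorBundle E := isVectorBundle_of_isBasisOn fun w => by
    obtain ⟨U, hw, n, e, he, -⟩ := hbas w
    exact ⟨U, hw, n, e, he⟩
  have : IsIso ε := isIso_of_isBasisOn fun x => by
    obtain ⟨U, hw, n, e, he, he'⟩ := hbas (q x)
    refine ⟨q ⁻¹ᵁ U, hw, n, _, he.pb le_rfl, ?_⟩
    simpa only [hε, res_self] using he'
  refine ⟨E, hE, asIso ε, fun {T} x₁ x₂ h w e₁ e₂ => ?_⟩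
  refine hom_ext_pb fun U s => ?_
  have k₁ : w ⁻¹ᵁ U ≤ x₁ ⁻¹ᵁ q ⁻¹ᵁ U := by subst e₁; exact le_rfl
  have k₂ : w ⁻¹ᵁ U ≤ x₂ ⁻¹ᵁ q ⁻¹ᵁ U := by subst e₂; exact le_rfl
  rw [asIso_hom, ev_comp, ev_pullHom_pb (V := q ⁻¹ᵁ U) _ _ _ _ le_rfl k₁,
    ev_pullHom_pb (V := q ⁻¹ᵁ U) _ _ _ _ le_rfl k₂, hε, res_self]
  exact (h1 U s) x₁ x₂ h _ _ _

end DescentDatum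

end AlgebraicGeometry.Scheme.Modules
end

noncomputable section

namespace Module.Flat
open TensorProduct

section
variable {A B : Type*} [CommRing A] [CommRing B] [Algebra A B] {n : Type*} [Fintype n]
  [DecidableEq n]

/-- The vectors `b` such that `Θ (b ⊗ 1) = 1 ⊗ b`. -/
def invariantVectors (Θ : Matrix n n (B ⊗[A] B)) : Set (n → B) :=
  {b | ∀ i, ∑ k, Θ i k * (b k ⊗ₜ 1) = 1 ⊗ₜ b i}

/-- Faithfully flat descent for free modules: the vectors invariant under a matrix which satisfies
the cocycle condition form a generating set. -/
theorem span_invariantVectors [Module.Flat A B] (Θ : Matrix n n (B ⊗[A] B))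
    (h : ∀ i j, Algebra.TensorProduct.map (AlgHom.id A B)
        (Algebra.TensorProduct.includeRight : B →ₐ[A] B ⊗[A] B) (Θ i j) =
      ∑ k, (Algebra.TensorProduct.includeRight : B ⊗[A] B →ₐ[A] B ⊗[A] (B ⊗[A] B)) (Θ i k) *
        Algebra.TensorProduct.map (AlgHom.id A B)
          (Algebra.TensorProduct.includeLeft : B →ₐ[A] B ⊗[A] B) (Θ k j))
    (h1 : ∀ i j, Algebra.TensorProduct.lmul' A (Θ i j) = (1 : Matrix n n B) i j) :
    Submodule.span B (invariantVectors Θ) = ⊤ := by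
  let δ : (n → B) →ₗ[A] (n → B ⊗[A] B) :=
    LinearMap.pi fun i => (∑ k, LinearMap.mulLeft A (Θ i k) ∘ₗ
      (Algebra.TensorProduct.includeLeft : B →ₐ[A] B ⊗[A] B).toLinearMap ∘ₗ LinearMap.proj k) -
        (Algebra.TensorProduct.includeRight : B →ₐ[A] B ⊗[A] B).toLinearMap ∘ₗ LinearMap.proj i
  have hδ (b : n → B) (i : n) : δ b i = ∑ k, Θ i k * (b k ⊗ₜ 1) - 1 ⊗ₜ b i := by
    simp [δ]
  have hM (b : n → B) (hb : b ∈ LinearMap.ker δ) : b ∈ invariantVectors Θ := fun i => by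
    have := congrFun (LinearMap.mem_ker.1 hb) i
    rw [hδ] at this
    exact sub_eq_zero.1 this
  have hex : Function.Exact (LinearMap.lTensor B (LinearMap.ker δ).subtype)
      (LinearMap.lTensor B δ) :=
    Module.Flat.lTensor_exact B (LinearMap.exact_subtype_ker_map δ)
  let π := TensorProduct.piRight A A B (fun _ : n => B)
  have hcomp (x : B ⊗[A] (n → B)) (i : n) :
      TensorProduct.piRight A A B (fun _ : n => B ⊗[A] B) (LinearMap.lTensor B δ x) i =
      ∑ k, (Algebra.TensorProduct.includeRight : B ⊗[A] B →ₐ[A] B ⊗[A] (B ⊗[A] B)) (Θ i k) *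
        Algebra.TensorProduct.map (AlgHom.id A B)
          (Algebra.TensorProduct.includeLeft : B →ₐ[A] B ⊗[A] B) (π x k) -
      Algebra.TensorProduct.map (AlgHom.id A B)
        (Algebra.TensorProduct.includeRight : B →ₐ[A] B ⊗[A] B) (π x i) := by
    induction x with
    | zero => simp
    | add x y hx hy =>
      simp only [map_add, Pi.add_apply, hx, hy, mul_add, Finset.sum_add_distrib]
      ring
    | tmul b β =>
      simp [π, hδ, TensorProduct.tmul_sub, TensorProduct.tmul_sum]
  let σ : B ⊗[A] (n → B) →ₗ[A] (n → B) := TensorProduct.lift (LinearMap.lsmul B (n → B)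
    |>.restrictScalars₁₂ A A)
  have hσ (b : B) (β : n → B) : σ (b ⊗ₜ β) = b • β := rfl
  have hσπ (x : B ⊗[A] (n → B)) (i : n) : σ x i = Algebra.TensorProduct.lmul' A (π x i) := by
    induction x with
    | zero => simp
    | add x y hx hy => simp [hx, hy]
    | tmul b β => simp [hσ, π]
  have hspan (y : B ⊗[A] LinearMap.ker δ) :
      σ (LinearMap.lTensor B (LinearMap.ker δ).subtype y) ∈
        Submodule.span B (invariantVectors Θ) := by
    induction y with
    | zero => simp
    | add x y hx hy => rw [map_add, map_add]; exact add_mem hx hy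
    | tmul b m =>
      rw [LinearMap.lTensor_tmul, hσ]
      exact Submodule.smul_mem _ _ (Submodule.subset_span (hM _ m.2))
  have hcol (j : n) : Pi.single j 1 ∈ Submodule.span B (invariantVectors Θ) := by
    let c := π.symm fun k => Θ k j
    have hc : LinearMap.lTensor B δ c = 0 := by
      apply (TensorProduct.piRight A A B (fun _ : n => B ⊗[A] B)).injective
      funext i
      rw [hcomp]
      simp only [c, LinearEquiv.apply_symm_apply, h, sub_self, map_zero, Pi.zero_apply]
    obtain ⟨y, hy⟩ := (hex c).1 hc
    have := hspan y
    rw [hy] at this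
    convert this using 1
    funext i
    rw [hσπ]
    simp [c, h1, Matrix.one_apply, Pi.single_apply]
  rw [eq_top_iff]
  intro v _
  rw [pi_eq_sum_univ v]
  refine Submodule.sum_mem _ fun i _ => Submodule.smul_mem _ _ ?_
  convert hcol i using 1
  funext j
  simp [Pi.single_apply, eq_comm]

end

end Module.Flat

/-- From a generating set of a free module one can choose vectors whose determinant does not lie in
a given prime ideal. -/
lemma Ideal.exists_det_notMem_of_span_eq_top {B : Type*} [CommRing B] {n : ℕ}
    {S : Set (Fin n → B)} (hS : Submodule.span B S = ⊤) (p : Ideal B) [p.IsPrime] :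
    ∃ m : Matrix (Fin n) (Fin n) B, (∀ i, m i ∈ S) ∧ m.det ∉ p := by
  let K := p.ResidueField
  let π : (Fin n → B) →ₗ[B] (Fin n → K) := (Algebra.linearMap B K).compLeft (Fin n)
  have hspan : Submodule.span K (π '' S) = ⊤ := by
    have h1 (v : Fin n → B) : π v ∈ Submodule.span K (π '' S) := by
      have hv : v ∈ Submodule.span B S := hS ▸ Submodule.mem_top
      induction hv using Submodule.span_induction with
      | mem x hx => exact Submodule.subset_span ⟨x, hx, rfl⟩
      | zero => rw [map_zero]; exact zero_mem _
      | add x y _ _ hx hy => rw [map_add]; exact add_mem hx hy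
      | smul a x _ hx =>
        rw [map_smul, ← algebraMap_smul K a (π x)]
        exact Submodule.smul_mem _ _ hx
    rw [eq_top_iff]
    intro v _
    rw [pi_eq_sum_univ v]
    refine Submodule.sum_mem _ fun i _ => Submodule.smul_mem _ _ ?_
    convert h1 (Pi.single i 1) using 1
    funext j
    by_cases hij : i = j
    · subst hij; simp [π]
    · simp [π, hij, Ne.symm hij]
  obtain ⟨b, hbS, hb, hli⟩ := exists_linearIndependent K (π '' S)
  have hsp : ⊤ ≤ Submodule.span K (Set.range ((↑) : b → Fin n → K)) := by
    rw [Subtype.range_coe, hb, hspan]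
  let bas := Module.Basis.mk hli hsp
  let e : Fin n ≃ b := (Pi.basisFun K (Fin n)).indexEquiv bas
  choose m hmS hm using fun i => hbS (e i).2
  refine ⟨Matrix.of m, hmS, fun hdet => ?_⟩
  have hunit : IsUnit ((Matrix.of m).map (algebraMap B K)) := by
    rw [← Matrix.linearIndependent_rows_iff_isUnit]
    have h : ((Matrix.of m).map (algebraMap B K)).row = (fun x : b => (x : Fin n → K)) ∘ e :=
      funext fun i => hm i
    rw [h]
    exact hli.comp e e.injective
  have := (Matrix.isUnit_iff_isUnit_det _).1 hunit
  rw [← RingHom.mapMatrix_apply, ← RingHom.map_det] at this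
  apply this.ne_zero
  rwa [Ideal.algebraMap_residueField_eq_zero]
end

noncomputable section

namespace AlgebraicGeometry.Scheme.Modules

/-- Whether sections of a pullback form a basis can be checked after a faithfully flat base
change. -/
lemma IsBasisOn.of_pbComp_of_fpqc {T T' Z : Scheme.{u}} {r : T' ⟶ T} [Flat r] [Surjective r]
    [QuasiCompact r] {F : Z.Modules} (hF : IsVectorBundle F) {f : T ⟶ Z} {f' : T' ⟶ Z}
    (h : r ≫ f = f') {n : ℕ} {e : Fin n → Γ((pullback f).obj F, ⊤)}
    (he : IsBasisOn (fun i => Modules.pbComp r h (top_le_preimage r) (e i))) : IsBasisOn e := by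
  apply IsBasisOn.of_pb_of_fpqc (q := r) (hF.pullback f)
  have := he.map_iso (compIso r h F).symm
  simp only [Iso.symm_hom, ev_compIso_inv_pbComp] at this
  exact this

namespace DescentDatum
variable {P W Z : Scheme.{u}} {q : P ⟶ W} {p : P ⟶ Z} {V : Z.Modules} (D : DescentDatum q p V)

/-- The isomorphisms of a descent datum. -/
def isoMap {T : Scheme.{u}} (x₁ x₂ : T ⟶ P) (h : x₁ ≫ q = x₂ ≫ q) :
    (pullback (x₁ ≫ p)).obj V ≅ (pullback (x₂ ≫ p)).obj V where
  hom := D.map x₁ x₂ h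
  inv := D.map x₂ x₁ h.symm
  hom_inv_id := by rw [D.map_comp, D.map_self]
  inv_hom_id := by rw [D.map_comp, D.map_self]

lemma ev_map_ev_map {T : Scheme.{u}} {x₁ x₂ x₃ : T ⟶ P} (h : x₁ ≫ q = x₂ ≫ q)
    (h' : x₂ ≫ q = x₃ ≫ q) {A : T.Opens} (s : Γ((pullback (x₁ ≫ p)).obj V, A)) :
    ev (D.map x₂ x₃ h') (ev (D.map x₁ x₂ h) s) = ev (D.map x₁ x₃ (h.trans h')) s := by
  rw [← D.map_comp x₁ x₂ x₃ h h', ev_comp]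

lemma pbComp_ev_map {T T' : Scheme.{u}} (g : T' ⟶ T) (x₁ x₂ : T ⟶ P) (h : x₁ ≫ q = x₂ ≫ q)
    {y₁ y₂ : T' ⟶ P} (e₁ : g ≫ x₁ = y₁) (e₂ : g ≫ x₂ = y₂) (h' : y₁ ≫ q = y₂ ≫ q)
    {O : P.Opens} {A : T.Opens} {B : T'.Opens} (k : A ≤ x₁ ⁻¹ᵁ O) (l : B ≤ g ⁻¹ᵁ A)
    (k' : B ≤ y₁ ⁻¹ᵁ O) (s : Γ((pullback p).obj V, O)) (e : g ≫ x₂ ≫ p = y₂ ≫ p) :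
    pbComp g e l (ev (D.map x₁ x₂ h) (pbComp x₁ rfl k s)) =
      ev (D.map y₁ y₂ h') (pbComp y₁ rfl k' s) := by
  subst e₁ e₂
  rw [← D.pullHom_map g x₁ x₂ h h',
    ← pbComp_pbComp rfl (Category.assoc g x₁ p).symm rfl rfl k l k', ev_pullHom_pbComp]

/-- A basis of invariant sections over an open extends to the saturation of that open. -/
lemma exists_extension [Flat q] (hV : IsVectorBundle V) {O : P.Opens} {U : W.Opens}
    (hO : O ≤ q ⁻¹ᵁ U) (hsurj : ∀ w ∈ U, ∃ x ∈ O, q x = w) (hqc : QuasiCompact (q.resLE U O hO))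
    {n : ℕ} {e : Fin n → Γ((pullback p).obj V, O)} (he : IsBasisOn e)
    (hi : ∀ i, D.IsInvariant (e i)) :
    ∃ e' : Fin n → Γ((pullback p).obj V, q ⁻¹ᵁ U), IsBasisOn e' ∧ ∀ i, D.IsInvariant (e' i) := by
  let g : (O : Scheme.{u}) ⟶ U := q.resLE U O hO
  have hg : g ≫ U.ι = O.ι ≫ q := Scheme.Hom.resLE_comp_ι _ _
  have : QuasiCompact g := hqc
  have : Surjective g := ⟨fun w => by
    obtain ⟨x, hx, hxw⟩ := hsurj w.1 w.2
    refine ⟨⟨x, hx⟩, Subtype.ext ?_⟩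
    rw [Scheme.Hom.coe_resLE_apply]
    exact hxw⟩
  let Q : P.Opens := q ⁻¹ᵁ U
  let fst' := Limits.pullback.fst g (q ∣_ U)
  let b' : Limits.pullback g (q ∣_ U) ⟶ (Q : Scheme.{u}) := Limits.pullback.snd g (q ∣_ U)
  have hfst : fst' ≫ g = b' ≫ q ∣_ U := Limits.pullback.condition
  let a := fst' ≫ O.ι
  let b := b' ≫ Q.ι
  have hab : a ≫ q = b ≫ q := by
    simp only [a, b, Category.assoc, ← hg, Q, ← morphismRestrict_ι]
    rw [reassoc_of% hfst]
  have lift_exists {T : Scheme.{u}} (y x : T ⟶ P) (h : y ≫ q = x ≫ q) (hy : ⊤ ≤ y ⁻¹ᵁ O)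
      (hx : ⊤ ≤ x ⁻¹ᵁ Q) : ∃ l : T ⟶ Limits.pullback g (q ∣_ U), l ≫ a = y ∧ l ≫ b = x := by
    let y' : T ⟶ (O : Scheme.{u}) := IsOpenImmersion.lift O.ι y (by
      rintro _ ⟨t, rfl⟩; rw [Scheme.Opens.range_ι]; exact hy (by trivial : t ∈ ⊤))
    let x' : T ⟶ (Q : Scheme.{u}) := IsOpenImmersion.lift Q.ι x (by
      rintro _ ⟨t, rfl⟩; rw [Scheme.Opens.range_ι]; exact hx (by trivial : t ∈ ⊤))
    have hy' : y' ≫ O.ι = y := IsOpenImmersion.lift_fac _ _ _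
    have hx' : x' ≫ Q.ι = x := IsOpenImmersion.lift_fac _ _ _
    refine ⟨Limits.pullback.lift y' x' ?_, ?_, ?_⟩
    · rw [← cancel_mono U.ι, Category.assoc, hg, Category.assoc, morphismRestrict_ι]
      rw [reassoc_of% hy', reassoc_of% hx', h]
    · rw [Limits.pullback.lift_fst_assoc, hy']
    · rw [Limits.pullback.lift_snd_assoc, hx']
  have ha : ⊤ ≤ a ⁻¹ᵁ O := by simp [a]
  have hb : ⊤ ≤ b ⁻¹ᵁ Q := by simp [b]
  have hQ : (⊤ : (Q : Scheme.{u}).Opens) = Q.ι ⁻¹ᵁ Q := by simp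
  let p₁ := Limits.pullback.fst b' b'
  let p₂ := Limits.pullback.snd b' b'
  have hp : IsPullback p₁ p₂ b' b' := IsPullback.of_hasPullback b' b'
  have hbp : b' ≫ Q.ι ≫ p = b ≫ p := (Category.assoc _ _ _).symm
  have hpb : p₂ ≫ b = p₁ ≫ b := by
    have := hp.w
    simp only [b, reassoc_of% this]
  have hbb : b' ≫ Q.ι = b := rfl
  clear_value a b
  have key (i : Fin n) : ∃ t : Γ((pullback (Q.ι ≫ p)).obj V, ⊤),
      pbComp b' hbp (top_le_preimage b') t = ev (D.map a b hab) (pbComp a rfl ha (e i)) := by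
    have h₁ : p₁ ≫ b ≫ p = (p₁ ≫ b) ≫ p := (Category.assoc _ _ _).symm
    have h₂ : p₂ ≫ b ≫ p = (p₁ ≫ b) ≫ p := by rw [← hpb, Category.assoc]
    have hq₁ : (p₁ ≫ a) ≫ q = (p₁ ≫ b) ≫ q := by rw [Category.assoc, hab, Category.assoc]
    have hq₂ : (p₂ ≫ a) ≫ q = (p₁ ≫ b) ≫ q := by rw [← hpb, Category.assoc, hab, Category.assoc]
    refine exists_pbComp_eq_of_fpqc hV hp hbp h₁ h₂ ⊤ _ (V := ⊤) rfl le_rfl ?_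
    have k₁ : ⊤ ≤ (p₁ ≫ a) ⁻¹ᵁ O := p₁.preimage_mono ha
    have k₂ : ⊤ ≤ (p₂ ≫ a) ⁻¹ᵁ O := p₂.preimage_mono ha
    have h₃ : ev (D.map (p₁ ≫ a) (p₁ ≫ b) hq₁) (pbComp (p₁ ≫ a) rfl k₁ (e i)) =
        ev (D.map (p₂ ≫ a) (p₁ ≫ b) hq₂) (pbComp (p₂ ≫ a) rfl k₂ (e i)) := by
      rw [← hi i (p₁ ≫ a) (p₂ ≫ a) (hq₁.trans hq₂.symm) ⊤ k₁ k₂, ev_map_ev_map]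
    exact (D.pbComp_ev_map p₁ a b hab rfl rfl hq₁ ha le_rfl k₁ _ h₁).trans
      (h₃.trans (D.pbComp_ev_map p₂ a b hab rfl hpb hq₂ ha le_rfl k₂ _ h₂).symm)
  choose t ht using key
  have hbas : IsBasisOn t := by
    apply IsBasisOn.of_pbComp_of_fpqc hV hbp
    simp only [ht]
    exact (he.pbComp rfl ha).map_iso (D.isoMap a b hab)
  choose e' he' using fun i => (bijective_pb_of_isOpenImmersion (M := (pullback p).obj V) Q.ι
    (U := Q) (by simp) hQ).2 (ev (compIso Q.ι (f := p) rfl V).inv (t i))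
  dsimp only at he'
  have hte (i : Fin n) : pbComp Q.ι rfl hQ.le (e' i) = t i := by
    rw [pbComp, he', ev_inv_hom]
  have hT (i : Fin n) {T : Scheme.{u}} (y x : T ⟶ P) (h : y ≫ q = x ≫ q) (hy : ⊤ ≤ y ⁻¹ᵁ O)
      (hx : ⊤ ≤ x ⁻¹ᵁ Q) :
      ev (D.map y x h) (pbComp y rfl hy (e i)) = pbComp x rfl hx (e' i) := by
    obtain ⟨l, hl₁, hl₂⟩ := lift_exists y x h hy hx
    refine ev_map_comp_pbComp l hab (k₁ := ha) (k₂ := hb) ?_ hl₁ hl₂ h (le_refl ⊤) hy hx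
    have h₅ := pbComp_pbComp rfl hbp hbb rfl hQ.le (top_le_preimage b') hb (e' i)
    rw [hte, ht] at h₅
    exact h₅
  refine ⟨e', ?_, fun i => IsInvariant.of_top fun {T} x₁ x₂ h k₁ k₂ => ?_⟩
  · rw [← isBasisOn_pb_ι_iff hQ.le]
    simp only [he']
    exact hbas.map_iso (compIso Q.ι (f := p) rfl V).symm
  · let x' : T ⟶ (Q : Scheme.{u}) := IsOpenImmersion.lift Q.ι x₁ (by
      rintro _ ⟨t, rfl⟩; rw [Scheme.Opens.range_ι]; exact k₁ (by trivial : t ∈ ⊤))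
    have hx' : x' ≫ Q.ι = x₁ := IsOpenImmersion.lift_fac _ _ _
    let r := Limits.pullback.fst x' b'
    let y := Limits.pullback.snd x' b' ≫ a
    have hy : ⊤ ≤ y ⁻¹ᵁ O := (Limits.pullback.snd x' b').preimage_mono ha
    have hyr : y ≫ q = (r ≫ x₁) ≫ q := by
      rw [Category.assoc, hab, ← hx']
      simp only [← hbb, r, Limits.pullback.condition_assoc, Category.assoc]
    have hr : (r ≫ x₁) ≫ q = (r ≫ x₂) ≫ q := by rw [Category.assoc, h, Category.assoc]
    have m₁ : ⊤ ≤ (r ≫ x₁) ⁻¹ᵁ Q := r.preimage_mono k₁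
    have m₂ : ⊤ ≤ (r ≫ x₂) ⁻¹ᵁ Q := r.preimage_mono k₂
    have ass : r ≫ x₂ ≫ p = (r ≫ x₂) ≫ p := (Category.assoc _ _ _).symm
    apply pbComp_injective_of_fpqc (q := r) hV ass (V := ⊤) rfl
    have h₃ : ev (D.map (r ≫ x₁) (r ≫ x₂) hr) (pbComp (r ≫ x₁) rfl m₁ (e' i)) =
        pbComp (r ≫ x₂) rfl m₂ (e' i) := by
      rw [← hT i y (r ≫ x₁) hyr hy m₁, ← hT i y (r ≫ x₂) (hyr.trans hr) hy m₂, ev_map_ev_map]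
    exact (D.pbComp_ev_map r x₁ x₂ h rfl rfl hr k₁ le_rfl m₁ _ ass).trans
      (h₃.trans (pbComp_pbComp rfl ass rfl rfl k₂ le_rfl m₂ _).symm)

end DescentDatum

end AlgebraicGeometry.Scheme.Modules
end

noncomputable section

open TensorProduct in
/-- The tensor square of an algebra represents pairs of points with the same image. -/
lemma AlgebraicGeometry.IsAffineOpen.exists_lift_tensor {P W T : Scheme.{u}} {q : P ⟶ W}
    {U : W.Opens} {O : P.Opens} (hU : IsAffineOpen U) (hO : IsAffineOpen O) (hOU : O ≤ q ⁻¹ᵁ U)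
    [Algebra Γ(W, U) Γ(P, O)]
    (halg : algebraMap Γ(W, U) Γ(P, O) = (q.appLE U O hOU).hom)
    (x₁ x₂ : T ⟶ P) (h : x₁ ≫ q = x₂ ≫ q) (h₁ : ⊤ ≤ x₁ ⁻¹ᵁ O) (h₂ : ⊤ ≤ x₂ ⁻¹ᵁ O) :
    ∃ l : T ⟶ Spec (.of (Γ(P, O) ⊗[Γ(W, U)] Γ(P, O))),
      l ≫ Spec.map (CommRingCat.ofHom (Algebra.TensorProduct.includeLeftRingHom)) ≫
        hO.fromSpec = x₁ ∧
      l ≫ Spec.map (CommRingCat.ofHom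
        (Algebra.TensorProduct.includeRight : _ →ₐ[Γ(W, U)] _).toRingHom) ≫ hO.fromSpec = x₂ := by
  have hlift (x : T ⟶ P) (hx : ⊤ ≤ x ⁻¹ᵁ O) : ∃ x' : T ⟶ Spec Γ(P, O), x' ≫ hO.fromSpec = x :=
    ⟨IsOpenImmersion.lift hO.fromSpec x (by
      rintro _ ⟨t, rfl⟩; rw [hO.range_fromSpec]; exact hx (by trivial : t ∈ ⊤)),
      IsOpenImmersion.lift_fac _ _ _⟩
  obtain ⟨y₁, hy₁⟩ := hlift x₁ h₁
  obtain ⟨y₂, hy₂⟩ := hlift x₂ h₂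
  have hpull := isPullback_SpecMap_of_isPushout _ _ _ _
    (CommRingCat.isPushout_tensorProduct Γ(W, U) Γ(P, O) Γ(P, O))
  have hw : y₁ ≫ Spec.map (CommRingCat.ofHom (algebraMap Γ(W, U) Γ(P, O))) =
      y₂ ≫ Spec.map (CommRingCat.ofHom (algebraMap Γ(W, U) Γ(P, O))) := by
    rw [halg, CommRingCat.ofHom_hom, ← cancel_mono hU.fromSpec, Category.assoc, Category.assoc,
      IsAffineOpen.SpecMap_appLE_fromSpec q hU hO hOU, reassoc_of% hy₁, reassoc_of% hy₂, h]
  refine ⟨hpull.lift _ _ hw, ?_, ?_⟩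
  · rw [← hy₁]
    exact (Category.assoc _ _ _).symm.trans (congrArg (· ≫ hO.fromSpec) (hpull.lift_fst _ _ hw))
  · rw [← hy₂]
    exact (Category.assoc _ _ _).symm.trans (congrArg (· ≫ hO.fromSpec) (hpull.lift_snd _ _ hw))

/-- The point of an affine open given by a ring homomorphism. -/
def AlgebraicGeometry.IsAffineOpen.specPoint {P : Scheme.{u}} {O : P.Opens} (hO : IsAffineOpen O)
    {R : CommRingCat.{u}} (φ : Γ(P, O) ⟶ R) : Spec R ⟶ P :=
  Spec.map φ ≫ hO.fromSpec

namespace AlgebraicGeometry.IsAffineOpen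
variable {P : Scheme.{u}} {O : P.Opens} (hO : IsAffineOpen O) {R R' : CommRingCat.{u}}

lemma top_le_specPoint (φ : Γ(P, O) ⟶ R) : ⊤ ≤ hO.specPoint φ ⁻¹ᵁ O := by
  rw [specPoint, Scheme.Hom.comp_preimage, hO.fromSpec_preimage_self]
  exact le_rfl

lemma specMap_specPoint (φ : Γ(P, O) ⟶ R) (χ : R ⟶ R') :
    Spec.map χ ≫ hO.specPoint φ = hO.specPoint (φ ≫ χ) := by
  rw [specPoint, specPoint, Spec.map_comp, Category.assoc]

lemma specPoint_appLE (φ : Γ(P, O) ⟶ R) (b : Γ(P, O)) :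
    (hO.specPoint φ).appLE O ⊤ (hO.top_le_specPoint φ) b = (Scheme.ΓSpecIso R).inv (φ b) := by
  have h1 : ⊤ ≤ hO.fromSpec ⁻¹ᵁ O := by rw [hO.fromSpec_preimage_self]
  have h2 : hO.fromSpec.appLE O ⊤ h1 = (Scheme.ΓSpecIso _).inv := by
    rw [Scheme.Hom.appLE, hO.fromSpec_app_self, Category.assoc, ← Functor.map_comp]
    exact (congrArg ((Scheme.ΓSpecIso _).inv ≫ ·)
      ((Spec Γ(P, O)).presheaf.map_id _)).trans (Category.comp_id _)
  have h3 : (hO.specPoint φ).appLE O ⊤ (hO.top_le_specPoint φ) =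
      φ ≫ (Scheme.ΓSpecIso R).inv := by
    rw [Scheme.ΓSpecIso_inv_naturality, ← h2, Scheme.appTop_eq_appLE,
      Scheme.Hom.appLE_comp_appLE]
    rfl
  exact congrArg (fun α => α.hom b) h3

end AlgebraicGeometry.IsAffineOpen

namespace AlgebraicGeometry.Scheme.Modules

/-- The combinations of a basis with an invertible coefficient matrix form a basis. -/
lemma IsBasisOn.of_matrix {X : Scheme.{u}} {M : X.Modules} {U : X.Opens} {n : ℕ}
    {e : Fin n → Γ(M, U)} (he : IsBasisOn e) (m : Matrix (Fin n) (Fin n) Γ(X, U))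
    (hm : IsUnit m.det) : IsBasisOn (fun i => ∑ k, m i k • e k) := by
  intro V hV
  let m' : Matrix (Fin n) (Fin n) Γ(X, V) := (X.presheaf.map (homOfLE hV).op).hom.mapMatrix m
  have hm' : IsUnit m' := by
    rw [Matrix.isUnit_iff_isUnit_det]
    change IsUnit ((X.presheaf.map (homOfLE hV).op).hom.mapMatrix m).det
    rw [← RingHom.map_det]
    exact hm.map _
  have hb : Function.Bijective (fun f : Fin n → Γ(X, V) => Matrix.vecMul f m') := by
    obtain ⟨w, hw⟩ := hm'
    refine Function.bijective_iff_has_inverse.2 ⟨fun f => Matrix.vecMul f (w⁻¹ :), fun f => ?_,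
      fun f => ?_⟩
    · simp [Matrix.vecMul_vecMul, ← hw]
    · simp [Matrix.vecMul_vecMul, ← hw]
  convert (he V hV).comp hb using 1
  funext f
  simp only [res_sum, res_smul, Function.comp_apply, Matrix.vecMul, dotProduct, Finset.smul_sum,
    Finset.sum_smul, smul_smul]
  rw [Finset.sum_comm]
  rfl

namespace DescentDatum
variable {P W Z : Scheme.{u}} {q : P ⟶ W} {p : P ⟶ Z} {V : Z.Modules} (D : DescentDatum q p V)
  {O : P.Opens} (hO : IsAffineOpen O) {n : ℕ} (e : Fin n → Γ((pullback p).obj V, O))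
  {R R' : CommRingCat.{u}}

/-- The pullbacks to a point of an affine open of sections over that open. -/
def pointSec (φ : Γ(P, O) ⟶ R) (i : Fin n) :
    Γ((pullback (hO.specPoint φ ≫ p)).obj V, ⊤) :=
  pbComp (hO.specPoint φ) rfl (hO.top_le_specPoint φ) (e i)

/-- The matrix of a descent datum between two points of an affine open, with respect to sections
over that open. -/
def IsTransition (φ ψ : Γ(P, O) ⟶ R) (Θ : Matrix (Fin n) (Fin n) R) : Prop :=
  ∀ h : hO.specPoint φ ≫ q = hO.specPoint ψ ≫ q, ∀ j,
    ev (D.map _ _ h) (pointSec hO e φ j) =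
      ∑ i, (Scheme.ΓSpecIso R).inv (Θ i j) • pointSec hO e ψ i

variable {D hO e}

lemma IsTransition.map {φ ψ : Γ(P, O) ⟶ R} {Θ : Matrix (Fin n) (Fin n) R}
    (h : D.IsTransition hO e φ ψ Θ) (χ : R ⟶ R')
    (hq : hO.specPoint φ ≫ q = hO.specPoint ψ ≫ q) :
    D.IsTransition hO e (φ ≫ χ) (ψ ≫ χ) (Θ.map χ) := by
  intro hq' j
  have e₂ : Spec.map χ ≫ hO.specPoint ψ ≫ p = hO.specPoint (ψ ≫ χ) ≫ p := by
    rw [← Category.assoc, hO.specMap_specPoint]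
  have h1 := congrArg (pbComp (Spec.map χ) e₂ (top_le_preimage _)) (h hq j)
  have h2 := D.pbComp_ev_map (Spec.map χ) _ _ hq (hO.specMap_specPoint φ χ)
    (hO.specMap_specPoint ψ χ) hq' (hO.top_le_specPoint φ) (top_le_preimage _)
    (hO.top_le_specPoint (φ ≫ χ)) (e j) e₂
  refine h2.symm.trans (h1.trans ?_)
  rw [pbComp_sum]
  refine Finset.sum_congr rfl fun i _ => ?_
  rw [pbComp_smul]
  have h3 : (Spec.map χ).appLE ⊤ ⊤ (top_le_preimage _) ((Scheme.ΓSpecIso R).inv (Θ i j)) =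
      (Scheme.ΓSpecIso R').inv (χ (Θ i j)) := by
    rw [← appTop_eq_appLE]
    exact congrArg (fun α => α.hom (Θ i j)) (Scheme.ΓSpecIso_inv_naturality χ).symm
  have h4 : pbComp (Spec.map χ) e₂ (top_le_preimage _) (pointSec hO e ψ i) =
      pointSec hO e (ψ ≫ χ) i :=
    pbComp_pbComp rfl e₂ (hO.specMap_specPoint ψ χ) rfl _ _ _ _
  rw [h3, h4]
  rfl

lemma IsTransition.comp {φ ψ ρ : Γ(P, O) ⟶ R} {Θ Θ' : Matrix (Fin n) (Fin n) R}
    (h : D.IsTransition hO e φ ψ Θ) (h' : D.IsTransition hO e ψ ρ Θ')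
    (hq : hO.specPoint φ ≫ q = hO.specPoint ψ ≫ q) :
    D.IsTransition hO e φ ρ (Θ' * Θ) := by
  intro hq' j
  rw [← D.ev_map_ev_map hq (hq.symm.trans hq'), h hq j]
  simp only [ev_sum, ev_smul, h' (hq.symm.trans hq'), Matrix.mul_apply, map_sum, map_mul,
    Finset.sum_smul, Finset.smul_sum, smul_smul]
  rw [Finset.sum_comm]
  simp only [mul_comm]

lemma isTransition_one (φ : Γ(P, O) ⟶ R) : D.IsTransition hO e φ φ 1 := by
  intro hq j
  rw [D.map_self, ev_id, Finset.sum_eq_single j]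
  · rw [Matrix.one_apply_eq, map_one, one_smul]
  · intro i _ hij
    rw [Matrix.one_apply_ne hij, map_zero, zero_smul]
  · simp

lemma isBasisOn_pointSec (he : IsBasisOn e) (φ : Γ(P, O) ⟶ R) : IsBasisOn (pointSec hO e φ) :=
  he.pbComp rfl (hO.top_le_specPoint φ)

lemma combination_injective (he : IsBasisOn e) (φ : Γ(P, O) ⟶ R) {a b : Fin n → R}
    (h : ∑ i, (Scheme.ΓSpecIso R).inv (a i) • pointSec hO e φ i =
      ∑ i, (Scheme.ΓSpecIso R).inv (b i) • pointSec hO e φ i) : a = b := by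
  have h1 := (isBasisOn_pointSec (hO := hO) he φ ⊤ le_rfl).1
    (a₁ := fun i => (Scheme.ΓSpecIso R).inv (a i)) (a₂ := fun i => (Scheme.ΓSpecIso R).inv (b i))
    (by simpa only [res_self] using h)
  funext i
  exact (ConcreteCategory.bijective_of_isIso (Scheme.ΓSpecIso R).inv).1 (congrFun h1 i)

lemma IsTransition.unique (he : IsBasisOn e) {φ ψ : Γ(P, O) ⟶ R}
    {Θ Θ' : Matrix (Fin n) (Fin n) R} (h : D.IsTransition hO e φ ψ Θ)
    (h' : D.IsTransition hO e φ ψ Θ') (hq : hO.specPoint φ ≫ q = hO.specPoint ψ ≫ q) :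
    Θ = Θ' := by
  ext i j
  exact congrFun (combination_injective he ψ ((h hq j).symm.trans (h' hq j))) i

lemma exists_isTransition (he : IsBasisOn e) {φ ψ : Γ(P, O) ⟶ R}
    (hq : hO.specPoint φ ≫ q = hO.specPoint ψ ≫ q) :
    ∃ Θ : Matrix (Fin n) (Fin n) R, D.IsTransition hO e φ ψ Θ := by
  choose c hc using fun j => (isBasisOn_pointSec (hO := hO) he ψ ⊤ le_rfl).2
    (ev (D.map _ _ hq) (pointSec hO e φ j))
  refine ⟨Matrix.of fun i j => (Scheme.ΓSpecIso R).hom (c j i), fun _ j => ?_⟩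
  rw [← hc]
  dsimp only
  refine Finset.sum_congr rfl fun i _ => ?_
  rw [res_self, Matrix.of_apply]
  congr 1
  exact (congrArg (fun α => α.hom (c j i)) (Scheme.ΓSpecIso R).hom_inv_id).symm

end DescentDatum

end AlgebraicGeometry.Scheme.Modules
end

noncomputable section

lemma AlgebraicGeometry.IsAffineOpen.specPoint_comp_eq {P W : Scheme.{u}} {q : P ⟶ W}
    {U : W.Opens} {O : P.Opens} (hU : IsAffineOpen U) (hO : IsAffineOpen O) (hOU : O ≤ q ⁻¹ᵁ U)
    {R : CommRingCat.{u}} {φ ψ : Γ(P, O) ⟶ R} (h : q.appLE U O hOU ≫ φ = q.appLE U O hOU ≫ ψ) :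
    hO.specPoint φ ≫ q = hO.specPoint ψ ≫ q := by
  rw [specPoint, specPoint, Category.assoc, Category.assoc,
    ← IsAffineOpen.SpecMap_appLE_fromSpec q hU hO hOU, ← Spec.map_comp_assoc,
    ← Spec.map_comp_assoc, h]

namespace AlgebraicGeometry.Scheme.Modules.DescentDatum
variable {P W Z : Scheme.{u}} {q : P ⟶ W} {p : P ⟶ Z} {V : Z.Modules} (D : DescentDatum q p V)

variable {D} in
lemma IsInvariant.res {O O' : P.Opens} {s : Γ((pullback p).obj V, O)} (hs : D.IsInvariant s)
    (h : O' ≤ O) : D.IsInvariant (Modules.res h s) := by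
  intro T x₁ x₂ hx A k₁ k₂
  rw [pbComp_res, pbComp_res]
  exact hs x₁ x₂ hx A _ _

open TensorProduct in
/-- Over an affine open over an affine open, the invariant combinations of a basis generate. -/
lemma exists_span_eq_top [Flat q] {U : W.Opens} {O : P.Opens} (hU : IsAffineOpen U)
    (hO : IsAffineOpen O) (hOU : O ≤ q ⁻¹ᵁ U) {n : ℕ} {e : Fin n → Γ((pullback p).obj V, O)}
    (he : IsBasisOn e) :
    ∃ S : Set (Fin n → Γ(P, O)), Submodule.span Γ(P, O) S = ⊤ ∧
      ∀ b ∈ S, D.IsInvariant (∑ k, b k • e k) := by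
  let alg : Algebra Γ(W, U) Γ(P, O) := (q.appLE U O hOU).hom.toAlgebra
  have halg : algebraMap Γ(W, U) Γ(P, O) = (q.appLE U O hOU).hom := rfl
  have hflat : Module.Flat Γ(W, U) Γ(P, O) :=
    HasRingHomProperty.appLE @Flat q inferInstance ⟨U, hU⟩ ⟨O, hO⟩ hOU
  let A := Γ(W, U)
  let B := Γ(P, O)
  let R : CommRingCat.{u} := .of (B ⊗[A] B)
  let R' : CommRingCat.{u} := .of (B ⊗[A] (B ⊗[A] B))
  let l : B ⟶ R := CommRingCat.ofHom Algebra.TensorProduct.includeLeftRingHom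
  let r : B ⟶ R := CommRingCat.ofHom (Algebra.TensorProduct.includeRight : B →ₐ[A] _).toRingHom
  let i₁₂ : R ⟶ R' := CommRingCat.ofHom (Algebra.TensorProduct.map (AlgHom.id A B)
          (Algebra.TensorProduct.includeLeft : B →ₐ[A] B ⊗[A] B)).toRingHom
  let i₁₃ : R ⟶ R' := CommRingCat.ofHom (Algebra.TensorProduct.map (AlgHom.id A B)
          (Algebra.TensorProduct.includeRight : B →ₐ[A] B ⊗[A] B)).toRingHom
  let i₂₃ : R ⟶ R' := CommRingCat.ofHom
    (Algebra.TensorProduct.includeRight : B ⊗[A] B →ₐ[A] B ⊗[A] (B ⊗[A] B)).toRingHom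
  let μ' : R ⟶ B := CommRingCat.ofHom (Algebra.TensorProduct.lmul' A).toRingHom
  have hlr : q.appLE U O hOU ≫ l = q.appLE U O hOU ≫ r := by
    ext a
    exact (Algebra.TensorProduct.includeLeft : B →ₐ[A] B ⊗[A] B).commutes a |>.trans
      ((Algebra.TensorProduct.includeRight : B →ₐ[A] B ⊗[A] B).commutes a).symm
  have hq := hU.specPoint_comp_eq hO hOU hlr
  have hq' {R' : CommRingCat.{u}} (χ : R ⟶ R') :
      hO.specPoint (l ≫ χ) ≫ q = hO.specPoint (r ≫ χ) ≫ q :=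
    hU.specPoint_comp_eq hO hOU (by rw [reassoc_of% hlr])
  have e₁ : l ≫ i₁₂ = l ≫ i₁₃ := by
    ext b
    change b ⊗ₜ[A] ((1 : B) ⊗ₜ[A] (1 : B)) = _
    rfl
  have e₂ : r ≫ i₁₂ = l ≫ i₂₃ := by
    ext b
    rfl
  have e₃ : r ≫ i₁₃ = r ≫ i₂₃ := by
    ext b
    rfl
  have em₁ : l ≫ μ' = 𝟙 B := by
    ext b
    exact (Algebra.TensorProduct.lmul'_apply_tmul (R := A) b 1).trans (mul_one b)
  have em₂ : r ≫ μ' = 𝟙 B := by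
    ext b
    exact (Algebra.TensorProduct.lmul'_apply_tmul (R := A) 1 b).trans (one_mul b)
  obtain ⟨Θ, hΘ⟩ := exists_isTransition (D := D) (hO := hO) he hq
  have h12 := hΘ.map i₁₂ hq
  have h13 := hΘ.map i₁₃ hq
  have h23 := hΘ.map i₂₃ hq
  have hm := hΘ.map μ' hq
  rw [em₁, em₂] at hm
  have c1 : Θ.map μ' = 1 := hm.unique he (isTransition_one _) rfl
  have hq13 := hq' i₁₃
  rw [← e₁, e₃] at h13 hq13
  rw [e₂] at h12
  have hq12 := hq' i₁₂
  rw [e₂] at hq12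
  have c2 : Θ.map i₁₃ = Θ.map i₂₃ * Θ.map i₁₂ := h13.unique he (h12.comp h23 hq12) hq13
  refine ⟨Module.Flat.invariantVectors (A := A) Θ, ?_, fun b hb => IsInvariant.of_top ?_⟩
  · exact Module.Flat.span_invariantVectors Θ (fun i j => congrFun (congrFun c2 i) j)
      fun i j => congrFun (congrFun c1 i) j
  · intro T x₁ x₂ h k₁ k₂
    obtain ⟨t, ht₁, ht₂⟩ := hU.exists_lift_tensor hO hOU halg x₁ x₂ h k₁ k₂
    refine ev_map_comp_pbComp t hq (k₁ := hO.top_le_specPoint l) (k₂ := hO.top_le_specPoint r)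
      ?_ ht₁ ht₂ h (le_refl ⊤) k₁ k₂
    simp only [pbComp_sum, pbComp_smul, ev_sum, ev_smul, hO.specPoint_appLE]
    have h1 (j : Fin n) : ev (D.map _ _ hq) (pbComp (hO.specPoint l) rfl
        (hO.top_le_specPoint l) (e j)) = _ := hΘ hq j
    simp only [h1, Finset.smul_sum, smul_smul]
    rw [Finset.sum_comm]
    refine Finset.sum_congr rfl fun i _ => ?_
    rw [← Finset.sum_smul]
    refine congrArg (· • pointSec hO e r i) ?_
    have h2 : ∑ k, Θ i k * l (b k) = r (b i) := hb i
    rw [← h2, map_sum]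
    refine Finset.sum_congr rfl fun k _ => ?_
    rw [map_mul, mul_comm]

/-- A descent datum for a vector bundle along a faithfully flat morphism locally of finite
presentation admits local bases of invariant sections. -/
lemma exists_isBasisOn_isInvariant [Flat q] [Surjective q] [LocallyOfFinitePresentation q]
    (hV : IsVectorBundle V) (w : W) : ∃ (U : W.Opens) (_ : w ∈ U) (n : ℕ)
      (e : Fin n → Γ((pullback p).obj V, q ⁻¹ᵁ U)), IsBasisOn e ∧ ∀ i, D.IsInvariant (e i) := by
  obtain ⟨x, rfl⟩ := q.surjective w
  obtain ⟨U, hU, hxU, -⟩ := exists_isAffineOpen_mem_and_subset (U := ⊤) (x := q x) trivial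
  obtain ⟨O', hxO', n, e', he'⟩ := (hV.pullback p).exists_isBasisOn x
  obtain ⟨O, hO, hxO, hOU⟩ := exists_isAffineOpen_mem_and_subset (U := O' ⊓ q ⁻¹ᵁ U) (x := x)
    ⟨hxO', hxU⟩
  have hOO' : O ≤ O' := hOU.trans inf_le_left
  replace hOU : O ≤ q ⁻¹ᵁ U := hOU.trans inf_le_right
  have he := he'.of_le hOO'
  obtain ⟨S, hS, hinv⟩ := D.exists_span_eq_top hU hO hOU he
  obtain ⟨m, hmS, hdet⟩ := Ideal.exists_det_notMem_of_span_eq_top hS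
    (hO.primeIdealOf ⟨x, hxO⟩).asIdeal
  let O₂ := P.basicOpen m.det
  have hO₂ : O₂ ≤ O := P.basicOpen_le _
  have hxO₂ : x ∈ O₂ := by
    have h : hO.primeIdealOf ⟨x, hxO⟩ ∈ hO.fromSpec ⁻¹ᵁ P.basicOpen m.det := by
      rw [hO.fromSpec_preimage_basicOpen]
      exact hdet
    have h' : hO.fromSpec (hO.primeIdealOf ⟨x, hxO⟩) ∈ P.basicOpen m.det := h
    rwa [hO.fromSpec_primeIdealOf] at h'
  let U₂ : W.Opens := ⟨q '' O₂, q.isOpenMap _ O₂.2⟩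
  have hU₂ : U₂ ≤ U := by
    rintro _ ⟨y, hy, rfl⟩
    exact hOU (hO₂ hy)
  have hO₂U₂ : O₂ ≤ q ⁻¹ᵁ U₂ := fun y hy => ⟨y, hy, rfl⟩
  have hqc : QuasiCompact (q.resLE U₂ O₂ hO₂U₂) := by
    have : IsAffine O₂ := hO.basicOpen m.det
    have : IsAffine U := hU
    have h : QuasiCompact (q.resLE U₂ O₂ hO₂U₂ ≫ W.homOfLE hU₂) := by
      rw [Scheme.Hom.resLE_map]
      infer_instance
    exact MorphismProperty.of_postcomp (W := @QuasiCompact) (W' := @QuasiSeparated) _ _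
      inferInstance h
  obtain ⟨e₂, he₂, hi₂⟩ := D.exists_extension hV hO₂U₂ (fun w hw => hw) hqc
    ((he.of_le hO₂).of_matrix ((P.presheaf.map (homOfLE hO₂).op).hom.mapMatrix m) (by
      rw [← RingHom.map_det]
      exact P.toRingedSpace.isUnit_res_basicOpen m.det)) fun i => by
    have := (hinv _ (hmS i)).res hO₂
    simp only [res_sum, res_smul] at this
    exact this
  exact ⟨U₂, ⟨x, hxO₂, rfl⟩, n, e₂, he₂, hi₂⟩

/-- Faithfully flat descent for vector bundles. -/
theorem exists_descended [Flat q] [Surjective q] [QuasiCompact q] [LocallyOfFinitePresentation q]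
    (hV : IsVectorBundle V) : ∃ (E : W.Modules) (_ : IsVectorBundle E)
      (ε : (pullback q).obj E ≅ (pullback p).obj V),
      ∀ {T : Scheme.{u}} (x₁ x₂ : T ⟶ P) (h : x₁ ≫ q = x₂ ≫ q) {w : T ⟶ W} (e₁ : x₁ ≫ q = w)
        (e₂ : x₂ ≫ q = w),
        pullHom ε.hom x₁ e₁ rfl ≫ D.map x₁ x₂ h = pullHom ε.hom x₂ e₂ rfl :=
  D.exists_isVectorBundle (D.exists_isBasisOn_isInvariant hV)

end AlgebraicGeometry.Scheme.Modules.DescentDatum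
end

noncomputable section

namespace EquivBundle

open Scheme.Modules

variable {S : Scheme.{u}}

namespace VecG

section act
variable {G X : Over S} [GrpObj G] [ModObj G X]

/-- The isomorphism `(g • x)^* E ≅ x^* E` at points `g` of the group and `x` of the scheme. -/
def act (E : VecG G X) {T : Over S} (g : T ⟶ G) (x : T ⟶ X) {a b : T.left ⟶ X.left}
    (ha : (g • x).left = a) (hb : x.left = b) :
    (pullback a).obj E.sheaf ≅ (pullback b).obj E.sheaf :=
  pullIso E.iso (lift g x).left ((left_comp_left (Hom.smul_def _ g x).symm).trans ha)
    ((left_comp_left (lift_snd g x)).trans hb)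

variable (E F : VecG G X) {T T' : Over S} (g g' : T ⟶ G) (x : T ⟶ X) {a b c : T.left ⟶ X.left}

lemma pullHom_act (f : T' ⟶ T) (ha : (g • x).left = a) (hb : x.left = b)
    {a' b' : T'.left ⟶ X.left} (ka : f.left ≫ a = a') (kb : f.left ≫ b = b')
    {g₁ : T' ⟶ G} (hg : f ≫ g = g₁) {x₁ : T' ⟶ X} (hx : f ≫ x = x₁)
    (ha' : (g₁ • x₁).left = a') (hb' : x₁.left = b') :
    pullHom (E.act g x ha hb).hom f.left ka kb = (E.act g₁ x₁ ha' hb').hom := by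
  subst hg hx
  rw [act, act, pullIso_hom, pullIso_hom,
    pullHom_pullHom (ht := left_comp_left (comp_lift f g x))]

lemma pullHom_act_inv (f : T' ⟶ T) (ha : (g • x).left = a) (hb : x.left = b)
    {a' b' : T'.left ⟶ X.left} (ka : f.left ≫ a = a') (kb : f.left ≫ b = b')
    {g₁ : T' ⟶ G} (hg : f ≫ g = g₁) {x₁ : T' ⟶ X} (hx : f ≫ x = x₁)
    (ha' : (g₁ • x₁).left = a') (hb' : x₁.left = b') :
    pullHom (E.act g x ha hb).inv f.left kb ka = (E.act g₁ x₁ ha' hb').inv := by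
  have : pullIso (E.act g x ha hb) f.left ka kb = E.act g₁ x₁ ha' hb' :=
    Iso.ext (E.pullHom_act g x f ha hb ka kb hg hx ha' hb')
  rw [← this, pullIso_inv]

attribute [irreducible] act

lemma act_mul {x' : T ⟶ X} (hx : g' • x = x') {g'' : T ⟶ G} (hg : g * g' = g'')
    (ha : (g'' • x).left = a) (ha' : (g • x').left = a) (hb : x'.left = b)
    (hb' : (g' • x).left = b) (hc : x.left = c) :
    (E.act g'' x ha hc).hom = (E.act g x' ha' hb).hom ≫ (E.act g' x hb' hc).hom := by
  subst hx hg hb hc ha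
  have e₁ : lift g (lift g' x) ≫ (α_ G G X).inv ≫ μ[G] ▷ X = lift (g * g') x := by
    apply CartesianMonoidalCategory.hom_ext
    · rw [lift_fst, Hom.mul_def]; simp
    · simp
  have e₂ : lift g (lift g' x) ≫ G ◁ γ[G, X] = lift g (g' • x) := by
    rw [Hom.smul_def]; simp
  have e₃ : lift g (lift g' x) ≫ snd G (G ⊗ X) = lift g' x := lift_snd _ _
  have f₁ : (lift g (lift g' x) ≫ (G ◁ γ[G, X]) ≫ γ[G, X]) = (g * g') • x := by
    rw [reassoc_of% e₂, ← Hom.smul_def, mul_smul]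
  have f₂ : (lift g (lift g' x) ≫ snd G (G ⊗ X) ≫ γ[G, X]) = g' • x := by
    rw [reassoc_of% e₃, ← Hom.smul_def]
  have f₃ : (lift g (lift g' x) ≫ snd G (G ⊗ X) ≫ snd G X) = x := by
    simp
  have k₁ := pullHom_pullHom E.iso.hom _ (left_comp_left (mulLeft_smul G X))
    (left_comp_left (mulLeft_snd G X)) _ (left_comp_left f₁) (left_comp_left f₃)
    (left_comp_left e₁)
  have k₂ := pullHom_pullHom E.iso.hom _ (left_comp_left rfl)
    (left_comp_left (whiskerLeft_smul_snd G X)) _ (left_comp_left f₁) (left_comp_left f₂)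
    (left_comp_left e₂)
  have k₃ := pullHom_pullHom E.iso.hom _ (left_comp_left rfl)
    (left_comp_left rfl) _ (left_comp_left f₂) (left_comp_left f₃)
    (left_comp_left e₃)
  rw [act, act, act, pullIso_hom, pullIso_hom, pullIso_hom]
  refine k₁.symm.trans (Eq.trans ?_ (congrArg₂ (· ≫ ·) k₂ k₃))
  rw [E.cocycle, pullHom_comp]

lemma act_one (ha : ((1 : T ⟶ G) • x).left = a) (hb : x.left = a) :
    E.act 1 x ha hb = Iso.refl _ := by
  have h := E.act_mul 1 1 x (one_smul _ x) (mul_one 1) ha ha hb ha hb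
  ext1
  rw [← cancel_epi (E.act 1 x ha hb).hom, ← h]
  exact (Category.comp_id _).symm

lemma act_map {E F : VecG G X} (f : E ⟶ F) (ha : (g • x).left = a) (hb : x.left = b) :
    (E.act g x ha hb).hom ≫ (pullback b).map f.hom =
      (pullback a).map f.hom ≫ (F.act g x ha hb).hom :=
  by rw [act, act, pullIso_hom, pullIso_hom, pullHom_map f.comm]

/-- An isomorphism of the underlying sheaves which is compatible with the equivariant structures. -/
def isoMk {E F : VecG G X} (α : E.sheaf ≅ F.sheaf)
    (h : E.iso.hom ≫ (pullback (snd G X).left).map α.hom =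
      (pullback γ[G, X].left).map α.hom ≫ F.iso.hom) : E ≅ F where
  hom := ⟨α.hom, h⟩
  inv := ⟨α.inv, by
    rw [← cancel_mono ((pullback (snd G X).left).map α.hom), Category.assoc, Category.assoc, h,
      ← Functor.map_comp, ← Functor.map_comp_assoc, α.inv_hom_id, CategoryTheory.Functor.map_id,
      CategoryTheory.Functor.map_id, Category.comp_id, Category.id_comp]⟩
  hom_inv_id := by
    apply VecG.hom_ext
    exact α.hom_inv_id
  inv_hom_id := by
    apply VecG.hom_ext
    exact α.inv_hom_id

end act

end VecG

end EquivBundle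
end

noncomputable section

namespace EquivBundle

open Scheme.Modules

variable {S : Scheme.{u}} {G H X Z : Over S} [GrpObj G] [GrpObj H] [ModObj G X] [ModObj H Z]
  {j : H ⟶ G} {i : Z ⟶ X}

section points
variable {T T' : Over S}

lemma IsEquivariant.smul_comp (hi : IsEquivariant j i) (h : T ⟶ H) (z : T ⟶ Z) :
    (h • z) ≫ i = (h ≫ j) • (z ≫ i) := by
  rw [Hom.smul_def, Hom.smul_def, Category.assoc, hi, ← Category.assoc, lift_map]

variable (G i) in
/-- The morphism `(g, z) ↦ g • i z`. -/
abbrev orbitFamily : G ⊗ Z ⟶ X := (G ◁ i) ≫ γ[G, X]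

lemma lift_orbitFamily (g : T ⟶ G) (z : T ⟶ Z) : lift g z ≫ orbitFamily G i = g • (z ≫ i) := by
  rw [Hom.smul_def]; simp [orbitFamily]

lemma comp_orbitFamily (x : T ⟶ G ⊗ Z) :
    x ≫ orbitFamily G i = (x ≫ fst G Z) • (x ≫ snd G Z ≫ i) := by
  have h := lift_orbitFamily (i := i) (x ≫ fst G Z) (x ≫ snd G Z)
  rwa [lift_comp_fst_snd, Category.assoc] at h

lemma lift_contractedAction [IsMonHom j] (x : T ⟶ G ⊗ Z) (h : T ⟶ H) :
    lift x h ≫ contractedAction j Z =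
      lift ((x ≫ fst G Z) * (h ≫ j)) (h⁻¹ • (x ≫ snd G Z)) := by
  rw [contractedAction, comp_lift, MonObj.comp_mul, ← toUnit_comp_smul_comp, GrpObj.comp_inv]
  simp

/-- Two points `x₁`, `x₂` of `G × Z` are related by `h` if `x₂ = x₁ · h`. -/
structure IsTranslate (j : H ⟶ G) (x₁ x₂ : T ⟶ G ⊗ Z) (h : T ⟶ H) : Prop where
  mul : (x₁ ≫ fst G Z) * (h ≫ j) = x₂ ≫ fst G Z
  smul : h • (x₂ ≫ snd G Z) = x₁ ≫ snd G Z

lemma isTranslate_iff [IsMonHom j] {x₁ x₂ : T ⟶ G ⊗ Z} {h : T ⟶ H} :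
    IsTranslate j x₁ x₂ h ↔ lift x₁ h ≫ contractedAction j Z = x₂ := by
  rw [lift_contractedAction]
  constructor
  · rintro ⟨h₁, h₂⟩
    rw [h₁, ← h₂, inv_smul_smul]
    simp
  · rintro rfl
    exact ⟨by simp, by simp⟩

lemma IsTranslate.comp {x₁ x₂ : T ⟶ G ⊗ Z} {h : T ⟶ H} (hx : IsTranslate j x₁ x₂ h)
    (f : T' ⟶ T) : IsTranslate j (f ≫ x₁) (f ≫ x₂) (f ≫ h) where
  mul := by rw [Category.assoc, Category.assoc, Category.assoc, ← MonObj.comp_mul, hx.mul]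
  smul := by rw [Category.assoc, Category.assoc, toUnit_comp_smul_comp, hx.smul]

lemma IsTranslate.trans [IsMonHom j] {x₁ x₂ x₃ : T ⟶ G ⊗ Z} {h h' : T ⟶ H}
    (hx : IsTranslate j x₁ x₂ h) (hx' : IsTranslate j x₂ x₃ h') :
    IsTranslate j x₁ x₃ (h * h') where
  mul := by rw [MonObj.mul_comp, ← _root_.mul_assoc, hx.mul, hx'.mul]
  smul := by rw [mul_smul, hx'.smul, hx.smul]

lemma isTranslate_one [IsMonHom j] (x : T ⟶ G ⊗ Z) : IsTranslate j x x 1 where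
  mul := by rw [MonObj.one_comp, _root_.mul_one]
  smul := one_smul _ _

lemma IsTranslate.orbitFamily (hi : IsEquivariant j i) {x₁ x₂ : T ⟶ G ⊗ Z} {h : T ⟶ H}
    (hx : IsTranslate j x₁ x₂ h) : x₁ ≫ orbitFamily G i = x₂ ≫ orbitFamily G i := by
  rw [comp_orbitFamily, comp_orbitFamily, ← hx.mul, mul_smul, ← Category.assoc x₂,
    ← hi.smul_comp, hx.smul, Category.assoc]

end points

lemma exists_over_of_comp_eq {W P T : Over S} {q : P ⟶ W} (y : T ⟶ P) (x : T.left ⟶ P.left)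
    (h : y.left ≫ q.left = x ≫ q.left) : ∃ y' : T ⟶ P, y'.left = x ∧ y ≫ q = y' ≫ q := by
  refine ⟨Over.homMk x ?_, rfl, Over.OverMorphism.ext h⟩
  rw [← Over.w q, ← Over.w y, ← Over.w q]
  exact congrArg (· ≫ W.hom) h.symm

lemma exists_over {W P : Over S} {q : P ⟶ W} {T : Scheme.{u}} (x₁ x₂ : T ⟶ P.left)
    (h : x₁ ≫ q.left = x₂ ≫ q.left) :
    ∃ (s : T ⟶ S) (y₁ y₂ : Over.mk s ⟶ P), y₁.left = x₁ ∧ y₂.left = x₂ ∧ y₁ ≫ q = y₂ ≫ q := by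
  let y₁ : Over.mk (x₁ ≫ P.hom) ⟶ P := Over.homMk x₁ rfl
  obtain ⟨y₂, h₁, h₂⟩ := exists_over_of_comp_eq (q := q) y₁ x₂ h
  exact ⟨_, y₁, y₂, rfl, h₁, h₂⟩

namespace IsTorsor
variable [IsMonHom j] {W : Over S} {q : G ⊗ Z ⟶ W}
variable {T : Over S}

lemma exists_isTranslate (hq : IsTorsor (contractedAction j Z) q) {x₁ x₂ : T ⟶ G ⊗ Z}
    (h : x₁ ≫ q = x₂ ≫ q) :
    ∃ h : T ⟶ H, IsTranslate j x₁ x₂ h := by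
  obtain ⟨l, h₁, h₂⟩ : ∃ l : T ⟶ (G ⊗ Z) ⊗ H, l ≫ contractedAction j Z = x₂ ∧ l ≫ fst _ _ = x₁ :=
    ⟨hq.isPullback.lift x₂ x₁ h.symm, hq.isPullback.lift_fst _ _ _, hq.isPullback.lift_snd _ _ _⟩
  refine ⟨l ≫ snd _ _, isTranslate_iff.2 ?_⟩
  rw [← h₁, ← h₂, lift_comp_fst_snd]

lemma isTranslate_unique (hq : IsTorsor (contractedAction j Z) q) {x₁ x₂ : T ⟶ G ⊗ Z} {h h' : T ⟶ H}
    (hx : IsTranslate j x₁ x₂ h)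
    (hx' : IsTranslate j x₁ x₂ h') : h = h' := by
  rw [isTranslate_iff] at hx hx'
  have : lift x₁ h = lift x₁ h' :=
    hq.isPullback.hom_ext (hx.trans hx'.symm) ((lift_fst _ _).trans (lift_fst _ _).symm)
  rw [← lift_snd x₁ h, this, lift_snd]

variable (V : VecG H Z)

/-- The isomorphism between the pullbacks of `V` to two points with the same image. -/
lemma exists_transition (hq : IsTorsor (contractedAction j Z) q) {T : Scheme.{u}}
    (x₁ x₂ : T ⟶ (G ⊗ Z).left) (h : x₁ ≫ q.left = x₂ ≫ q.left) :
    ∃ φ : (pullback (x₁ ≫ (snd G Z).left)).obj V.sheaf ⟶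
        (pullback (x₂ ≫ (snd G Z).left)).obj V.sheaf,
      ∀ (s : T ⟶ S) (y₁ y₂ : Over.mk s ⟶ G ⊗ Z) (h : Over.mk s ⟶ H) (_ : IsTranslate j y₁ y₂ h)
        (e₁ : (h • (y₂ ≫ snd G Z)).left = x₁ ≫ (snd G Z).left) (_ : y₁.left = x₁)
        (e₂ : (y₂ ≫ snd G Z).left = x₂ ≫ (snd G Z).left) (_ : y₂.left = x₂),
        φ = (V.act h (y₂ ≫ snd G Z) e₁ e₂).hom := by
  obtain ⟨s, y₁, y₂, rfl, rfl, hy⟩ := exists_over x₁ x₂ h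
  obtain ⟨t, ht⟩ := hq.exists_isTranslate hy
  refine ⟨(V.act t (y₂ ≫ snd G Z) (by rw [ht.smul]; rfl) rfl).hom,
    fun s' y₁' y₂' t' ht' e₁ f₁ e₂ f₂ => ?_⟩
  obtain rfl : s' = s := by
    have h₁ := Over.w y₁
    have h₂ := Over.w y₁'
    rw [f₁] at h₂
    exact h₂.symm.trans h₁
  obtain rfl : y₁' = y₁ := Over.OverMorphism.ext f₁
  obtain rfl : y₂' = y₂ := Over.OverMorphism.ext f₂
  obtain rfl := hq.isTranslate_unique ht ht'
  rfl

/-- The descent datum on the pullback of an equivariant bundle `V` to `G × Z`. -/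
def descentDatum (hq : IsTorsor (contractedAction j Z) q) :
    DescentDatum q.left (snd G Z).left V.sheaf where
  map x₁ x₂ h := (hq.exists_transition V x₁ x₂ h).choose
  pullHom_map {T T'} g x₁ x₂ h h' := by
    obtain ⟨s, y₁, y₂, rfl, rfl, hy⟩ := exists_over x₁ x₂ h
    obtain ⟨t, ht⟩ := hq.exists_isTranslate hy
    let f : Over.mk (g ≫ s) ⟶ Over.mk s := Over.homMk g rfl
    have ht' := ht.comp f
    rw [(hq.exists_transition V y₁.left y₂.left h).choose_spec s y₁ y₂ t ht
        (by rw [ht.smul]; rfl) rfl rfl rfl,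
      (hq.exists_transition V _ _ h').choose_spec (g ≫ s) (f ≫ y₁) (f ≫ y₂) (f ≫ t) ht'
        (by rw [ht'.smul]; rfl) rfl rfl rfl]
    exact V.pullHom_act t _ f _ _ _ _ rfl (Category.assoc _ _ _).symm _ _
  map_self {T} x := by
    obtain ⟨s, y₁, -, rfl, -, -⟩ := exists_over (q := q) x x rfl
    have ht := isTranslate_one (j := j) y₁
    rw [(hq.exists_transition V y₁.left y₁.left rfl).choose_spec s y₁ y₁ 1 ht
        (by rw [ht.smul]; rfl) rfl rfl rfl, V.act_one]
    rfl
  map_comp {T} x₁ x₂ x₃ h h' := by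
    obtain ⟨s, y₁, y₂, rfl, rfl, hy⟩ := exists_over x₁ x₂ h
    obtain ⟨y₃, rfl, hy'⟩ := exists_over_of_comp_eq y₂ x₃ h'
    obtain ⟨t, ht⟩ := hq.exists_isTranslate hy
    obtain ⟨t', ht'⟩ := hq.exists_isTranslate hy'
    have ht'' := ht.trans ht'
    rw [(hq.exists_transition V _ _ h).choose_spec s y₁ y₂ t ht
        (by rw [ht.smul]; rfl) rfl rfl rfl,
      (hq.exists_transition V _ _ h').choose_spec s y₂ y₃ t' ht'
        (by rw [ht'.smul]; rfl) rfl rfl rfl,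
      (hq.exists_transition V _ _ (h.trans h')).choose_spec s y₁ y₃ (t * t') ht''
        (by rw [ht''.smul]; rfl) rfl rfl rfl]
    exact (V.act_mul t t' _ ht'.smul rfl _ _ _ _ _).symm

lemma descentDatum_map (hq : IsTorsor (contractedAction j Z) q) {T : Over S}
    (x₁ x₂ : T ⟶ G ⊗ Z) {t : T ⟶ H} (ht : IsTranslate j x₁ x₂ t)
    (h : x₁.left ≫ q.left = x₂.left ≫ q.left)
    (e₁ : (t • (x₂ ≫ snd G Z)).left = x₁.left ≫ (snd G Z).left)
    (e₂ : (x₂ ≫ snd G Z).left = x₂.left ≫ (snd G Z).left) :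
    (hq.descentDatum V).map x₁.left x₂.left h = (V.act t (x₂ ≫ snd G Z) e₁ e₂).hom :=
  (hq.exists_transition V _ _ h).choose_spec T.hom x₁ x₂ t ht e₁ rfl e₂ rfl

end IsTorsor

end EquivBundle
end

noncomputable section

namespace AlgebraicGeometry.Scheme.Modules

lemma map_pullbackId {X Y : Scheme.{u}} (f : X ⟶ Y) (h : f ≫ 𝟙 Y = f) (M : Y.Modules) :
    (pullback f).map ((pullbackId Y).hom.app M) = (compIso f h M).hom := by
  have H := NatTrans.congr_app (pseudofunctor_left_unitality f) M
  simp only [NatTrans.comp_app, Functor.whiskerRight_app, Functor.leftUnitor_hom_app,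
    eqToHom_app] at H
  have h₁ : (pullbackCongr h).hom.app M = eqToHom (by rw [h]) := by
    simp [pullbackCongr]
  have h₂ : (compIso f h M).hom = (pullbackComp f (𝟙 Y)).hom.app M ≫ (pullbackCongr h).hom.app M :=
    rfl
  have h₃ : (pullbackComp f (𝟙 Y)).hom.app M ≫ (pullbackComp f (𝟙 Y)).inv.app M = 𝟙 _ :=
    Iso.hom_inv_id_app _ _
  rw [h₂, h₁, ← H, reassoc_of% h₃]
  exact (Category.comp_id _).symm

section
variable {X₁ X₂ Z W : Scheme.{u}} {M : X₁.Modules} {N : X₂.Modules}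

lemma restrHom_pullHom {f₁ : Z ⟶ X₁} {f₂ : Z ⟶ X₂}
    (φ : (pullback f₁).obj M ⟶ (pullback f₂).obj N) {z : W ⟶ Z} {g₁ : W ⟶ X₁} {g₂ : W ⟶ X₂}
    (h₁ : z ≫ f₁ = g₁) (h₂ : z ≫ f₂ = g₂) :
    restrHom h₁ h₂ (pullHom φ z h₁ h₂) = (pullback z).map φ := by
  rw [restrHom_eq, pullHom_eq]
  simp

lemma pullHom_pullHom_eq {W' W'' : Scheme.{u}} {f₁ : W ⟶ X₁} {f₂ : W ⟶ X₂}
    (φ : (pullback f₁).obj M ⟶ (pullback f₂).obj N)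
    {g : W' ⟶ W} {g₁ : W' ⟶ X₁} {g₂ : W' ⟶ X₂} (h₁ : g ≫ f₁ = g₁) (h₂ : g ≫ f₂ = g₂)
    {g' : W'' ⟶ W'} {k₁ : W'' ⟶ X₁} {k₂ : W'' ⟶ X₂} (l₁ : g' ≫ g₁ = k₁) (l₂ : g' ≫ g₂ = k₂)
    {t : W'' ⟶ W} (ht : g' ≫ g = t) (m₁ : t ≫ f₁ = k₁) (m₂ : t ≫ f₂ = k₂) :
    pullHom (pullHom φ g h₁ h₂) g' l₁ l₂ = pullHom φ t m₁ m₂ :=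
  pullHom_pullHom φ g h₁ h₂ g' l₁ l₂ ht

lemma pullHom_inv_comp_pullHom_hom {f₁ : Z ⟶ X₁} {f₂ : Z ⟶ X₂}
    (ε : (pullback f₁).obj M ≅ (pullback f₂).obj N) {g : W ⟶ Z} {g₁ : W ⟶ X₁} {g₂ : W ⟶ X₂}
    (h₁ h₁' : g ≫ f₁ = g₁) (h₂ h₂' : g ≫ f₂ = g₂) :
    pullHom ε.inv g h₂ h₁ ≫ pullHom ε.hom g h₁' h₂' = 𝟙 _ := by
  obtain rfl : h₁ = h₁' := rfl
  obtain rfl : h₂ = h₂' := rfl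
  rw [← pullHom_comp, Iso.inv_hom_id, pullHom_id]

lemma restrHom_injective {b₁ b₂ : W ⟶ Z} {f₁ : Z ⟶ X₁} {f₂ : Z ⟶ X₂} {g₁ : W ⟶ X₁} {g₂ : W ⟶ X₂}
    (h₁ : b₁ ≫ f₁ = g₁) (h₂ : b₂ ≫ f₂ = g₂) :
    Function.Injective (restrHom h₁ h₂ (M := M) (N := N)) := fun φ ψ h => by
  rwa [restrHom_eq, restrHom_eq, cancel_epi, cancel_mono] at h

end

section
variable {S : Scheme.{u}} {P W : Over S} {q : P ⟶ W} [Flat q.left] [Surjective q.left]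
  [QuasiCompact q.left]

lemma exists_map_eq_of_over {E F : W.left.Modules} (hF : IsVectorBundle F)
    (ψ : (pullback q.left).obj E ⟶ (pullback q.left).obj F)
    (hψ : ∀ {T : Over S} (y₁ y₂ : T ⟶ P) {r : T.left ⟶ W.left} (h₁ : y₁.left ≫ q.left = r)
      (h₂ : y₂.left ≫ q.left = r), y₁ ≫ q = y₂ ≫ q →
      pullHom ψ y₁.left h₁ h₁ = pullHom ψ y₂.left h₂ h₂) :
    ∃ φ : E ⟶ F, (pullback q.left).map φ = ψ := by
  have hp := IsPullback.of_hasPullback q.left q.left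
  refine exists_map_eq_of_fpqc hF hp rfl hp.w.symm ψ ?_
  obtain ⟨s, y₁, y₂, h₁, h₂, hy⟩ := EquivBundle.exists_over (q := q) _ _ hp.w
  have := hψ y₁ y₂ rfl (EquivBundle.left_comp_left hy.symm) hy
  generalize_proofs at this ⊢
  revert this
  generalize Limits.pullback.fst q.left q.left = p₁ at *
  generalize Limits.pullback.snd q.left q.left = p₂ at *
  subst h₁ h₂
  exact id

lemma exists_pullIso_eq_of_over {X₁ X₂ : Scheme.{u}} {E : X₁.Modules} {F : X₂.Modules}
    {a : W.left ⟶ X₁} {b : W.left ⟶ X₂} {a' : P.left ⟶ X₁} {b' : P.left ⟶ X₂}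
    (hE : IsVectorBundle E) (hF : IsVectorBundle F) (h₁ : q.left ≫ a = a') (h₂ : q.left ≫ b = b')
    (ψ : (pullback a').obj E ≅ (pullback b').obj F)
    (hψ : ∀ {T : Over S} (y₁ y₂ : T ⟶ P) {a'' : T.left ⟶ X₁} {b'' : T.left ⟶ X₂}
      (k₁ : y₁.left ≫ a' = a'') (k₂ : y₁.left ≫ b' = b'') (l₁ : y₂.left ≫ a' = a'')
      (l₂ : y₂.left ≫ b' = b''), y₁ ≫ q = y₂ ≫ q →
      pullHom ψ.hom y₁.left k₁ k₂ = pullHom ψ.hom y₂.left l₁ l₂) :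
    ∃ φ : (pullback a).obj E ≅ (pullback b).obj F, pullIso φ q.left h₁ h₂ = ψ := by
  have hp := IsPullback.of_hasPullback q.left q.left
  obtain ⟨s, y₁, y₂, e₁, e₂, hy⟩ := EquivBundle.exists_over (q := q) _ _ hp.w
  have l₁ : y₂.left ≫ a' = y₁.left ≫ a' := by
    rw [← h₁, ← Category.assoc, ← Category.assoc, EquivBundle.left_comp_left hy.symm]; rfl
  have l₂ : y₂.left ≫ b' = y₁.left ≫ b' := by
    rw [← h₂, ← Category.assoc, ← Category.assoc, EquivBundle.left_comp_left hy.symm]; rfl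
  rw [← e₁, ← e₂] at hp
  exact exists_pullIso_eq_of_fpqc hE hF hp h₁ h₂ ψ rfl rfl l₁ l₂ (hψ y₁ y₂ rfl rfl l₁ l₂ hy)

end

end AlgebraicGeometry.Scheme.Modules

namespace EquivBundle

lemma isPullback_whiskerLeft {C : Type*} [Category* C] [CartesianMonoidalCategory C] (A : C)
    {P W : C} (q : P ⟶ W) : IsPullback (A ◁ q) (snd A P) (snd A W) q := by
  refine ⟨⟨by simp⟩, ⟨Limits.PullbackCone.IsLimit.mk _ (fun s => lift (s.fst ≫ fst A W) s.snd)
    (fun s => ?_) (fun s => ?_) fun s m h₁ h₂ => ?_⟩⟩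
  · apply CartesianMonoidalCategory.hom_ext
    · simp
    · simpa using s.condition.symm
  · simp
  · apply CartesianMonoidalCategory.hom_ext
    · simp [← h₁]
    · simpa using h₂

section
variable {S : Scheme.{u}} (A : Over S) {P W : Over S} (q : P ⟶ W)

lemma isPullback_whiskerLeft_left :
    IsPullback (A ◁ q).left (snd A P).left (snd A W).left q.left :=
  (isPullback_whiskerLeft A q).map (Over.forget S)

instance [Flat q.left] : Flat (A ◁ q).left :=
  MorphismProperty.of_isPullback (isPullback_whiskerLeft_left A q).flip ‹_›
instance [Surjective q.left] : Surjective (A ◁ q).left :=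
  MorphismProperty.of_isPullback (isPullback_whiskerLeft_left A q).flip ‹_›
instance [QuasiCompact q.left] : QuasiCompact (A ◁ q).left :=
  MorphismProperty.of_isPullback (isPullback_whiskerLeft_left A q).flip ‹_›

end

lemma IsTorsor.comp_isIso {S : Scheme.{u}} {P H W X : Over S} {r : P ⊗ H ⟶ P} {q : P ⟶ W}
    (hq : IsTorsor r q) (m : W ⟶ X) [IsIso m] : IsTorsor r (q ≫ m) where
  flat := by
    have := hq.flat
    have : IsIso m.left := inferInstanceAs (IsIso ((Over.forget S).map m))
    rw [Over.comp_left]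
    infer_instance
  surjective := by
    have := hq.surjective
    have : IsIso m.left := inferInstanceAs (IsIso ((Over.forget S).map m))
    rw [Over.comp_left]
    infer_instance
  quasiCompact := by
    have := hq.quasiCompact
    have : IsIso m.left := inferInstanceAs (IsIso ((Over.forget S).map m))
    rw [Over.comp_left]
    infer_instance
  isPullback := hq.isPullback.of_iso (Iso.refl _) (Iso.refl _) (Iso.refl _) (asIso m)
    (by simp) (by simp) (by simp) (by simp)

lemma locallyOfFinitePresentation_left {S : Scheme.{u}} [IsLocallyNoetherian S] {P X : Over S}
    (q : P ⟶ X) [LocallyOfFiniteType P.hom] [LocallyOfFiniteType X.hom] :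
    LocallyOfFinitePresentation q.left := by
  have := LocallyOfFiniteType.isLocallyNoetherian X.hom
  have h : LocallyOfFiniteType (q.left ≫ X.hom) := by rw [Over.w]; infer_instance
  have := locallyOfFiniteType_of_comp q.left X.hom
  infer_instance

instance {S : Scheme.{u}} (A B : Over S) [LocallyOfFiniteType A.hom] [LocallyOfFiniteType B.hom] :
    LocallyOfFiniteType (A ⊗ B).hom := by
  rw [Over.tensorObj_hom]
  infer_instance

end EquivBundle
end

noncomputable section

namespace EquivBundle

open Scheme.Modules

variable {S : Scheme.{u}} {G H X Z : Over S} [GrpObj G] [GrpObj H] [ModObj G X] [ModObj H Z]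
  {j : H ⟶ G} {i : Z ⟶ X} [IsMonHom j]

lemma VecG.pullHom_iso_hom (E : VecG G X) {T : Over S} (y : T ⟶ G ⊗ X) {g : T ⟶ G} {x : T ⟶ X}
    (l : lift g x = y) {a b : T.left ⟶ X.left} (ka : y.left ≫ γ[G, X].left = a)
    (kb : y.left ≫ (snd G X).left = b) (ha : (g • x).left = a) (hb : x.left = b) :
    pullHom E.iso.hom y.left ka kb = (E.act g x ha hb).hom := by
  subst l
  rw [VecG.act, pullIso_hom]

namespace IsEquivariant
variable (hi : IsEquivariant j i) {T T' : Over S}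

lemma restrict_act_hom (E : VecG G X) (h : T ⟶ H) (z : T ⟶ Z) {a b : T.left ⟶ Z.left}
    {a' b' : T.left ⟶ X.left} (ha : (h • z).left = a) (hb : z.left = b)
    (ha' : ((h ≫ j) • (z ≫ i)).left = a') (hb' : (z ≫ i).left = b') (ka : a ≫ i.left = a')
    (kb : b ≫ i.left = b') : ((hi.restrict.obj E).act h z ha hb).hom =
      restrHom ka kb (E.act (h ≫ j) (z ≫ i) ha' hb').hom := by
  have e : (lift h z).left ≫ (j ⊗ₘ i).left = (lift (h ≫ j) (z ≫ i)).left :=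
    left_comp_left (lift_map _ _ _ _)
  rw [VecG.act, pullIso_hom, VecG.act, pullIso_hom]
  change pullHom (restrHom hi.left_smul (left_snd j i) (pullHom E.iso.hom (j ⊗ₘ i).left rfl rfl))
    _ _ _ = _
  rw [pullHom_restrHom (l₁ := ka) (l₂ := kb), pullHom_pullHom (ht := e)]

variable {hi} {E F : VecG G X}

/-- The map of sheaves underlying a morphism between restrictions. -/
abbrev homOfRestrict (f : hi.restrict.obj E ⟶ hi.restrict.obj F) :
    (pullback i.left).obj E.sheaf ⟶ (pullback i.left).obj F.sheaf := f.hom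

lemma act_comp_pullHom (f : hi.restrict.obj E ⟶ hi.restrict.obj F) (h : T ⟶ H) {g : T ⟶ G}
    (hg : h ≫ j = g) {z z' : T ⟶ Z} (hz : h • z = z') {x : T ⟶ X} (hx : z ≫ i = x)
    {a b : T.left ⟶ X.left} (ha : (g • x).left = a) (hb : x.left = b)
    (ka : z'.left ≫ i.left = a) (kb : z.left ≫ i.left = b) :
    (E.act g x ha hb).hom ≫ pullHom (homOfRestrict f) z.left kb kb =
      pullHom (homOfRestrict f) z'.left ka ka ≫ (F.act g x ha hb).hom := by
  subst hg hx hz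
  have key := VecG.act_map h z f rfl rfl
  rw [hi.restrict_act_hom E h z rfl rfl ha hb ka kb,
    hi.restrict_act_hom F h z rfl rfl ha hb ka kb] at key
  have h₁ := restrHom_pullHom (homOfRestrict f) kb kb
  have h₂ := restrHom_pullHom (homOfRestrict f) ka ka
  apply restrHom_injective ka kb
  rw [restrHom_comp _ kb, restrHom_comp _ ka, h₁, h₂]
  exact key

end IsEquivariant

section translate
variable {E F : VecG G X} {T T' : Over S}

/-- The conjugate `(g • x)^* E ⟶ (g • x)^* F` of the pullback of `f : i^* E ⟶ i^* F` to a point `z`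
with image `x` in `X` by the action of `g`. -/
def translate (f : (pullback i.left).obj E.sheaf ⟶ (pullback i.left).obj F.sheaf) (g : T ⟶ G)
    (z : T ⟶ Z) (x : T ⟶ X) {a b : T.left ⟶ X.left} (ha : (g • x).left = a) (hb : x.left = b)
    (kb : z.left ≫ i.left = b) : (pullback a).obj E.sheaf ⟶ (pullback a).obj F.sheaf :=
  (E.act g x ha hb).hom ≫ pullHom f z.left kb kb ≫ (F.act g x ha hb).inv

section
variable (f : (pullback i.left).obj E.sheaf ⟶ (pullback i.left).obj F.sheaf) (g : T ⟶ G)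
  (z : T ⟶ Z) (x : T ⟶ X) {a b : T.left ⟶ X.left}

lemma pullHom_translate (y : T' ⟶ T) (ha : (g • x).left = a) (hb : x.left = b)
    (kb : z.left ≫ i.left = b) {a' b' : T'.left ⟶ X.left} (ka : y.left ≫ a = a')
    {g' : T' ⟶ G} (hg : y ≫ g = g') {z' : T' ⟶ Z} (hz : y ≫ z = z')
    {x' : T' ⟶ X} (hx : y ≫ x = x') (ha' : (g' • x').left = a') (hb' : x'.left = b')
    (kb' : z'.left ≫ i.left = b') :
    pullHom (translate f g z x ha hb kb) y.left ka ka = translate f g' z' x' ha' hb' kb' := by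
  have hbb : y.left ≫ b = b' := by rw [← hb, ← hb', left_comp_left hx]
  rw [translate, translate, pullHom_comp _ _ _ ka hbb ka, pullHom_comp _ _ _ hbb hbb ka,
    E.pullHom_act g _ y ha hb ka hbb hg hx ha' hb',
    F.pullHom_act_inv g _ y ha hb ka hbb hg hx ha' hb',
    pullHom_pullHom_eq f kb kb hbb hbb (left_comp_left hz) kb' kb']

lemma translate_one (ha : ((1 : T ⟶ G) • x).left = a) (hb : x.left = a)
    (ka : z.left ≫ i.left = a) : translate f 1 z x ha hb ka = pullHom f z.left ka ka := by
  rw [translate, VecG.act_one, VecG.act_one, Iso.refl_hom, Iso.refl_inv, Category.id_comp,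
    Category.comp_id]

lemma act_comp_translate (g' : T ⟶ G) {x' : T ⟶ X} (hx' : g' • x = x')
    {c : T.left ⟶ X.left} {g'' : T ⟶ G} (hg : g * g' = g'') (ha : (g • x').left = a)
    (hb : x'.left = b) (ha' : (g'' • x).left = a) (hb' : (g' • x).left = b) (hc : x.left = c)
    (kc : z.left ≫ i.left = c) :
    (E.act g x' ha hb).hom ≫ translate f g' z x hb' hc kc =
      translate f g'' z x ha' hc kc ≫ (F.act g x' ha hb).hom := by
  have hF : F.act g'' x ha' hc = F.act g x' ha hb ≪≫ F.act g' x hb' hc :=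
    Iso.ext (F.act_mul g g' x hx' hg ha' ha hb hb' hc)
  rw [translate, translate, E.act_mul g g' _ hx' hg ha' ha hb hb' hc, hF, Iso.trans_inv]
  simp only [Category.assoc, Iso.inv_hom_id, Category.comp_id]

lemma translate_eq_of_smul_eq {g₁ g₂ : T ⟶ G} (t : T ⟶ G) {z₁ z₂ : T ⟶ Z} {y₁ y₂ : T ⟶ X}
    {b c : T.left ⟶ X.left} (hg : g₁ * t = g₂) (hy : t • y₂ = y₁) (h₁ : (g₁ • y₁).left = a)
    (h₂ : (g₂ • y₂).left = a) (hb : y₁.left = b) (hb' : (t • y₂).left = b) (hc : y₂.left = c)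
    (kb : z₁.left ≫ i.left = b) (kc : z₂.left ≫ i.left = c)
    (hf : (E.act t y₂ hb' hc).hom ≫ pullHom f z₂.left kc kc =
      pullHom f z₁.left kb kb ≫ (F.act t y₂ hb' hc).hom) :
    translate f g₁ z₁ y₁ h₁ hb kb = translate f g₂ z₂ y₂ h₂ hc kc := by
  have hF : F.act g₂ y₂ h₂ hc = F.act g₁ y₁ h₁ hb ≪≫ F.act t y₂ hb' hc :=
    Iso.ext (F.act_mul g₁ t y₂ hy hg h₂ h₁ hb hb' hc)
  rw [translate, translate, E.act_mul g₁ t y₂ hy hg h₂ h₁ hb hb' hc, hF,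
    Iso.trans_inv, Category.assoc, reassoc_of% hf, Iso.hom_inv_id_assoc]

end

end translate

section
variable (hi : IsEquivariant j i)

lemma restrict_faithful [Flat (orbitFamily G i).left] [Surjective (orbitFamily G i).left]
    [QuasiCompact (orbitFamily G i).left] : hi.restrict.Faithful where
  map_injective {E F φ ψ} h := by
    apply VecG.hom_ext
    apply map_injective_of_fpqc (q := (orbitFamily G i).left) F.isVectorBundle
    have h' : (pullback i.left).map φ.hom = (pullback i.left).map ψ.hom :=
      congrArg VecG.Hom.hom h
    have e : (fst G Z • (snd G Z ≫ i)).left = (orbitFamily G i).left := by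
      rw [← lift_orbitFamily, lift_fst_snd, Category.id_comp]
    have e₁ := pullHom_map_eq (g := (snd G Z).left) (k := (snd G Z ≫ i).left) rfl φ.hom
    have e₂ := pullHom_map_eq (g := (snd G Z).left) (k := (snd G Z ≫ i).left) rfl ψ.hom
    have h₁ := VecG.act_map (fst G Z) (snd G Z ≫ i) φ e rfl
    have h₂ := VecG.act_map (fst G Z) (snd G Z ≫ i) ψ e rfl
    rw [← e₁, h', e₂, h₂, cancel_mono] at h₁
    exact h₁.symm

lemma restrict_full (hq : IsTorsor (contractedAction j Z) (orbitFamily G i)) :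
    hi.restrict.Full where
  map_surjective {E F} f := by
    have := hq.flat
    have := hq.surjective
    have := hq.quasiCompact
    have e : (fst G Z • (snd G Z ≫ i)).left = (orbitFamily G i).left := by
      rw [← lift_orbitFamily, lift_fst_snd, Category.id_comp]
    let f' := IsEquivariant.homOfRestrict f
    obtain ⟨b₀, hb₀⟩ : ∃ b, (snd G Z ≫ i).left = b := ⟨_, rfl⟩
    obtain ⟨φ, hφ⟩ := exists_map_eq_of_over F.isVectorBundle
      (translate f' (fst G Z) (snd G Z) _ e hb₀ hb₀) (fun y₁ y₂ r h₁ h₂ hy => by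
        obtain ⟨t, ht⟩ := hq.exists_isTranslate hy
        have k₁ : ((y₁ ≫ fst G Z) • ((y₁ ≫ snd G Z) ≫ i)).left = r := by
          rw [Category.assoc, ← comp_orbitFamily]; exact h₁
        have k₂ : ((y₂ ≫ fst G Z) • ((y₂ ≫ snd G Z) ≫ i)).left = r := by
          rw [Category.assoc, ← comp_orbitFamily]; exact h₂
        have e₂ : (t ≫ j) • ((y₂ ≫ snd G Z) ≫ i) = (y₁ ≫ snd G Z) ≫ i := by
          rw [← hi.smul_comp, ht.smul]
        obtain ⟨b, hb⟩ : ∃ b, ((y₁ ≫ snd G Z) ≫ i).left = b := ⟨_, rfl⟩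
        obtain ⟨c, hc⟩ : ∃ c, ((y₂ ≫ snd G Z) ≫ i).left = c := ⟨_, rfl⟩
        have hb' : ((t ≫ j) • ((y₂ ≫ snd G Z) ≫ i)).left = b := by rw [e₂, hb]
        rw [pullHom_translate f' _ _ _ y₁ e hb₀ hb₀ h₁ rfl rfl (Category.assoc _ _ _).symm k₁ hb hb,
          pullHom_translate f' _ _ _ y₂ e hb₀ hb₀ h₂ rfl rfl (Category.assoc _ _ _).symm k₂ hc hc]
        exact translate_eq_of_smul_eq f' (t ≫ j) ht.mul e₂ k₁ k₂ hb hb' hc hb hc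
          (IsEquivariant.act_comp_pullHom f t rfl ht.smul rfl hb' hc hb hc))
    have key {T : Over S} (g : T ⟶ G) (z : T ⟶ Z) {x : T ⟶ X} (hx : z ≫ i = x)
        {a b : T.left ⟶ X.left} (ha : (g • x).left = a) (hb : x.left = b)
        (kb : z.left ≫ i.left = b) : (pullback a).map φ = translate f' g z x ha hb kb := by
      have h : (lift g z).left ≫ (orbitFamily G i).left = a :=
        (left_comp_left (lift_orbitFamily g z)).trans (by rw [hx, ha])
      rw [← pullHom_map_eq h φ, hφ, pullHom_translate f' _ _ _ (lift g z) e hb₀ hb₀ h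
        (lift_fst _ _) (lift_snd _ _) (by rw [lift_snd_assoc, hx]) ha hb kb]
    refine ⟨⟨φ, ?_⟩, ?_⟩
    · obtain ⟨g, hg⟩ : ∃ g, g = fst G (G ⊗ Z) := ⟨_, rfl⟩
      obtain ⟨g', hg'⟩ : ∃ g, g = snd G (G ⊗ Z) ≫ fst G Z := ⟨_, rfl⟩
      obtain ⟨z, hz⟩ : ∃ z, z = snd G (G ⊗ Z) ≫ snd G Z := ⟨_, rfl⟩
      obtain ⟨x, hx⟩ : ∃ x, z ≫ i = x := ⟨_, rfl⟩
      obtain ⟨x', hx'⟩ : ∃ x', g' • x = x' := ⟨_, rfl⟩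
      obtain ⟨a, hc⟩ : ∃ a, (g • x').left = a := ⟨_, rfl⟩
      obtain ⟨b, hb⟩ : ∃ b, x'.left = b := ⟨_, rfl⟩
      obtain ⟨c, hcx⟩ : ∃ c, x.left = c := ⟨_, rfl⟩
      have kc : z.left ≫ i.left = c := by rw [left_comp_left hx, hcx]
      have l : lift g x' = G ◁ orbitFamily G i := by
        rw [← hx', ← hx, ← lift_orbitFamily, hg', hz, ← comp_lift, lift_fst_snd,
          Category.comp_id, hg]
        apply CartesianMonoidalCategory.hom_ext <;> simp
      have ka : (G ◁ orbitFamily G i).left ≫ γ[G, X].left = a := by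
        rw [← hc]
        exact left_comp_left (by rw [← l, ← Hom.smul_def _ g x'])
      have kb : (G ◁ orbitFamily G i).left ≫ (snd G X).left = b := by
        rw [← hb]
        exact left_comp_left (by rw [← l, lift_snd])
      have ha : ((g * g') • x).left = a := by rw [← hc, ← hx', mul_smul]
      have hb' : (g' • x).left = b := by rw [hx', hb]
      apply pullHom_injective_of_fpqc (q := (G ◁ orbitFamily G i).left)
        (F.isVectorBundle) ka kb
      rw [pullHom_comp _ _ _ ka kb kb, pullHom_comp _ _ _ ka ka kb, pullHom_map_eq, pullHom_map_eq,
        E.pullHom_iso_hom _ l ka kb hc hb, F.pullHom_iso_hom _ l ka kb hc hb,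
        key g' z hx hb' hcx kc, key (g * g') z hx ha hcx kc]
      exact act_comp_translate f' g z x g' hx' rfl hc hb ha hb' hcx kc
    · apply VecG.hom_ext
      have ha : ((1 : Z ⟶ G) • i).left = i.left := by rw [one_smul]
      have h₁ := key 1 (𝟙 Z) (Category.id_comp i) ha rfl (Category.id_comp _)
      rw [translate_one f' (𝟙 Z) i ha rfl (Category.id_comp _)] at h₁
      exact h₁.trans (pullHom_self _ _ _)

end

end EquivBundle
end

noncomputable section

namespace EquivBundle

open Scheme.Modules

variable {S : Scheme.{u}} {G H X Z : Over S} [GrpObj G] [GrpObj H] [ModObj G X] [ModObj H Z]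
  {j : H ⟶ G} {i : Z ⟶ X}

section leftMul
variable {T T' : Over S}

/-- Left multiplication `g · (g', z) = (g * g', z)` on points of `G × Z`. -/
def leftMul (g : T ⟶ G) (x : T ⟶ G ⊗ Z) : T ⟶ G ⊗ Z := lift (g * (x ≫ fst G Z)) (x ≫ snd G Z)

@[simp] lemma leftMul_fst (g : T ⟶ G) (x : T ⟶ G ⊗ Z) :
    leftMul g x ≫ fst G Z = g * (x ≫ fst G Z) := lift_fst _ _

@[simp] lemma leftMul_snd (g : T ⟶ G) (x : T ⟶ G ⊗ Z) : leftMul g x ≫ snd G Z = x ≫ snd G Z :=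
  lift_snd _ _

lemma comp_leftMul (y : T' ⟶ T) (g : T ⟶ G) (x : T ⟶ G ⊗ Z) :
    y ≫ leftMul g x = leftMul (y ≫ g) (y ≫ x) := by
  rw [leftMul, leftMul, comp_lift, MonObj.comp_mul, Category.assoc, Category.assoc]

lemma leftMul_orbitFamily (g : T ⟶ G) (x : T ⟶ G ⊗ Z) :
    leftMul g x ≫ orbitFamily G i = g • (x ≫ orbitFamily G i) := by
  rw [comp_orbitFamily, comp_orbitFamily, leftMul_fst, ← Category.assoc, leftMul_snd, mul_smul,
    Category.assoc]

lemma leftMul_leftMul (g g' : T ⟶ G) (x : T ⟶ G ⊗ Z) :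
    leftMul g (leftMul g' x) = leftMul (g * g') x := by
  rw [leftMul, leftMul_fst, leftMul_snd, leftMul, _root_.mul_assoc]

lemma IsTranslate.leftMul {x₁ x₂ : T ⟶ G ⊗ Z} {t : T ⟶ H} (ht : IsTranslate j x₁ x₂ t)
    (g : T ⟶ G) : IsTranslate j (leftMul g x₁) (leftMul g x₂) t where
  mul := by rw [leftMul_fst, leftMul_fst, _root_.mul_assoc, ht.mul]
  smul := by rw [leftMul_snd, leftMul_snd, ht.smul]

end leftMul

section leftTranslate
variable {V : Z.left.Modules} {E : X.left.Modules} {T T' : Over S}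

/-- The isomorphism `(g • q x)^* E ≅ (q x)^* E` induced by an isomorphism `q^* E ≅ p^* V`, where
`q : G × Z ⟶ X` is the orbit map and `p` is the projection to `Z`. -/
def leftTranslate (ε : (pullback (orbitFamily G i).left).obj E ≅ (pullback (snd G Z).left).obj V)
    (g : T ⟶ G) (x : T ⟶ G ⊗ Z) {a b : T.left ⟶ X.left} {c : T.left ⟶ Z.left}
    (ha : (leftMul g x).left ≫ (orbitFamily G i).left = a)
    (hb : x.left ≫ (orbitFamily G i).left = b) (hc : (leftMul g x).left ≫ (snd G Z).left = c)
    (hc' : x.left ≫ (snd G Z).left = c) : (pullback a).obj E ≅ (pullback b).obj E :=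
  pullIso ε (leftMul g x).left ha hc ≪≫ (pullIso ε x.left hb hc').symm

variable (ε : (pullback (orbitFamily G i).left).obj E ≅ (pullback (snd G Z).left).obj V)
  {a b d : T.left ⟶ X.left} {c : T.left ⟶ Z.left}

lemma leftTranslate_hom (g : T ⟶ G) (x : T ⟶ G ⊗ Z)
    (ha : (leftMul g x).left ≫ (orbitFamily G i).left = a)
    (hb : x.left ≫ (orbitFamily G i).left = b) (hc : (leftMul g x).left ≫ (snd G Z).left = c)
    (hc' : x.left ≫ (snd G Z).left = c) : (leftTranslate ε g x ha hb hc hc').hom =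
      pullHom ε.hom (leftMul g x).left ha hc ≫ pullHom ε.inv x.left hc' hb := by
  rw [leftTranslate, Iso.trans_hom, Iso.symm_hom, pullIso_hom, pullIso_inv]

attribute [irreducible] leftTranslate

lemma pullHom_leftTranslate (g : T ⟶ G) (x : T ⟶ G ⊗ Z) (y : T' ⟶ T)
    (ha : (leftMul g x).left ≫ (orbitFamily G i).left = a)
    (hb : x.left ≫ (orbitFamily G i).left = b) (hc : (leftMul g x).left ≫ (snd G Z).left = c)
    (hc' : x.left ≫ (snd G Z).left = c) {a' b' : T'.left ⟶ X.left} {c' : T'.left ⟶ Z.left}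
    {g' : T' ⟶ G} {x' : T' ⟶ G ⊗ Z} (hg : y ≫ g = g') (hx : y ≫ x = x')
    (ka : y.left ≫ a = a') (kb : y.left ≫ b = b')
    (ha' : (leftMul g' x').left ≫ (orbitFamily G i).left = a')
    (hb' : x'.left ≫ (orbitFamily G i).left = b')
    (kc : (leftMul g' x').left ≫ (snd G Z).left = c')
    (kc' : x'.left ≫ (snd G Z).left = c') :
    pullHom (leftTranslate ε g x ha hb hc hc').hom y.left ka kb =
      (leftTranslate ε g' x' ha' hb' kc kc').hom := by
  have hy : y ≫ leftMul g x = leftMul g' x' := by rw [comp_leftMul, hg, hx]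
  have hyc : y.left ≫ c = c' := by rw [← hc', ← kc', ← Category.assoc, left_comp_left hx]
  rw [leftTranslate_hom, leftTranslate_hom, pullHom_comp _ _ _ ka hyc kb,
    pullHom_pullHom_eq ε.hom ha hc ka hyc (left_comp_left hy) ha' kc,
    pullHom_pullHom_eq ε.inv hc' hb hyc kb (left_comp_left hx) kc' hb']

lemma leftTranslate_mul (g g' : T ⟶ G) (x : T ⟶ G ⊗ Z) {g'' : T ⟶ G} {x' : T ⟶ G ⊗ Z}
    (hg : g * g' = g'') (hx : leftMul g' x = x')
    (ha : (leftMul g'' x).left ≫ (orbitFamily G i).left = a)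
    (ha' : (leftMul g x').left ≫ (orbitFamily G i).left = a)
    (hb : x'.left ≫ (orbitFamily G i).left = b)
    (hb' : (leftMul g' x).left ≫ (orbitFamily G i).left = b)
    (hd : x.left ≫ (orbitFamily G i).left = d)
    (h₁ : (leftMul g'' x).left ≫ (snd G Z).left = c)
    (h₂ : (leftMul g x').left ≫ (snd G Z).left = c)
    (h₃ : x'.left ≫ (snd G Z).left = c)
    (h₄ : (leftMul g' x).left ≫ (snd G Z).left = c)
    (h₅ : x.left ≫ (snd G Z).left = c) :
    (leftTranslate ε g'' x ha hd h₁ h₅).hom =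
      (leftTranslate ε g x' ha' hb h₂ h₃).hom ≫ (leftTranslate ε g' x hb' hd h₄ h₅).hom := by
  have e : leftMul g x' = leftMul g'' x := by rw [← hx, leftMul_leftMul, hg]
  subst hx
  rw [leftTranslate_hom, leftTranslate_hom, leftTranslate_hom]
  have h : pullHom ε.inv (leftMul g' x).left h₃ hb ≫ pullHom ε.hom (leftMul g' x).left hb' h₄ =
    𝟙 _ := pullHom_inv_comp_pullHom_hom ε hb hb' h₃ h₄
  have h' : pullHom ε.hom (leftMul g (leftMul g' x)).left ha' h₂ =
      pullHom ε.hom (leftMul g'' x).left ha h₁ := by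
    generalize leftMul g (leftMul g' x) = y at *
    subst e
    rfl
  rw [Category.assoc, reassoc_of% h, h']

end leftTranslate

section
variable {T : Over S} (V : VecG H Z) {E : X.left.Modules}
  {ε : (pullback (orbitFamily G i).left).obj E ≅ (pullback (snd G Z).left).obj V.sheaf}

variable (j ε) in
/-- An isomorphism `q^* E ≅ p^* V` identifies the canonical descent datum on `q^* E` with the
descent datum on `p^* V` given by the equivariant structure on `V`. -/
def IsDescended : Prop := ∀ ⦃T : Over S⦄ ⦃x₁ x₂ : T ⟶ G ⊗ Z⦄ ⦃t : T ⟶ H⦄,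
  IsTranslate j x₁ x₂ t → ∀ ⦃z : T ⟶ Z⦄, x₂ ≫ snd G Z = z →
    ∀ ⦃a : T.left ⟶ X.left⦄ ⦃b c : T.left ⟶ Z.left⦄ (h₁ : x₁.left ≫ (orbitFamily G i).left = a)
      (h₂ : x₂.left ≫ (orbitFamily G i).left = a) (k₁ : x₁.left ≫ (snd G Z).left = b)
      (k₂ : x₂.left ≫ (snd G Z).left = c) (hb : (t • z).left = b) (hc : z.left = c),
      pullHom ε.hom x₁.left h₁ k₁ ≫ (V.act t z hb hc).hom = pullHom ε.hom x₂.left h₂ k₂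

variable {V}

lemma IsDescended.leftTranslate_eq (hε : IsDescended j V ε) {g : T ⟶ G} {x₁ x₂ : T ⟶ G ⊗ Z}
    {t : T ⟶ H} (ht : IsTranslate j x₁ x₂ t) {a b : T.left ⟶ X.left} {c d : T.left ⟶ Z.left}
    (ha : (leftMul g x₁).left ≫ (orbitFamily G i).left = a)
    (hb : x₁.left ≫ (orbitFamily G i).left = b)
    (hc : (leftMul g x₁).left ≫ (snd G Z).left = c)
    (hc' : x₁.left ≫ (snd G Z).left = c)
    (ka : (leftMul g x₂).left ≫ (orbitFamily G i).left = a)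
    (kb : x₂.left ≫ (orbitFamily G i).left = b)
    (hd : (leftMul g x₂).left ≫ (snd G Z).left = d)
    (hd' : x₂.left ≫ (snd G Z).left = d) :
    (leftTranslate ε g x₁ ha hb hc hc').hom = (leftTranslate ε g x₂ ka kb hd hd').hom := by
  have e₁ : (t • (x₂ ≫ snd G Z)).left = c := by rw [ht.smul, ← hc']; rfl
  have h₁ := hε ht rfl hb kb hc' hd' e₁ hd'
  have h₂ := hε (ht.leftMul g) (leftMul_snd g x₂) ha ka hc hd e₁ hd'
  have h₃ : (V.act t (x₂ ≫ snd G Z) e₁ hd').hom ≫ pullHom ε.inv x₂.left hd' kb =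
      pullHom ε.inv x₁.left hc' hb := by
    rw [← pullIso_hom, ← pullIso_hom, ← Iso.eq_inv_comp, ← Iso.comp_inv_eq, pullIso_inv,
      pullIso_inv] at h₁
    exact h₁
  rw [leftTranslate_hom, leftTranslate_hom, ← h₂, Category.assoc, h₃]

end

end EquivBundle
end

noncomputable section

namespace EquivBundle

open Scheme.Modules

variable {S : Scheme.{u}} {G H X Z : Over S} [GrpObj G] [GrpObj H] [ModObj G X] [ModObj H Z]
  {j : H ⟶ G} {i : Z ⟶ X} [IsMonHom j]

lemma lift_whiskerLeft_orbitFamily {T : Over S} (g : T ⟶ G) (x : T ⟶ G ⊗ Z) {y : T ⟶ X}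
    (hy : x ≫ orbitFamily G i = y) : lift g x ≫ G ◁ orbitFamily G i = lift g y := by
  rw [← hy]
  exact lift_whiskerLeft _ _ _

section
variable {V : VecG H Z} {E : X.left.Modules}
  {ε : (pullback (orbitFamily G i).left).obj E ≅ (pullback (snd G Z).left).obj V.sheaf}

/-- The equivariant structure on a bundle `E` whose pullback along the orbit map `q : G × Z ⟶ X` is
identified with the pullback of `V` along the projection `G × Z ⟶ Z`. -/
lemma IsDescended.exists_iso (hq : IsTorsor (contractedAction j Z) (orbitFamily G i))
    (hε : IsDescended j V ε) (hE : IsVectorBundle E) :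
    ∃ φ : (pullback γ[G, X].left).obj E ≅ (pullback (snd G X).left).obj E,
      ∀ ⦃T : Over S⦄ (g : T ⟶ G) (x : T ⟶ G ⊗ Z) ⦃l : T ⟶ G ⊗ X⦄
        (_ : lift g x ≫ G ◁ orbitFamily G i = l) ⦃a b : T.left ⟶ X.left⦄ ⦃c : T.left ⟶ Z.left⦄
        (ha : (leftMul g x).left ≫ (orbitFamily G i).left = a)
        (hb : x.left ≫ (orbitFamily G i).left = b)
        (hc : (leftMul g x).left ≫ (snd G Z).left = c) (hc' : x.left ≫ (snd G Z).left = c)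
        (ka : l.left ≫ γ[G, X].left = a) (kb : l.left ≫ (snd G X).left = b),
        pullHom φ.hom l.left ka kb = (leftTranslate ε g x ha hb hc hc').hom := by
  have := hq.flat
  have := hq.surjective
  have := hq.quasiCompact
  obtain ⟨g₀, hg₀⟩ : ∃ g, fst G (G ⊗ Z) = g := ⟨_, rfl⟩
  obtain ⟨x₀, hx₀⟩ : ∃ x, snd G (G ⊗ Z) = x := ⟨_, rfl⟩
  obtain ⟨a₀, ha₀⟩ : ∃ a, (leftMul g₀ x₀).left ≫ (orbitFamily G i).left = a := ⟨_, rfl⟩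
  obtain ⟨b₀, hb₀⟩ : ∃ b, x₀.left ≫ (orbitFamily G i).left = b := ⟨_, rfl⟩
  obtain ⟨c₀, hc₀⟩ : ∃ c, x₀.left ≫ (snd G Z).left = c := ⟨_, rfl⟩
  have kc₀ : (leftMul g₀ x₀).left ≫ (snd G Z).left = c₀ := by
    rw [← hc₀, left_comp_left (leftMul_snd g₀ x₀)]; rfl
  have l₀ : G ◁ orbitFamily G i = lift g₀ (x₀ ≫ orbitFamily G i) := by
    rw [← lift_whiskerLeft_orbitFamily g₀ x₀ rfl, ← hg₀, ← hx₀, lift_fst_snd, Category.id_comp]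
  have ka₀ : (G ◁ orbitFamily G i).left ≫ γ[G, X].left = a₀ := by
    rw [← ha₀, left_comp_left (leftMul_orbitFamily g₀ x₀)]
    exact left_comp_left (by rw [l₀, ← Hom.smul_def _ g₀])
  have kb₀ : (G ◁ orbitFamily G i).left ≫ (snd G X).left = b₀ := by
    rw [← hb₀]
    exact left_comp_left (c := x₀ ≫ orbitFamily G i) (by rw [l₀, lift_snd])
  obtain ⟨φ, hφ⟩ := exists_pullIso_eq_of_over (q := G ◁ orbitFamily G i) hE hE ka₀ kb₀
    (leftTranslate ε g₀ x₀ ha₀ hb₀ kc₀ hc₀) (fun {T} y₁ y₂ a b k₁ k₂ l₁ l₂ hy => by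
      have hg : y₁ ≫ g₀ = y₂ ≫ g₀ := by
        have := congrArg (· ≫ fst G X) hy
        simpa [hg₀] using this
      have hx : (y₁ ≫ x₀) ≫ orbitFamily G i = (y₂ ≫ x₀) ≫ orbitFamily G i := by
        have := congrArg (· ≫ snd G X) hy
        simpa only [Category.assoc, whiskerLeft_snd, hx₀] using this
      obtain ⟨t, ht⟩ := hq.exists_isTranslate hx
      obtain ⟨g, hg₁⟩ : ∃ g, y₁ ≫ g₀ = g := ⟨_, rfl⟩
      obtain ⟨x₁, hx₁⟩ : ∃ x, y₁ ≫ x₀ = x := ⟨_, rfl⟩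
      obtain ⟨x₂, hx₂⟩ : ∃ x, y₂ ≫ x₀ = x := ⟨_, rfl⟩
      rw [hg₁] at hg
      rw [hx₁, hx₂] at ht
      obtain ⟨c, hc⟩ : ∃ c, x₁.left ≫ (snd G Z).left = c := ⟨_, rfl⟩
      obtain ⟨d, hd⟩ : ∃ c, x₂.left ≫ (snd G Z).left = c := ⟨_, rfl⟩
      have kc : (leftMul g x₁).left ≫ (snd G Z).left = c := by
        rw [← hc, left_comp_left (leftMul_snd g x₁)]; rfl
      have kd : (leftMul g x₂).left ≫ (snd G Z).left = d := by
        rw [← hd, left_comp_left (leftMul_snd g x₂)]; rfl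
      have e₁ : y₁ ≫ leftMul g₀ x₀ = leftMul g x₁ := by rw [comp_leftMul, hg₁, hx₁]
      have e₂ : y₂ ≫ leftMul g₀ x₀ = leftMul g x₂ := by rw [comp_leftMul, ← hg, hx₂]
      have m₁ : (leftMul g x₁).left ≫ (orbitFamily G i).left = a := by
        rw [← left_comp_left e₁, Category.assoc, ha₀, k₁]
      have m₂ : (leftMul g x₂).left ≫ (orbitFamily G i).left = a := by
        rw [← left_comp_left e₂, Category.assoc, ha₀, l₁]
      have n₁ : x₁.left ≫ (orbitFamily G i).left = b := by
        rw [← left_comp_left hx₁, Category.assoc, hb₀, k₂]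
      have n₂ : x₂.left ≫ (orbitFamily G i).left = b := by
        rw [← left_comp_left hx₂, Category.assoc, hb₀, l₂]
      rw [pullHom_leftTranslate ε g₀ x₀ y₁ ha₀ hb₀ kc₀ hc₀ hg₁ hx₁ k₁ k₂ m₁ n₁ kc hc,
        pullHom_leftTranslate ε g₀ x₀ y₂ ha₀ hb₀ kc₀ hc₀ hg.symm hx₂ l₁ l₂ m₂ n₂ kd hd]
      exact hε.leftTranslate_eq ht m₁ n₁ kc hc m₂ n₂ kd hd)
  refine ⟨φ, fun T g x l hl a b c ha hb hc hc' ka kb => ?_⟩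
  have ma : (lift g x).left ≫ a₀ = a := by
    rw [← ka₀, ← ka, ← left_comp_left hl, Category.assoc]
  have mb : (lift g x).left ≫ b₀ = b := by
    rw [← kb₀, ← kb, ← left_comp_left hl, Category.assoc]
  have h₁ := pullHom_pullHom_eq φ.hom ka₀ kb₀ ma mb (left_comp_left hl) ka kb
  rw [← h₁, ← pullIso_hom, hφ]
  exact pullHom_leftTranslate ε g₀ x₀ (lift g x) ha₀ hb₀ kc₀ hc₀ (by rw [← hg₀, lift_fst])
    (by rw [← hx₀, lift_snd]) ma mb ha hb hc hc'

/-- The `G`-equivariant bundle on `X` descended from an `H`-equivariant bundle `V` on `Z`. -/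
lemma IsDescended.exists_vecG (hq : IsTorsor (contractedAction j Z) (orbitFamily G i))
    (hε : IsDescended j V ε) (hE : IsVectorBundle E) :
    ∃ (F : VecG G X)
      (δ : (pullback (orbitFamily G i).left).obj F.sheaf ≅ (pullback (snd G Z).left).obj V.sheaf),
      IsDescended j V δ ∧
      ∀ ⦃T : Over S⦄ (g : T ⟶ G) (x : T ⟶ G ⊗ Z) ⦃y : T ⟶ X⦄ (_ : x ≫ orbitFamily G i = y)
        ⦃a b : T.left ⟶ X.left⦄ ⦃c : T.left ⟶ Z.left⦄
        (ha : (leftMul g x).left ≫ (orbitFamily G i).left = a)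
        (hb : x.left ≫ (orbitFamily G i).left = b)
        (hc : (leftMul g x).left ≫ (snd G Z).left = c) (hc' : x.left ≫ (snd G Z).left = c)
        (ka : (g • y).left = a) (kb : y.left = b),
        (F.act g y ka kb).hom = (leftTranslate δ g x ha hb hc hc').hom := by
  have := hq.flat
  have := hq.surjective
  have := hq.quasiCompact
  obtain ⟨φ, hφ⟩ := hε.exists_iso hq hE
  refine ⟨⟨E, hE, φ, ?_⟩, ε, hε, ?_⟩
  · obtain ⟨g, hg⟩ : ∃ g, fst G (G ⊗ (G ⊗ Z)) = g := ⟨_, rfl⟩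
    obtain ⟨g', hg'⟩ : ∃ g, snd G (G ⊗ (G ⊗ Z)) ≫ fst G (G ⊗ Z) = g := ⟨_, rfl⟩
    obtain ⟨x, hx⟩ : ∃ x, snd G (G ⊗ (G ⊗ Z)) ≫ snd G (G ⊗ Z) = x := ⟨_, rfl⟩
    obtain ⟨y, hy⟩ : ∃ y, x ≫ orbitFamily G i = y := ⟨_, rfl⟩
    obtain ⟨x', hx'⟩ : ∃ x', leftMul g' x = x' := ⟨_, rfl⟩
    have hy' : x' ≫ orbitFamily G i = g' • y := by rw [← hx', leftMul_orbitFamily, hy]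
    obtain ⟨r, hr⟩ : ∃ r, G ◁ (G ◁ orbitFamily G i) = r := ⟨_, rfl⟩
    have hr' : lift g (lift g' y) = r := by
      rw [← hr, ← hg, ← hg', ← hy, ← hx]
      apply CartesianMonoidalCategory.hom_ext
      · simp
      · apply CartesianMonoidalCategory.hom_ext <;> simp
    obtain ⟨l₁, hl₁⟩ : ∃ l, lift (g * g') y = l := ⟨_, rfl⟩
    obtain ⟨l₂, hl₂⟩ : ∃ l, lift g (g' • y) = l := ⟨_, rfl⟩
    obtain ⟨l₃, hl₃⟩ : ∃ l, lift g' y = l := ⟨_, rfl⟩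
    have r₁ : r ≫ (α_ G G X).inv ≫ μ[G] ▷ X = l₁ := by
      rw [← hl₁, ← hr']
      apply CartesianMonoidalCategory.hom_ext
      · rw [lift_fst, Hom.mul_def]; simp
      · simp
    have r₂ : r ≫ G ◁ γ[G, X] = l₂ := by
      rw [← hl₂, ← hr', Hom.smul_def]; simp
    have r₃ : r ≫ snd G (G ⊗ X) = l₃ := by rw [← hl₃, ← hr', lift_snd]
    obtain ⟨a, ha⟩ : ∃ a, (g • g' • y).left = a := ⟨_, rfl⟩
    obtain ⟨b, hb⟩ : ∃ b, (g' • y).left = b := ⟨_, rfl⟩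
    obtain ⟨d, hd⟩ : ∃ d, y.left = d := ⟨_, rfl⟩
    obtain ⟨c, hc⟩ : ∃ c, x.left ≫ (snd G Z).left = c := ⟨_, rfl⟩
    have a₁ : l₁.left ≫ γ[G, X].left = a := by
      rw [← ha, ← mul_smul]
      exact left_comp_left (by rw [← hl₁, ← Hom.smul_def _ (g * g') y])
    have b₁ : l₁.left ≫ (snd G X).left = d := by
      rw [← hd]
      exact left_comp_left (by rw [← hl₁, lift_snd])
    have a₂ : l₂.left ≫ γ[G, X].left = a := by
      rw [← ha]
      exact left_comp_left (by rw [← hl₂, ← Hom.smul_def _ g])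
    have b₂ : l₂.left ≫ (snd G X).left = b := by
      rw [← hb]
      exact left_comp_left (by rw [← hl₂, lift_snd])
    have a₃ : l₃.left ≫ γ[G, X].left = b := by
      rw [← hb]
      exact left_comp_left (by rw [← hl₃, ← Hom.smul_def _ g' y])
    have b₃ : l₃.left ≫ (snd G X).left = d := by
      rw [← hd]
      exact left_comp_left (by rw [← hl₃, lift_snd])
    have n₁ : (leftMul (g * g') x).left ≫ (orbitFamily G i).left = a := by
      rw [← ha, ← mul_smul, ← hy]
      exact left_comp_left (leftMul_orbitFamily _ _)
    have n₂ : (leftMul g x').left ≫ (orbitFamily G i).left = a := by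
      rw [← ha, ← hy']
      exact left_comp_left (leftMul_orbitFamily _ _)
    have n₃ : x'.left ≫ (orbitFamily G i).left = b := by rw [← hb, left_comp_left hy']
    have n₄ : (leftMul g' x).left ≫ (orbitFamily G i).left = b := by rw [hx', n₃]
    have n₅ : x.left ≫ (orbitFamily G i).left = d := by rw [← hd, left_comp_left hy]
    have c₁ : (leftMul (g * g') x).left ≫ (snd G Z).left = c := by
      rw [← hc, left_comp_left (leftMul_snd _ x)]; rfl
    have c₄ : (leftMul g' x).left ≫ (snd G Z).left = c := by
      rw [← hc, left_comp_left (leftMul_snd _ x)]; rfl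
    have c₃ : x'.left ≫ (snd G Z).left = c := by rw [← hx', c₄]
    have c₂ : (leftMul g x').left ≫ (snd G Z).left = c := by
      rw [← c₃, left_comp_left (leftMul_snd _ x')]; rfl
    have s₁ : r.left ≫ ((G ◁ γ[G, X]) ≫ γ[G, X]).left = a := by
      rw [Over.comp_left, ← Category.assoc, left_comp_left r₂, a₂]
    have s₂ : r.left ≫ (snd G (G ⊗ X) ≫ γ[G, X]).left = b := by
      rw [Over.comp_left, ← Category.assoc, left_comp_left r₃, a₃]
    have s₃ : r.left ≫ (snd G (G ⊗ X) ≫ snd G X).left = d := by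
      rw [Over.comp_left, ← Category.assoc, left_comp_left r₃, b₃]
    have hflat : Flat r.left := by rw [← hr]; infer_instance
    have hsurj : Surjective r.left := by rw [← hr]; infer_instance
    have hqc : QuasiCompact r.left := by rw [← hr]; infer_instance
    apply pullHom_injective_of_fpqc (q := r.left) hE s₁ s₃
    rw [pullHom_pullHom_eq φ.hom _ _ s₁ s₃ (left_comp_left r₁) a₁ b₁, pullHom_comp _ _ _ s₁ s₂ s₃,
      pullHom_pullHom_eq φ.hom _ _ s₁ s₂ (left_comp_left r₂) a₂ b₂,
      pullHom_pullHom_eq φ.hom _ _ s₂ s₃ (left_comp_left r₃) a₃ b₃,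
      hφ (g * g') x ((lift_whiskerLeft_orbitFamily _ x hy).trans hl₁) n₁ n₅ c₁ hc a₁ b₁,
      hφ g x' ((lift_whiskerLeft_orbitFamily _ x' hy').trans hl₂) n₂ n₃ c₂ c₃ a₂ b₂,
      hφ g' x ((lift_whiskerLeft_orbitFamily _ x hy).trans hl₃) n₄ n₅ c₄ hc a₃ b₃]
    exact leftTranslate_mul ε g g' x rfl hx' n₁ n₂ n₃ n₄ n₅ c₁ c₂ c₃ c₄ hc
  · intro T g x y hy a b c ha hb hc hc' ka kb
    have la : (lift g y).left ≫ γ[G, X].left = a := by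
      rw [← ka]
      exact left_comp_left (Hom.smul_def _ g y).symm
    have lb : (lift g y).left ≫ (snd G X).left = b := by
      rw [← kb]
      exact left_comp_left (lift_snd g y)
    exact (VecG.pullHom_iso_hom _ (lift g y) rfl la lb ka kb).symm.trans
      (hφ g x (lift_whiskerLeft_orbitFamily g x hy) ha hb hc hc' la lb)

/-- The restriction of the descended bundle is the original one. -/
lemma IsDescended.nonempty_restrict_iso (hi : IsEquivariant j i) {F : VecG G X}
    {δ : (pullback (orbitFamily G i).left).obj F.sheaf ≅ (pullback (snd G Z).left).obj V.sheaf}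
    (hδ : IsDescended j V δ)
    (hF : ∀ ⦃T : Over S⦄ (g : T ⟶ G) (x : T ⟶ G ⊗ Z) ⦃y : T ⟶ X⦄ (_ : x ≫ orbitFamily G i = y)
        ⦃a b : T.left ⟶ X.left⦄ ⦃c : T.left ⟶ Z.left⦄
        (ha : (leftMul g x).left ≫ (orbitFamily G i).left = a)
        (hb : x.left ≫ (orbitFamily G i).left = b)
        (hc : (leftMul g x).left ≫ (snd G Z).left = c) (hc' : x.left ≫ (snd G Z).left = c)
        (ka : (g • y).left = a) (kb : y.left = b),
        (F.act g y ka kb).hom = (leftTranslate δ g x ha hb hc hc').hom) :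
    Nonempty (hi.restrict.obj F ≅ V) := by
  obtain ⟨s, hs⟩ : ∃ s : Z ⟶ G ⊗ Z, lift 1 (𝟙 Z) = s := ⟨_, rfl⟩
  have s₁ : s ≫ orbitFamily G i = i := by
    rw [← hs, lift_orbitFamily, one_smul, Category.id_comp]
  have s₂ : s ≫ snd G Z = 𝟙 Z := by rw [← hs, lift_snd]
  have t₁ := left_comp_left s₁
  have t₂ : s.left ≫ (snd G Z).left = 𝟙 Z.left := left_comp_left s₂
  let β := pullIso δ s.left t₁ t₂
  let α : (pullback i.left).obj F.sheaf ≅ V.sheaf := β ≪≫ (pullbackId Z.left).app V.sheaf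
  have hα {T : Scheme.{u}} (z : T ⟶ Z.left) {x : T ⟶ (G ⊗ Z).left} {a : T ⟶ X.left}
      (hx : z ≫ s.left = x) (ha : z ≫ i.left = a) (kx : x ≫ (orbitFamily G i).left = a)
      (kz : x ≫ (snd G Z).left = z) :
      (pullback z).map α.hom = (compIso z ha F.sheaf).hom ≫ pullHom δ.hom x kx kz := by
    have h₁ := pullHom_pullHom_eq δ.hom t₁ t₂ ha (Category.comp_id z) hx kx kz
    rw [← h₁, pullHom_eq, Iso.hom_inv_id_assoc, ← map_pullbackId, ← Functor.map_comp]
    rfl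
  clear_value α
  refine ⟨VecG.isoMk α ?_⟩
  obtain ⟨h, hh⟩ : ∃ h, fst H Z = h := ⟨_, rfl⟩
  obtain ⟨z, hz⟩ : ∃ z, snd H Z = z := ⟨_, rfl⟩
  obtain ⟨z', hz'⟩ : ∃ z', γ[H, Z] = z' := ⟨_, rfl⟩
  have hzz : h • z = z' := by
    rw [← hh, ← hz, ← hz', Hom.smul_def, lift_fst_snd, Category.id_comp]
  have hzl : (h • z).left = z'.left := by rw [hzz]
  obtain ⟨g, hg⟩ : ∃ g, h ≫ j = g := ⟨_, rfl⟩
  obtain ⟨y, hy⟩ : ∃ y, z ≫ i = y := ⟨_, rfl⟩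
  obtain ⟨x₁, hx₁⟩ : ∃ x, z' ≫ s = x := ⟨_, rfl⟩
  obtain ⟨x₂, hx₂⟩ : ∃ x, z ≫ s = x := ⟨_, rfl⟩
  obtain ⟨a, ha⟩ : ∃ a, (g • y).left = a := ⟨_, rfl⟩
  obtain ⟨b, hb⟩ : ∃ b, y.left = b := ⟨_, rfl⟩
  have hx₂z : x₂ ≫ snd G Z = z := by rw [← hx₂, Category.assoc, s₂, Category.comp_id]
  have ht : IsTranslate j x₁ (leftMul g x₂) h := by
    constructor
    · rw [leftMul_fst, ← hx₁, ← hx₂, ← hs, hg]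
      simp
    · rw [leftMul_snd, hx₂z, hzz, ← hx₁, Category.assoc, s₂, Category.comp_id]
  have e₁ : leftMul g x₂ ≫ orbitFamily G i = g • y := by
    rw [leftMul_orbitFamily, ← hx₂, Category.assoc, s₁, hy]
  have e₂ : x₂ ≫ orbitFamily G i = y := by rw [← hx₂, Category.assoc, s₁, hy]
  have e₃ : x₁ ≫ orbitFamily G i = g • y := by
    rw [← hx₁, Category.assoc, s₁, ← hy, ← hg, ← hi.smul_comp, hzz]
  have n₁ : (leftMul g x₂).left ≫ (orbitFamily G i).left = a := by rw [left_comp_left e₁, ha]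
  have n₂ : x₂.left ≫ (orbitFamily G i).left = b := by rw [left_comp_left e₂, hb]
  have n₃ : x₁.left ≫ (orbitFamily G i).left = a := by rw [left_comp_left e₃, ha]
  have c₁ : (leftMul g x₂).left ≫ (snd G Z).left = z.left :=
    left_comp_left (by rw [leftMul_snd, hx₂z])
  have c₂ : x₂.left ≫ (snd G Z).left = z.left := left_comp_left hx₂z
  have c₃ : x₁.left ≫ (snd G Z).left = z'.left :=
    left_comp_left (by rw [← hx₁, Category.assoc, s₂, Category.comp_id])
  have ka : z'.left ≫ i.left = a := by
    rw [← ha, ← hy, ← hg, ← hi.smul_comp, hzz]; rfl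
  have kb : z.left ≫ i.left = b := by rw [left_comp_left hy, hb]
  have key := hδ ht (by rw [leftMul_snd, hx₂z]) n₃ n₁ c₃ c₁ hzl rfl
  have hV := VecG.pullHom_iso_hom V (𝟙 (H ⊗ Z)) (g := h) (x := z)
    (by rw [← hh, ← hz, lift_fst_snd]) (a := z'.left) (b := z.left)
    (by rw [← hz']; exact Category.id_comp _) (by rw [← hz]; exact Category.id_comp _) hzl rfl
  have hR := VecG.pullHom_iso_hom (hi.restrict.obj F) (𝟙 (H ⊗ Z)) (g := h) (x := z)
    (by rw [← hh, ← hz, lift_fst_snd]) (a := z'.left) (b := z.left)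
    (by rw [← hz']; exact Category.id_comp _) (by rw [← hz]; exact Category.id_comp _) hzl rfl
  subst hz hz' hg hy
  rw [hi.restrict_act_hom F h (snd H Z) hzl rfl ha hb ka kb] at hR
  have hV' := (pullHom_self V.iso.hom (Category.id_comp _) (Category.id_comp _)).symm.trans hV
  have hR' := (pullHom_self (hi.restrict.obj F).iso.hom (Category.id_comp _)
    (Category.id_comp _)).symm.trans hR
  have h₁ := pullHom_inv_comp_pullHom_hom δ n₂ n₂ c₂ c₂
  have goal : restrHom ka kb (F.act (h ≫ j) (snd H Z ≫ i) ha hb).hom ≫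
      (pullback (snd H Z).left).map α.hom =
        (pullback γ[H, Z].left).map α.hom ≫ (V.act h (snd H Z) hzl rfl).hom := by
    rw [hα _ (left_comp_left hx₁) ka n₃ c₃, hα _ (left_comp_left hx₂) kb n₂ c₂, restrHom_eq,
      hF _ x₂ e₂ n₁ n₂ c₁ c₂ ha hb, leftTranslate_hom, ← key]
    simp only [Category.assoc, Iso.inv_hom_id_assoc]
    rw [h₁, Category.comp_id]
  rw [hV', hR']
  exact goal

end

end EquivBundle
end

noncomputable section

namespace EquivBundle

open Scheme.Modules

variable {S : Scheme.{u}} {G H X Z : Over S} [GrpObj G] [GrpObj H] [ModObj G X] [ModObj H Z]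
  {j : H ⟶ G} {i : Z ⟶ X} [IsMonHom j]

lemma exists_isDescended (hi : IsEquivariant j i)
    (hq : IsTorsor (contractedAction j Z) (orbitFamily G i))
    [LocallyOfFinitePresentation (orbitFamily G i).left] (V : VecG H Z) :
    ∃ (E : X.left.Modules) (_ : IsVectorBundle E)
      (ε : (pullback (orbitFamily G i).left).obj E ≅ (pullback (snd G Z).left).obj V.sheaf),
      IsDescended j V ε := by
  have := hq.flat
  have := hq.surjective
  have := hq.quasiCompact
  obtain ⟨E, hE, ε, hε⟩ := (hq.descentDatum V).exists_descended V.isVectorBundle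
  refine ⟨E, hE, ε, fun T x₁ x₂ t ht z hz a b c h₁ h₂ k₁ k₂ hb hc => ?_⟩
  subst hz k₁ k₂
  have key := hε x₁.left x₂.left (left_comp_left (ht.orbitFamily hi)) h₁ h₂
  rw [hq.descentDatum_map V x₁ x₂ ht _ hb hc] at key
  exact key

theorem restrict_essSurj (hi : IsEquivariant j i)
    (hq : IsTorsor (contractedAction j Z) (orbitFamily G i))
    [LocallyOfFinitePresentation (orbitFamily G i).left] : hi.restrict.EssSurj where
  mem_essImage V := by
    obtain ⟨E, hE, ε, hε⟩ := exists_isDescended hi hq V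
    obtain ⟨F, δ, hδ, hF⟩ := hε.exists_vecG hq hE
    exact ⟨F, hδ.nonempty_restrict_iso hi hF⟩

/-- If the orbit map `G × Z ⟶ X` is a torsor under `H`, then restriction to `Z` is an equivalence
from `G`-equivariant bundles on `X` to `H`-equivariant bundles on `Z`. -/
theorem restrict_isEquivalence (hi : IsEquivariant j i)
    (hq : IsTorsor (contractedAction j Z) (orbitFamily G i))
    [LocallyOfFinitePresentation (orbitFamily G i).left] : hi.restrict.IsEquivalence where
  faithful := by
    have := hq.flat
    have := hq.surjective
    have := hq.quasiCompact
    exact restrict_faithful hi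
  full := restrict_full hi hq
  essSurj := restrict_essSurj hi hq

end EquivBundle
end

theorem lemma5p3 {k : Type u} [Field k] [IsAlgClosed k] [CharZero k]
    (G : Over (Spec (CommRingCat.of k))) [GrpObj G] [IsAffine G.left] [LocallyOfFiniteType G.hom]
    (X : Over (Spec (CommRingCat.of k))) [IsIntegral X.left] [IsSeparated X.hom]
    [LocallyOfFiniteType X.hom] [QuasiCompact X.hom] [ModObj G X]
    (y : 𝟙_ (Over (Spec (CommRingCat.of k))) ⟶ X)
    (Z : Over (Spec (CommRingCat.of k))) [IsIntegral Z.left]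
    [ModObj (EquivBundle.stabilizer G y) Z] (i : Z ⟶ X) [IsClosedImmersion i.left]
    (hi : EquivBundle.IsEquivariant (EquivBundle.stabilizerι G y) i)
    (W : Over (Spec (CommRingCat.of k))) (q : G ⊗ Z ⟶ W)
    (hq : EquivBundle.IsContractedProduct (EquivBundle.stabilizerι G y) Z q)
    (m : W ⟶ X) (hm : q ≫ m = (G ◁ i) ≫ γ[G, X]) [IsIso m] :
    (hi.restrict : EquivBundle.VecG G X ⥤
      EquivBundle.VecG (EquivBundle.stabilizer G y) Z).IsEquivalence := by
  have hT := EquivBundle.IsTorsor.comp_isIso hq m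
  rw [hm] at hT
  have : LocallyOfFiniteType Z.hom := by
    rw [← Over.w i]
    infer_instance
  have := EquivBundle.locallyOfFinitePresentation_left (EquivBundle.orbitFamily G i)
  exact EquivBundle.restrict_isEquivalence hi hT
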